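/- Let $\mathfrak g$ be the $N=2$ Ramond algebra, i.e. the complex Lie superalgebra with even basis elements $L_m,H_m,C$ and odd basis elements $G_m^{\pm}$ ($m\in\mathbb Z$), where $C$ is central and $$[L_m,L_n]=(n-m)L_{m+n}+\tfrac{1}{12}(m^3-m)\delta_{m+n,0}C,\quad [H_m,H_n]=\tfrac13 m\,\delta_{m+n,0}C,\quad [L_m,H_n]=nH_{m+n},$$ $$[L_m,G_p^\pm]=(p-\tfrac m2)G_{m+p}^\pm,\quad [H_m,G_p^\pm]=\pm G_{m+p}^\pm,\quad [G_p^\pm,G_q^\pm]=0,$$ $$[G_p^+,G_q^-]=-2L_{p+q}+(p-q)H_{p+q}+\tfrac13(p^2-\tfrac14)\delta_{p+q,0}C .$$ Modules are $\mathbb Z_2$-graded, $V=V_{\bar 0}\oplus V_{\bar 1}$; submodules are graded, and isomorphisms preserve the grading. For $\lambda\in\mathbb C$ put $V_\lambda=\{v\in V: L_0v=\lambda v\}$. A $\mathfrak g$-module $V$ is cuspidal if $V=\sum_\lambda V_\lambda$ and there is a positive integer $p$ with $\dim (V_\lambda)_\tau\le p$ for all $\lambda\in\mathbb C$ and $\tau\in\mathbb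 Z_2$; the least such $p$ is the length of $V$. For $a,b,c\in\mathbb C$ let $\mathcal R_{a,b,c}$ be the $\mathfrak g$-module with basis $v_i,v_i^{+-}$ (even) and $v_i^+,v_i^-$ (odd), $i\in\mathbb Z$, on which $C$ acts by $0$ and, for all $m,r,i,k\in\mathbb Z$, $$L_m v_i=(a+i+bm)v_{m+i},\qquad L_m v_k^\pm=(a+k+(b-\tfrac12)m)v_{m+k}^\pm,$$ $$H_m v_i=c\,v_{m+i},\qquad H_m v_k^\pm=(c\pm1)v_{m+k}^\pm,$$ $$G_r^\pm v_i=v_{r+i}^\pm,\qquad G_r^\pm v_i^\pm=0,$$ $$L_m v_i^{+-}=(a+i+(b-1)m)v_{m+i}^{+-}+\tfrac12(2b-c-2)m^2v_{i+m},$$ $$H_m v_i^{+-}=c\,v_{m+i}^{+-}-m(2b-c-2)v_{m+i},$$ $$G_r^+v_k^-=v_{k+r}^{+-}+(c+2-2b)r\,v_{k+r},\qquad G_r^-v_k^+=-v_{r+k}^{+-}-(2a+2k+(2b+c)r)v_{k+r},$$ $$G_r^-v_i^{+-}=-(2a+2i+(2b+c-2)r)v_{r+i}^-,\qquad G_r^+v_i^{+-}=(2b-c-2)r\,v_{r+i}^+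 .$$ Then every simple cuspidal $\mathfrak g$-module of length $2$ is isomorphic, up to parity change (interchanging the two parts of the $\mathbb Z_2$-grading), to $\mathcal R_{a,b,c}$ for some $a,b,c\in\mathbb C$ with $2b+c\ne2$ and $2b-c\ne2$. Moreover, for all $a,b,c\in\mathbb C$, the module $\mathcal R_{a,b,c}$ is simple if and only if $2b+c\neq 2$ and $2b-c\ne2$. -/

import Mathlib

/-- A Lie superalgebra structure over `ℂ` on a vector space `A`: a `ℤ/2`-grading
`A = part 0 ⊕ part 1` and an even bilinear bracket that is super-skew-symmetric and satisfies
the super Jacobi identity on homogeneous elements. -/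
class LieSuperalgebra (A : Type*) [AddCommGroup A] [Module ℂ A] where
  part : ZMod 2 → Submodule ℂ A
  isCompl : IsCompl (part 0) (part 1)
  bracket : A →ₗ[ℂ] A →ₗ[ℂ] A
  bracket_mem : ∀ {σ τ : ZMod 2} {x y : A}, x ∈ part σ → y ∈ part τ →
    bracket x y ∈ part (σ + τ)
  bracket_skew : ∀ {σ τ : ZMod 2} {x y : A}, x ∈ part σ → y ∈ part τ →
    bracket y x = -((-1 : ℂ) ^ (σ.val * τ.val) • bracket x y)
  jacobi : ∀ {σ τ ρ : ZMod 2} {x y z : A}, x ∈ part σ → y ∈ part τ → z ∈ part ρ →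
    bracket x (bracket y z) =
      bracket (bracket x y) z + (-1 : ℂ) ^ (σ.val * τ.val) • bracket y (bracket x z)

/-- A module over a Lie superalgebra `A` with underlying vector space `V`: a `ℤ/2`-grading
`V = part 0 ⊕ part 1` and a bilinear action `A × V → V`, compatible with the gradings, with
`x (y v) - (-1)^{|x||y|} y (x v) = [x, y] v` for homogeneous `x`, `y`. -/
structure SuperModule (A : Type*) [AddCommGroup A] [Module ℂ A] [LieSuperalgebra A]
    (V : Type*) [AddCommGroup V] [Module ℂ V] where
  part : ZMod 2 → Submodule ℂ V
  isCompl : IsCompl (part 0) (part 1)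
  act : A →ₗ[ℂ] V →ₗ[ℂ] V
  act_mem : ∀ {σ τ : ZMod 2} {x : A} {v : V}, x ∈ LieSuperalgebra.part σ → v ∈ part τ →
    act x v ∈ part (σ + τ)
  act_bracket : ∀ {σ τ : ZMod 2} {x y : A} (v : V),
    x ∈ LieSuperalgebra.part σ → y ∈ LieSuperalgebra.part τ →
    act x (act y v) - (-1 : ℂ) ^ (σ.val * τ.val) • act y (act x v) =
      act (LieSuperalgebra.bracket x y) v

namespace SuperModule

variable {A : Type*} [AddCommGroup A] [Module ℂ A] [LieSuperalgebra A]
variable {V : Type*} [AddCommGroup V] [Module ℂ V]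
variable {W : Type*} [AddCommGroup W] [Module ℂ W]

/-- The parity change of a module: the same space and action, with the two parts of the
`ℤ/2`-grading interchanged. -/
def parityChange (M : SuperModule A V) : SuperModule A V where
  part τ := M.part (τ + 1)
  isCompl := M.isCompl.symm
  act := M.act
  act_mem := by
    intro σ τ x v hx hv
    rw [add_assoc]
    exact M.act_mem hx hv
  act_bracket := fun v hx hy => M.act_bracket v hx hy

/-- Isomorphism of modules: a linear bijection that preserves parity and commutes with the
action. -/
def Isomorphic (M : SuperModule A V) (N : SuperModule A W) : Prop :=
  ∃ e : V ≃ₗ[ℂ] W, (∀ (τ : ZMod 2) (v : V), v ∈ M.part τ → e v ∈ N.part τ) ∧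
    ∀ (x : A) (v : V), e (M.act x v) = N.act x (e v)

/-- A submodule (sub-object in the category of `ℤ/2`-graded modules): a linear subspace that is
stable under the action and is the sum of its even and odd parts. -/
def IsSubmodule (M : SuperModule A V) (N : Submodule ℂ V) : Prop :=
  (∀ (x : A), ∀ v ∈ N, M.act x v ∈ N) ∧ N = (N ⊓ M.part 0) ⊔ (N ⊓ M.part 1)

/-- A simple module: nonzero, and the only submodules are `0` and the whole module. -/
def IsSimple (M : SuperModule A V) : Prop :=
  Nontrivial V ∧ ∀ N : Submodule ℂ V, M.IsSubmodule N → N = ⊥ ∨ N = ⊤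

end SuperModule

/-- Index set of the basis `L_m, H_m, G_m^+, G_m^-, C` (`m ∈ ℤ`). -/
inductive RamondIndex : Type
  | L (m : ℤ)
  | H (m : ℤ)
  | Gp (m : ℤ)
  | Gm (m : ℤ)
  | C

/-- The underlying vector space of the `N = 2` Ramond algebra: the complex vector space with
basis `L_m, H_m, G_m^+, G_m^-, C` (`m ∈ ℤ`). -/
abbrev Ramond : Type := RamondIndex →₀ ℂ

namespace Ramond

noncomputable section

/-- The basis element `L_m`. -/
def L (m : ℤ) : Ramond := Finsupp.single (RamondIndex.L m) 1
/-- The basis element `H_m`. -/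
def H (m : ℤ) : Ramond := Finsupp.single (RamondIndex.H m) 1
/-- The basis element `G_m^+`. -/
def Gp (m : ℤ) : Ramond := Finsupp.single (RamondIndex.Gp m) 1
/-- The basis element `G_m^-`. -/
def Gm (m : ℤ) : Ramond := Finsupp.single (RamondIndex.Gm m) 1
/-- The central basis element `C`. -/
def C : Ramond := Finsupp.single RamondIndex.C 1

/-- Parity of the basis elements: `L_m, H_m, C` are even, `G_m^+, G_m^-` are odd. -/
def parity : RamondIndex → ZMod 2
  | .L _ => 0
  | .H _ => 0
  | .Gp _ => 1
  | .Gm _ => 1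
  | .C => 0

/-- The brackets of the basis elements.  The central terms form the `2`-cocycle for which the
super Jacobi identity holds: `[L_m, L_n] = (n - m) L_{m+n} + (m^3 - m)/12 δ_{m+n,0} C`. -/
def bracketBasis : RamondIndex → RamondIndex → Ramond
  | .L m, .L n => ((n : ℂ) - m) • L (m + n) +
      (if m + n = 0 then ((m : ℂ) ^ 3 - m) / 12 else 0) • C
  | .L m, .H n => (n : ℂ) • H (m + n)
  | .H m, .L n => -(m : ℂ) • H (m + n)
  | .H m, .H n => (if m + n = 0 then (m : ℂ) / 3 else 0) • C
  | .L m, .Gp p => ((p : ℂ) - m / 2) • Gp (m + p)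
  | .L m, .Gm p => ((p : ℂ) - m / 2) • Gm (m + p)
  | .Gp p, .L m => -((p : ℂ) - m / 2) • Gp (p + m)
  | .Gm p, .L m => -((p : ℂ) - m / 2) • Gm (p + m)
  | .H m, .Gp p => Gp (m + p)
  | .H m, .Gm p => -Gm (m + p)
  | .Gp p, .H m => -Gp (p + m)
  | .Gm p, .H m => Gm (p + m)
  | .Gp p, .Gm q => (-2 : ℂ) • L (p + q) + ((p : ℂ) - q) • H (p + q) +
      (if p + q = 0 then ((p : ℂ) ^ 2 - 1 / 4) / 3 else 0) • C
  | .Gm q, .Gp p => (-2 : ℂ) • L (q + p) + ((p : ℂ) - q) • H (q + p) +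
      (if q + p = 0 then ((p : ℂ) ^ 2 - 1 / 4) / 3 else 0) • C
  | .Gp _, .Gp _ => 0
  | .Gm _, .Gm _ => 0
  | .C, _ => 0
  | _, .C => 0

/-- The bracket, extended bilinearly from the basis. -/
def bracket : Ramond →ₗ[ℂ] Ramond →ₗ[ℂ] Ramond :=
  Finsupp.linearCombination ℂ fun i => Finsupp.linearCombination ℂ fun j => bracketBasis i j

/-- The even and odd parts: the spans of the even and of the odd basis elements. -/
def part (σ : ZMod 2) : Submodule ℂ Ramond := Finsupp.supported ℂ ℂ {i | parity i = σ}

theorem part_eq_span (σ : ZMod 2) :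
    part σ = Submodule.span ℂ ((fun i => Finsupp.single i (1 : ℂ)) '' {i | parity i = σ}) :=
  Finsupp.supported_eq_span_single ℂ _

theorem single_mem_part (i : RamondIndex) : Finsupp.single i (1 : ℂ) ∈ part (parity i) :=
  Finsupp.single_mem_supported ℂ _ rfl

/-- Induction principle for homogeneous elements. -/
theorem part_induction {σ : ZMod 2} {p : Ramond → Prop}
    (h : ∀ i, parity i = σ → p (Finsupp.single i 1)) (h_zero : p 0)
    (h_add : ∀ x y, p x → p y → p (x + y)) (h_smul : ∀ (t : ℂ) x, p x → p (t • x))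
    {x : Ramond} (hx : x ∈ part σ) : p x := by
  rw [part_eq_span] at hx
  induction hx using Submodule.span_induction with
  | mem x hx =>
    obtain ⟨i, hi, rfl⟩ := hx
    exact h i hi
  | zero => exact h_zero
  | add x y _ _ hx hy => exact h_add x y hx hy
  | smul t x _ hx => exact h_smul t x hx

theorem bracket_single (i j : RamondIndex) :
    bracket (Finsupp.single i 1) (Finsupp.single j 1) = bracketBasis i j := by
  simp [bracket]

theorem part_isCompl : IsCompl (part 0) (part 1) := by
  constructor
  · refine Finsupp.disjoint_supported_supported ?_
    rw [Set.disjoint_left]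
    intro i h0 h1
    replace h0 : parity i = 0 := h0
    replace h1 : parity i = 1 := h1
    rw [h0] at h1
    exact absurd h1 (by decide)
  · refine Finsupp.codisjoint_supported_supported ?_
    refine codisjoint_iff.2 (Set.eq_univ_of_forall fun i => ?_)
    change parity i = 0 ∨ parity i = 1
    cases i <;> simp [parity]

theorem L_mem (m : ℤ) : L m ∈ part 0 := single_mem_part (.L m)
theorem H_mem (m : ℤ) : H m ∈ part 0 := single_mem_part (.H m)
theorem Gp_mem (m : ℤ) : Gp m ∈ part 1 := single_mem_part (.Gp m)
theorem Gm_mem (m : ℤ) : Gm m ∈ part 1 := single_mem_part (.Gm m)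
theorem C_mem : C ∈ part 0 := single_mem_part .C

theorem bracketBasis_mem (i j : RamondIndex) : bracketBasis i j ∈ part (parity i + parity j) := by
  have h2 : (1 + 1 : ZMod 2) = 0 := by decide
  cases i <;> cases j <;> simp only [bracketBasis, parity, add_zero, zero_add, h2] <;>
    (repeat' first
    | with_reducible exact Submodule.zero_mem _
    | with_reducible exact L_mem _
    | with_reducible exact H_mem _
    | with_reducible exact Gp_mem _
    | with_reducible exact Gm_mem _
    | with_reducible exact C_mem
    | with_reducible apply Submodule.add_mem
    | with_reducible apply Submodule.neg_mem
    | with_reducible apply Submodule.smul_mem)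

theorem bracketBasis_skew (i j : RamondIndex) :
    bracketBasis j i =
      -((-1 : ℂ) ^ ((parity i).val * (parity j).val) • bracketBasis i j) := by
  have h1 : (1 : ZMod 2).val = 1 := rfl
  cases i <;> cases j <;>
    simp only [bracketBasis, parity, ZMod.val_zero, h1, mul_zero, mul_one, pow_zero,
      pow_one, one_smul, neg_smul, neg_neg, neg_zero, smul_zero]
  case L.L m n =>
    rw [add_comm n m]
    by_cases h : m + n = 0
    · obtain rfl : n = -m := by omega
      simp only [h, if_true]
      push_cast
      module
    · simp only [h, if_false]
      module
  case H.H m n =>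
    rw [add_comm n m]
    by_cases h : m + n = 0
    · obtain rfl : n = -m := by omega
      simp only [h, if_true]
      push_cast
      module
    · simp only [h, if_false]
      module
  all_goals simp only [Int.add_comm]

section Rules

variable (m n : ℤ)

theorem bracket_L_L : bracket (L m) (L n) = ((n : ℂ) - m) • L (m + n) +
    (if m + n = 0 then ((m : ℂ) ^ 3 - m) / 12 else 0) • C := bracket_single _ _
theorem bracket_L_H : bracket (L m) (H n) = (n : ℂ) • H (m + n) := bracket_single _ _
theorem bracket_H_L : bracket (H m) (L n) = -(m : ℂ) • H (m + n) := bracket_single _ _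
theorem bracket_H_H : bracket (H m) (H n) = (if m + n = 0 then (m : ℂ) / 3 else 0) • C :=
  bracket_single _ _
theorem bracket_L_Gp : bracket (L m) (Gp n) = ((n : ℂ) - m / 2) • Gp (m + n) :=
  bracket_single _ _
theorem bracket_L_Gm : bracket (L m) (Gm n) = ((n : ℂ) - m / 2) • Gm (m + n) :=
  bracket_single _ _
theorem bracket_Gp_L : bracket (Gp m) (L n) = -((m : ℂ) - n / 2) • Gp (m + n) :=
  bracket_single _ _
theorem bracket_Gm_L : bracket (Gm m) (L n) = -((m : ℂ) - n / 2) • Gm (m + n) :=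
  bracket_single _ _
theorem bracket_H_Gp : bracket (H m) (Gp n) = Gp (m + n) := bracket_single _ _
theorem bracket_H_Gm : bracket (H m) (Gm n) = -Gm (m + n) := bracket_single _ _
theorem bracket_Gp_H : bracket (Gp m) (H n) = -Gp (m + n) := bracket_single _ _
theorem bracket_Gm_H : bracket (Gm m) (H n) = Gm (m + n) := bracket_single _ _
theorem bracket_Gp_Gm : bracket (Gp m) (Gm n) =
    (-2 : ℂ) • L (m + n) + ((m : ℂ) - n) • H (m + n) +
      (if m + n = 0 then ((m : ℂ) ^ 2 - 1 / 4) / 3 else 0) • C := bracket_single _ _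
theorem bracket_Gm_Gp : bracket (Gm m) (Gp n) =
    (-2 : ℂ) • L (m + n) + ((n : ℂ) - m) • H (m + n) +
      (if m + n = 0 then ((n : ℂ) ^ 2 - 1 / 4) / 3 else 0) • C := bracket_single _ _
theorem bracket_Gp_Gp : bracket (Gp m) (Gp n) = 0 := bracket_single _ _
theorem bracket_Gm_Gm : bracket (Gm m) (Gm n) = 0 := bracket_single _ _

theorem bracket_C_left (x : Ramond) : bracket C x = 0 := by
  have : bracket C = 0 := by
    refine Finsupp.lhom_ext' fun j => LinearMap.ext_ring ?_
    change bracket (Finsupp.single .C 1) (Finsupp.single j 1) = 0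
    rw [bracket_single]
    cases j <;> rfl
  rw [this, LinearMap.zero_apply]

theorem bracket_C_right (x : Ramond) : bracket x C = 0 := by
  have : bracket.flip C = 0 := by
    refine Finsupp.lhom_ext' fun j => LinearMap.ext_ring ?_
    change bracket (Finsupp.single j 1) (Finsupp.single .C 1) = 0
    rw [bracket_single]
    cases j <;> rfl
  have h := LinearMap.congr_fun this x
  simpa using h

end Rules

set_option maxHeartbeats 4000000 in
theorem jacobi_basis (i j k : RamondIndex) :
    bracket (Finsupp.single i 1) (bracket (Finsupp.single j 1) (Finsupp.single k 1)) =
      bracket (bracket (Finsupp.single i 1) (Finsupp.single j 1)) (Finsupp.single k 1) +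
      (-1 : ℂ) ^ ((parity i).val * (parity j).val) •
        bracket (Finsupp.single j 1) (bracket (Finsupp.single i 1) (Finsupp.single k 1)) := by
  have h1 : (1 : ZMod 2).val = 1 := rfl
  have hL : ∀ m, Finsupp.single (RamondIndex.L m) (1 : ℂ) = L m := fun _ => rfl
  have hH : ∀ m, Finsupp.single (RamondIndex.H m) (1 : ℂ) = H m := fun _ => rfl
  have hGp : ∀ m, Finsupp.single (RamondIndex.Gp m) (1 : ℂ) = Gp m := fun _ => rfl
  have hGm : ∀ m, Finsupp.single (RamondIndex.Gm m) (1 : ℂ) = Gm m := fun _ => rfl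
  have hC : Finsupp.single RamondIndex.C (1 : ℂ) = C := rfl
  rcases i with l | l | l | l | _ <;> rcases j with m | m | m | m | _ <;>
  rcases k with n | n | n | n | _ <;>
  simp only [hL, hH, hGp, hGm, hC, parity, ZMod.val_zero, h1, mul_zero, mul_one,
    pow_zero, pow_one, bracket_L_L, bracket_L_H, bracket_H_L, bracket_H_H, bracket_L_Gp,
    bracket_L_Gm, bracket_Gp_L, bracket_Gm_L, bracket_H_Gp, bracket_H_Gm, bracket_Gp_H,
    bracket_Gm_H, bracket_Gp_Gm, bracket_Gm_Gp, bracket_Gp_Gp, bracket_Gm_Gm, bracket_C_left,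
    bracket_C_right, map_add, map_smul, map_neg, map_zero, LinearMap.add_apply,
    LinearMap.smul_apply, LinearMap.neg_apply, LinearMap.zero_apply, smul_zero, add_zero,
    zero_add, neg_zero, Int.add_left_comm,
    Int.add_comm] <;>
  (by_cases h : l + (m + n) = 0
   · obtain rfl : n = -l - m := by omega
     try simp only [h, if_true]
     push_cast
     module
   · try simp only [h, if_false]
     push_cast
     module)

noncomputable instance : LieSuperalgebra Ramond where
  part := part
  isCompl := part_isCompl
  bracket := bracket
  bracket_mem := by
    intro σ τ x y hx hy
    refine part_induction (p := fun x => bracket x y ∈ part (σ + τ)) ?_ ?_ ?_ ?_ hx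
    · intro i hi
      refine part_induction (p := fun y => bracket _ y ∈ part (σ + τ)) ?_ ?_ ?_ ?_ hy
      · intro j hj
        rw [bracket_single, ← hi, ← hj]
        exact bracketBasis_mem i j
      · rw [map_zero]; exact Submodule.zero_mem _
      · intro y z hy hz; rw [map_add]; exact Submodule.add_mem _ hy hz
      · intro t y hy; rw [map_smul]; exact Submodule.smul_mem _ _ hy
    · rw [map_zero]; exact Submodule.zero_mem _
    · intro y z hy hz; rw [map_add]; exact Submodule.add_mem _ hy hz
    · intro t y hy; rw [map_smul]; exact Submodule.smul_mem _ _ hy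
  bracket_skew := by
    intro σ τ x y hx hy
    refine part_induction (p := fun x => bracket y x = -(_ • bracket x y)) ?_ ?_ ?_ ?_ hx
    · intro i hi
      refine part_induction (p := fun y => bracket y _ = -(_ • bracket _ y)) ?_ ?_ ?_ ?_ hy
      · intro j hj
        rw [bracket_single, bracket_single, ← hi, ← hj]
        exact bracketBasis_skew i j
      · simp
      · intro y z hy hz; simp only [map_add, LinearMap.add_apply, hy, hz]; module
      · intro t y hy; simp only [map_smul, LinearMap.smul_apply, hy]; module
    · simp
    · intro y z hy hz; simp only [map_add, LinearMap.add_apply, hy, hz]; module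
    · intro t y hy; simp only [map_smul, LinearMap.smul_apply, hy]; module
  jacobi := by
    intro σ τ ρ x y z hx hy hz
    refine part_induction (p := fun x => bracket x (bracket y z) =
      bracket (bracket x y) z + _ • bracket y (bracket x z)) ?_ ?_ ?_ ?_ hx
    · intro i hi
      refine part_induction (p := fun y => bracket _ (bracket y z) =
        bracket (bracket _ y) z + _ • bracket y (bracket _ z)) ?_ ?_ ?_ ?_ hy
      · intro j hj
        refine part_induction (p := fun z => bracket _ (bracket _ z) =
          bracket (bracket _ _) z + _ • bracket _ (bracket _ z)) ?_ ?_ ?_ ?_ hz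
        · intro k _
          rw [← hi, ← hj]
          exact jacobi_basis i j k
        · simp
        · intro y z hy hz; simp only [map_add, hy, hz]; module
        · intro t y hy; simp only [map_smul, hy]; module
      · simp
      · intro y z hy hz; simp only [map_add, LinearMap.add_apply, hy, hz]; module
      · intro t y hy; simp only [map_smul, LinearMap.smul_apply, hy]; module
    · simp
    · intro y z hy hz; simp only [map_add, LinearMap.add_apply, hy, hz]; module
    · intro t y hy; simp only [map_smul, LinearMap.smul_apply, hy]; module

end

end Ramond

namespace SuperModule

section Cuspidal

variable {V : Type*} [AddCommGroup V] [Module ℂ V]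

/-- The weight space `V_μ = {v | L_0 v = μ v}`. -/
noncomputable def weightSpace (M : SuperModule Ramond V) (μ : ℂ) : Submodule ℂ V :=
  Module.End.eigenspace (M.act (Ramond.L 0)) μ

/-- A weight module: the sum of its weight spaces. -/
def IsWeight (M : SuperModule Ramond V) : Prop := ⨆ μ : ℂ, M.weightSpace μ = ⊤

/-- `p` is a positive integer with `dim (V_μ)_τ ≤ p` for all weights `μ` and parities `τ`. -/
def IsDimBound (M : SuperModule Ramond V) (p : ℕ) : Prop :=
  0 < p ∧ ∀ (μ : ℂ) (τ : ZMod 2),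
    Module.rank ℂ (M.weightSpace μ ⊓ M.part τ : Submodule ℂ V) ≤ p

/-- A cuspidal module: a weight module with uniformly bounded homogeneous weight spaces. -/
def IsCuspidal (M : SuperModule Ramond V) : Prop := M.IsWeight ∧ ∃ p : ℕ, M.IsDimBound p

/-- The cuspidal module `M` has length `n`: `n` is the least uniform bound. -/
def HasLength (M : SuperModule Ramond V) (n : ℕ) : Prop := IsLeast {p : ℕ | M.IsDimBound p} n

end Cuspidal

end SuperModule

/-- Index set of the basis `v_i, v_i^+, v_i^-, v_i^{+-}` (`i ∈ ℤ`). -/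
inductive RModIndex : Type
  | v (i : ℤ)
  | vp (i : ℤ)
  | vm (i : ℤ)
  | vpm (i : ℤ)

/-- The complex vector space with basis `v_i, v_i^+, v_i^-, v_i^{+-}` (`i ∈ ℤ`). -/
abbrev RSpace : Type := RModIndex →₀ ℂ

namespace RSpace

noncomputable section

/-- The basis vector `v_i`. -/
def v (i : ℤ) : RSpace := Finsupp.single (RModIndex.v i) 1
/-- The basis vector `v_i^+`. -/
def vp (i : ℤ) : RSpace := Finsupp.single (RModIndex.vp i) 1
/-- The basis vector `v_i^-`. -/
def vm (i : ℤ) : RSpace := Finsupp.single (RModIndex.vm i) 1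
/-- The basis vector `v_i^{+-}`. -/
def vpm (i : ℤ) : RSpace := Finsupp.single (RModIndex.vpm i) 1

/-- Parity of the basis vectors: `v_i, v_i^{+-}` are even, `v_i^+, v_i^-` are odd. -/
def parity : RModIndex → ZMod 2
  | .v _ => 0
  | .vp _ => 1
  | .vm _ => 1
  | .vpm _ => 0

/-- The even and odd parts: the spans of the even and of the odd basis vectors. -/
def part (τ : ZMod 2) : Submodule ℂ RSpace := Finsupp.supported ℂ ℂ {k | parity k = τ}

/-- The action of the basis elements of the Ramond algebra on the basis vectors. -/
def actBasis (a b c : ℂ) : RamondIndex → RModIndex → RSpace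
  | .L m, .v i => (a + i + b * m) • v (m + i)
  | .L m, .vp k => (a + k + (b - 1 / 2) * m) • vp (m + k)
  | .L m, .vm k => (a + k + (b - 1 / 2) * m) • vm (m + k)
  | .L m, .vpm i => (a + i + (b - 1) * m) • vpm (m + i) +
      (1 / 2 * (2 * b - c - 2) * (m : ℂ) ^ 2) • v (m + i)
  | .H m, .v i => c • v (m + i)
  | .H m, .vp k => (c + 1) • vp (m + k)
  | .H m, .vm k => (c - 1) • vm (m + k)
  | .H m, .vpm i => c • vpm (m + i) - ((m : ℂ) * (2 * b - c - 2)) • v (m + i)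
  | .Gp r, .v i => vp (r + i)
  | .Gp _, .vp _ => 0
  | .Gp r, .vm k => vpm (r + k) + ((c + 2 - 2 * b) * r) • v (r + k)
  | .Gp r, .vpm i => ((2 * b - c - 2) * r) • vp (r + i)
  | .Gm r, .v i => vm (r + i)
  | .Gm r, .vp k => -vpm (r + k) - (2 * a + 2 * k + (2 * b + c) * r) • v (r + k)
  | .Gm _, .vm _ => 0
  | .Gm r, .vpm i => -(2 * a + 2 * i + (2 * b + c - 2) * r) • vm (r + i)
  | .C, _ => 0

/-- The action, extended bilinearly from the bases. -/
def act (a b c : ℂ) : Ramond →ₗ[ℂ] RSpace →ₗ[ℂ] RSpace :=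
  Finsupp.linearCombination ℂ fun x => Finsupp.linearCombination ℂ fun k => actBasis a b c x k

theorem act_single (a b c : ℂ) (x : RamondIndex) (k : RModIndex) :
    act a b c (Finsupp.single x 1) (Finsupp.single k 1) = actBasis a b c x k := by
  simp [act]

theorem single_mem_part (k : RModIndex) : Finsupp.single k (1 : ℂ) ∈ part (parity k) :=
  Finsupp.single_mem_supported ℂ _ rfl

theorem part_induction {τ : ZMod 2} {p : RSpace → Prop}
    (h : ∀ k, parity k = τ → p (Finsupp.single k 1)) (h_zero : p 0)
    (h_add : ∀ x y, p x → p y → p (x + y)) (h_smul : ∀ (t : ℂ) x, p x → p (t • x))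
    {x : RSpace} (hx : x ∈ part τ) : p x := by
  rw [part, Finsupp.supported_eq_span_single] at hx
  induction hx using Submodule.span_induction with
  | mem x hx =>
    obtain ⟨i, hi, rfl⟩ := hx
    exact h i hi
  | zero => exact h_zero
  | add x y _ _ hx hy => exact h_add x y hx hy
  | smul t x _ hx => exact h_smul t x hx

theorem part_isCompl : IsCompl (part 0) (part 1) := by
  constructor
  · refine Finsupp.disjoint_supported_supported ?_
    rw [Set.disjoint_left]
    intro i h0 h1
    replace h0 : parity i = 0 := h0
    replace h1 : parity i = 1 := h1
    rw [h0] at h1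
    exact absurd h1 (by decide)
  · refine Finsupp.codisjoint_supported_supported ?_
    refine codisjoint_iff.2 (Set.eq_univ_of_forall fun i => ?_)
    change parity i = 0 ∨ parity i = 1
    cases i <;> simp [parity]

theorem v_mem (i : ℤ) : v i ∈ part 0 := single_mem_part (.v i)
theorem vp_mem (i : ℤ) : vp i ∈ part 1 := single_mem_part (.vp i)
theorem vm_mem (i : ℤ) : vm i ∈ part 1 := single_mem_part (.vm i)
theorem vpm_mem (i : ℤ) : vpm i ∈ part 0 := single_mem_part (.vpm i)

theorem actBasis_mem (a b c : ℂ) (x : RamondIndex) (k : RModIndex) :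
    actBasis a b c x k ∈ part (Ramond.parity x + parity k) := by
  have h2 : (1 + 1 : ZMod 2) = 0 := by decide
  cases x <;> cases k <;>
    simp only [actBasis, Ramond.parity, parity, add_zero, zero_add, h2] <;>
    (repeat' first
    | with_reducible exact Submodule.zero_mem _
    | with_reducible exact v_mem _
    | with_reducible exact vp_mem _
    | with_reducible exact vm_mem _
    | with_reducible exact vpm_mem _
    | with_reducible apply Submodule.add_mem
    | with_reducible apply Submodule.sub_mem
    | with_reducible apply Submodule.neg_mem
    | with_reducible apply Submodule.smul_mem)

section Rules

variable (a b c : ℂ) (m i : ℤ)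

theorem act_L_v : act a b c (Ramond.L m) (v i) = (a + i + b * m) • v (m + i) := act_single ..
theorem act_L_vp : act a b c (Ramond.L m) (vp i) = (a + i + (b - 1 / 2) * m) • vp (m + i) :=
  act_single ..
theorem act_L_vm : act a b c (Ramond.L m) (vm i) = (a + i + (b - 1 / 2) * m) • vm (m + i) :=
  act_single ..
theorem act_L_vpm : act a b c (Ramond.L m) (vpm i) = (a + i + (b - 1) * m) • vpm (m + i) +
    (1 / 2 * (2 * b - c - 2) * (m : ℂ) ^ 2) • v (m + i) := act_single ..
theorem act_H_v : act a b c (Ramond.H m) (v i) = c • v (m + i) := act_single ..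
theorem act_H_vp : act a b c (Ramond.H m) (vp i) = (c + 1) • vp (m + i) := act_single ..
theorem act_H_vm : act a b c (Ramond.H m) (vm i) = (c - 1) • vm (m + i) := act_single ..
theorem act_H_vpm : act a b c (Ramond.H m) (vpm i) =
    c • vpm (m + i) - ((m : ℂ) * (2 * b - c - 2)) • v (m + i) := act_single ..
theorem act_Gp_v : act a b c (Ramond.Gp m) (v i) = vp (m + i) := act_single ..
theorem act_Gp_vp : act a b c (Ramond.Gp m) (vp i) = 0 := act_single ..
theorem act_Gp_vm : act a b c (Ramond.Gp m) (vm i) =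
    vpm (m + i) + ((c + 2 - 2 * b) * m) • v (m + i) := act_single ..
theorem act_Gp_vpm : act a b c (Ramond.Gp m) (vpm i) =
    ((2 * b - c - 2) * m) • vp (m + i) := act_single ..
theorem act_Gm_v : act a b c (Ramond.Gm m) (v i) = vm (m + i) := act_single ..
theorem act_Gm_vp : act a b c (Ramond.Gm m) (vp i) =
    -vpm (m + i) - (2 * a + 2 * i + (2 * b + c) * m) • v (m + i) := act_single ..
theorem act_Gm_vm : act a b c (Ramond.Gm m) (vm i) = 0 := act_single ..
theorem act_Gm_vpm : act a b c (Ramond.Gm m) (vpm i) =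
    -(2 * a + 2 * i + (2 * b + c - 2) * m) • vm (m + i) := act_single ..

theorem act_C (x : RSpace) : act a b c Ramond.C x = 0 := by
  have : act a b c Ramond.C = 0 := by
    refine Finsupp.lhom_ext' fun j => LinearMap.ext_ring ?_
    change act a b c (Finsupp.single .C 1) (Finsupp.single j 1) = 0
    rw [act_single]
    cases j <;> rfl
  rw [this, LinearMap.zero_apply]

end Rules

set_option maxHeartbeats 4000000 in
theorem act_bracket_basis (a b c : ℂ) (x y : RamondIndex) (k : RModIndex) :
    act a b c (Finsupp.single x 1) (act a b c (Finsupp.single y 1) (Finsupp.single k 1)) -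
      (-1 : ℂ) ^ ((Ramond.parity x).val * (Ramond.parity y).val) •
        act a b c (Finsupp.single y 1) (act a b c (Finsupp.single x 1) (Finsupp.single k 1)) =
      act a b c (Ramond.bracketBasis x y) (Finsupp.single k 1) := by
  have h1 : (1 : ZMod 2).val = 1 := rfl
  have hL : ∀ m, Finsupp.single (RamondIndex.L m) (1 : ℂ) = Ramond.L m := fun _ => rfl
  have hH : ∀ m, Finsupp.single (RamondIndex.H m) (1 : ℂ) = Ramond.H m := fun _ => rfl
  have hGp : ∀ m, Finsupp.single (RamondIndex.Gp m) (1 : ℂ) = Ramond.Gp m := fun _ => rfl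
  have hGm : ∀ m, Finsupp.single (RamondIndex.Gm m) (1 : ℂ) = Ramond.Gm m := fun _ => rfl
  have hC : Finsupp.single RamondIndex.C (1 : ℂ) = Ramond.C := rfl
  have h_v : ∀ m, Finsupp.single (RModIndex.v m) (1 : ℂ) = v m := fun _ => rfl
  have h_vp : ∀ m, Finsupp.single (RModIndex.vp m) (1 : ℂ) = vp m := fun _ => rfl
  have h_vm : ∀ m, Finsupp.single (RModIndex.vm m) (1 : ℂ) = vm m := fun _ => rfl
  have h_vpm : ∀ m, Finsupp.single (RModIndex.vpm m) (1 : ℂ) = vpm m := fun _ => rfl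
  rcases x with l | l | l | l | _ <;> rcases y with m | m | m | m | _ <;>
  rcases k with n | n | n | n <;>
  simp only [hL, hH, hGp, hGm, hC, h_v, h_vp, h_vm, h_vpm, Ramond.bracketBasis, Ramond.parity,
    ZMod.val_zero, h1, mul_zero, mul_one, pow_zero, pow_one, act_L_v, act_L_vp,
    act_L_vm, act_L_vpm, act_H_v, act_H_vp, act_H_vm, act_H_vpm, act_Gp_v, act_Gp_vp, act_Gp_vm,
    act_Gp_vpm, act_Gm_v, act_Gm_vp, act_Gm_vm, act_Gm_vpm, act_C, map_add, map_sub, map_smul,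
    map_neg, map_zero, LinearMap.add_apply, LinearMap.smul_apply, LinearMap.neg_apply,
    LinearMap.zero_apply, smul_zero, add_zero, sub_zero, Int.add_left_comm,
    Int.add_comm] <;>
  push_cast <;> module

end

end RSpace

/-- The module `R_{a,b,c}` over the `N = 2` Ramond algebra. -/
noncomputable def RModule (a b c : ℂ) : SuperModule Ramond RSpace where
  part := RSpace.part
  isCompl := RSpace.part_isCompl
  act := RSpace.act a b c
  act_mem := by
    intro σ τ x v hx hv
    refine Ramond.part_induction (p := fun x => RSpace.act a b c x v ∈ RSpace.part (σ + τ))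
      ?_ ?_ ?_ ?_ hx
    · intro i hi
      refine RSpace.part_induction (p := fun v => RSpace.act a b c _ v ∈ RSpace.part (σ + τ))
        ?_ ?_ ?_ ?_ hv
      · intro j hj
        rw [RSpace.act_single, ← hi, ← hj]
        exact RSpace.actBasis_mem a b c i j
      · rw [map_zero]; exact Submodule.zero_mem _
      · intro y z hy hz; rw [map_add]; exact Submodule.add_mem _ hy hz
      · intro t y hy; rw [map_smul]; exact Submodule.smul_mem _ _ hy
    · rw [map_zero]; exact Submodule.zero_mem _
    · intro y z hy hz; rw [map_add]; exact Submodule.add_mem _ hy hz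
    · intro t y hy; rw [map_smul]; exact Submodule.smul_mem _ _ hy
  act_bracket := by
    intro σ τ x y v hx hy
    change _ = RSpace.act a b c (Ramond.bracket x y) v
    refine Ramond.part_induction (p := fun x => RSpace.act a b c x (RSpace.act a b c y v) -
      _ • RSpace.act a b c y (RSpace.act a b c x v) = RSpace.act a b c (Ramond.bracket x y) v)
      ?_ ?_ ?_ ?_ hx
    · intro i hi
      refine Ramond.part_induction (p := fun y => RSpace.act a b c _ (RSpace.act a b c y v) -
        _ • RSpace.act a b c y (RSpace.act a b c _ v) = RSpace.act a b c (Ramond.bracket _ y) v)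
        ?_ ?_ ?_ ?_ hy
      · intro j hj
        rw [Ramond.bracket_single, ← hi, ← hj]
        induction v using Finsupp.induction_linear with
        | zero => simp
        | add f g hf hg => simp only [map_add, ← hf, ← hg]; module
        | single k t =>
          have hk : Finsupp.single k t = t • Finsupp.single k (1 : ℂ) := by simp
          rw [hk]
          simp only [map_smul, ← RSpace.act_bracket_basis a b c i j k]
          module
      · simp
      · intro y z hy hz; simp only [map_add, LinearMap.add_apply, ← hy, ← hz]; module
      · intro t y hy; simp only [map_smul, LinearMap.smul_apply, ← hy]; module
    · simp
    · intro y z hy hz; simp only [map_add, LinearMap.add_apply, ← hy, ← hz]; module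
    · intro t y hy; simp only [map_smul, LinearMap.smul_apply, ← hy]; module

/-!
On a simple cuspidal module the central element acts by zero, because a Heisenberg algebra of
nonzero level has no representation with bounded weight spaces. Only finitely many eigenvalues of
`H_0` (charges) occur, so the vectors of largest charge are killed by all `G_m^+` and those of
smallest charge by all `G_m^-`. The vectors of such an extremal nonzero charge `c` form a
representation of the Heisenberg–Virasoro algebra, which contains a density family
`L_m y_i = (a + i + b m) y_{m+i}`, `H_m y_i = c y_{m+i}`. From it one obtains a family `x` transforming under
`L_m` and `H_m` like the vectors `v_i` of `R_{a,b,c}`, and for which `G_m^± x_i` depends only on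
`m + i`. The commutation relations then determine the action on the span of the vectors `x_i`,
`G_0^± x_i` and `G_0^+ G_0^- x_i`, which is thus a quotient of `R_{a,b,c}`.

If `2b + c ≠ 2` and `2b - c ≠ 2`, every nonzero weight vector of `R_{a,b,c}` leads back to the
`v_i`, so the module is simple and the quotient is `R_{a,b,c}` itself. Otherwise half of the basis
spans a submodule, and in a simple quotient the graded parts of the weight spaces are at most
one-dimensional.
-/

open Module

section LinearAlgebra

variable {K V : Type*} [Field K] [AddCommGroup V] [Module K V]

theorem mem_of_sum_eigenvectors_mem {f : End K V} {p : Submodule K V} (hp : p ≤ p.comap f)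
    {s : Finset K} {g : K → V} (hg : ∀ μ, g μ ∈ f.eigenspace μ) (hs : ∑ μ ∈ s, g μ ∈ p)
    {ν : K} (hν : ν ∈ s) : g ν ∈ p := by
  classical
  -- The Lagrange polynomial of `ν` in `f` projects the sum onto its `ν`-component.
  have hproj : Polynomial.aeval f (Lagrange.basis s id ν) (∑ μ ∈ s, g μ) = g ν := by
    rw [map_sum, Finset.sum_eq_single_of_mem ν hν fun μ hμ hμν => ?_]
    · rw [End.aeval_apply_of_mem_apply_eq_smul (End.mem_eigenspace_iff.1 (hg ν))]
      simpa using congrArg (· • g ν) (Lagrange.eval_basis_self (v := id) (Set.injOn_id _) hν)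
    · rw [End.aeval_apply_of_mem_apply_eq_smul (End.mem_eigenspace_iff.1 (hg μ))]
      simpa using congrArg (· • g μ) (Lagrange.eval_basis_of_ne (v := id) hμν.symm hμ)
  exact hproj ▸ Polynomial.aeval_apply_smul_mem_of_le_comap hs _ f hp

theorem le_iSup_inf_eigenspace {f : End K V} (hf : ⨆ μ, f.eigenspace μ = ⊤)
    {p : Submodule K V} (hp : p ≤ p.comap f) : p ≤ ⨆ μ, p ⊓ f.eigenspace μ := by
  intro x hx
  obtain ⟨g, hg, rfl⟩ := (Submodule.mem_iSup_iff_exists_finsupp _ x).1 (hf ▸ Submodule.mem_top)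
  exact Submodule.sum_mem _ fun μ hμ =>
    Submodule.mem_iSup_of_mem μ ⟨mem_of_sum_eigenvectors_mem hp hg hx hμ, hg μ⟩

theorem exists_eigenvector_mem {f : End K V} (hf : ⨆ μ, f.eigenspace μ = ⊤)
    {p : Submodule K V} (hp : p ≤ p.comap f) (h : p ≠ ⊥) :
    ∃ μ : K, ∃ v ∈ p, v ≠ 0 ∧ f v = μ • v := by
  contrapose! h
  refine eq_bot_iff.2 ((le_iSup_inf_eigenspace hf hp).trans (iSup_le fun μ v hv => ?_))
  by_contra hv0
  exact h μ v hv.1 hv0 (End.mem_eigenspace_iff.1 hv.2)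

theorem iSup_eigenspace_restrict_eq_top {f : End K V} (hf : ⨆ μ, f.eigenspace μ = ⊤)
    {p : Submodule K V} (hp : ∀ x ∈ p, f x ∈ p) :
    ⨆ μ, End.eigenspace (f.restrict hp) μ = ⊤ := by
  refine Submodule.map_injective_of_injective p.injective_subtype ?_
  rw [Submodule.map_iSup, Submodule.map_top, Submodule.range_subtype]
  refine le_antisymm (iSup_le fun μ => Submodule.map_subtype_le p _)
    ((le_iSup_inf_eigenspace hf hp).trans (iSup_mono fun μ x hx => ⟨⟨x, hx.1⟩, ?_, rfl⟩))
  exact End.mem_eigenspace_iff.2 (Subtype.ext (End.mem_eigenspace_iff.1 hx.2))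

theorem inf_eigenspace_stable_of_commute {f g : End K V} (hfg : Commute f g) {U : Submodule K V}
    (hgU : ∀ v ∈ U, g v ∈ U) (t : K) : ∀ v ∈ U ⊓ f.eigenspace t, g v ∈ U ⊓ f.eigenspace t :=
  fun v hv => ⟨hgU v hv.1, End.mapsTo_genEigenspace_of_comm hfg t 1 hv.2⟩

/-- If some member of the family is not a scalar on `U`, pass to one of its eigenspaces in `U`. -/
theorem exists_common_eigenvector [IsAlgClosed K] {ι : Type*} {f : ι → End K V}
    (hf : ∀ i j, Commute (f i) (f j)) (U : Submodule K V) [FiniteDimensional K U] (hU : U ≠ ⊥)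
    (hfU : ∀ i, ∀ v ∈ U, f i v ∈ U) : ∃ v ∈ U, v ≠ 0 ∧ ∀ i, ∃ t : K, f i v = t • v := by
  obtain ⟨d, hd⟩ : ∃ d, finrank K U = d := ⟨_, rfl⟩
  induction d using Nat.strong_induction_on generalizing U with
  | _ d ih =>
    by_cases h : ∀ i, ∃ t : K, ∀ v ∈ U, f i v = t • v
    · obtain ⟨v, hv, hv0⟩ := (Submodule.ne_bot_iff _).1 hU
      exact ⟨v, hv, hv0, fun i => (h i).imp fun t ht => ht v hv⟩
    · push Not at h
      obtain ⟨i, hi⟩ := h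
      have : Nontrivial U := Submodule.nontrivial_iff_ne_bot.2 hU
      obtain ⟨t, ht⟩ := End.exists_eigenvalue ((f i).restrict (hfU i))
      obtain ⟨u, hu⟩ := ht.exists_hasEigenvector
      have hu_mem : (u : V) ∈ U ⊓ (f i).eigenspace t :=
        ⟨u.2, End.mem_eigenspace_iff.2 (congrArg Subtype.val hu.apply_eq_smul)⟩
      have hlt : U ⊓ (f i).eigenspace t < U := by
        obtain ⟨v, hv, hvt⟩ := hi t
        exact inf_le_left.lt_of_ne fun h0 => hvt (End.mem_eigenspace_iff.1 (h0.ge hv).2)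
      have : FiniteDimensional K (U ⊓ (f i).eigenspace t : Submodule K V) :=
        Submodule.finiteDimensional_of_le hlt.le
      obtain ⟨v, hv, hv'⟩ := ih _ (hd ▸ Submodule.finrank_lt_finrank_of_lt hlt) _
        ((Submodule.ne_bot_iff _).2 ⟨u, hu_mem, fun h0 => hu.2 (Subtype.ext h0)⟩)
        (fun j => inf_eigenspace_stable_of_commute (hf i j) (hfU j) t) rfl
      exact ⟨v, hlt.le hv, hv'⟩

theorem pow_succ_mul_of_commute_lie {A : Type*} [Ring A] {x y : A} (h : Commute x ⁅x, y⁆) (k : ℕ) :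
    x ^ (k + 1) * y = y * x ^ (k + 1) + (k + 1) • (⁅x, y⁆ * x ^ k) := by
  induction k with
  | zero => simp [Ring.lie_def]
  | succ k ih =>
    have hx : x ^ (k + 1) * ⁅x, y⁆ = ⁅x, y⁆ * x ^ (k + 1) := (h.pow_left _).eq
    calc x ^ (k + 2) * y = x ^ (k + 1) * (y * x + ⁅x, y⁆) := by
          rw [Ring.lie_def, add_sub_cancel, ← mul_assoc, pow_succ]
      _ = (y * x ^ (k + 1) + (k + 1) • (⁅x, y⁆ * x ^ k)) * x + ⁅x, y⁆ * x ^ (k + 1) := by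
          rw [mul_add, hx, ← mul_assoc, ih]
      _ = y * x ^ (k + 2) + (k + 2) • (⁅x, y⁆ * x ^ (k + 1)) := by
          simp only [add_mul, smul_mul_assoc, mul_assoc, ← pow_succ, add_assoc, ← succ_nsmul]

theorem pow_apply_pow_apply_of_commute_lie {X Y : End K V} (h : Commute X ⁅X, Y⁆) {γ : K} {v : V}
    (hX : X v = 0) (hγ : ⁅X, Y⁆ v = γ • v) (k : ℕ) :
    (X ^ k) ((Y ^ k) v) = (k.factorial * γ ^ k : K) • v ∧ (X ^ (k + 1)) ((Y ^ k) v) = 0 := by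
  have step (j k : ℕ) : (X ^ (j + 1)) ((Y ^ (k + 1)) v) =
      Y ((X ^ (j + 1)) ((Y ^ k) v)) + (j + 1) • ⁅X, Y⁆ ((X ^ j) ((Y ^ k) v)) := by
    rw [pow_succ' Y, End.mul_apply, ← End.mul_apply, pow_succ_mul_of_commute_lie h]
    rfl
  induction k with
  | zero => simpa using hX
  | succ k ih =>
    obtain ⟨ih₁, ih₂⟩ := ih
    constructor
    · rw [step, ih₂, ih₁, map_zero, map_smul, hγ, Nat.factorial_succ]
      push_cast
      module
    · rw [step, pow_succ' X (k + 1), End.mul_apply, ih₂, map_zero, map_zero, map_zero, smul_zero,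
        add_zero]

theorem linearIndepOn_of_pow_apply_ne_zero {X : End K V} {u : ℕ → V} {F : Finset ℕ}
    (h₀ : ∀ k ∈ F, (X ^ k) (u k) ≠ 0) (h₁ : ∀ k ∈ F, (X ^ (k + 1)) (u k) = 0) :
    LinearIndepOn K u (F : Set ℕ) := by
  induction F using Finset.induction_on_max with
  | empty => simp
  | insert a F ha ih =>
    rw [Finset.forall_mem_insert] at h₀ h₁
    rw [Finset.coe_insert]
    refine (ih h₀.2 h₁.2).insert fun hspan => h₀.1 ?_
    have hker : Submodule.span K (u '' F) ≤ LinearMap.ker (X ^ a) := by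
      rw [Submodule.span_le]
      rintro _ ⟨k, hk, rfl⟩
      exact Module.End.pow_map_zero_of_le (ha k hk) (h₁.2 k hk)
    exact hker hspan

/-- The vectors `Y ^ k v` have pairwise different orders of nilpotency under `X`. -/
theorem card_le_finrank_of_lie_apply_eq_smul [CharZero K] {X Y : End K V} (h : Commute X ⁅X, Y⁆)
    {γ : K} (hγ : γ ≠ 0) {U : Submodule K V} [FiniteDimensional K U] {F : Finset ℕ}
    (hF : ∀ k ∈ F, ∃ v ≠ 0, X v = 0 ∧ ⁅X, Y⁆ v = γ • v ∧ (Y ^ k) v ∈ U) :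
    F.card ≤ finrank K U := by
  choose! v hv0 hXv hγv hvU using hF
  have hu (k) (hk : k ∈ F) := pow_apply_pow_apply_of_commute_lie h (hXv k hk) (hγv k hk) k
  have hindep : LinearIndepOn K (fun k => (Y ^ k) (v k)) (F : Set ℕ) := by
    refine linearIndepOn_of_pow_apply_ne_zero (X := X) (fun k hk => ?_) fun k hk => (hu k hk).2
    rw [(hu k hk).1]
    exact smul_ne_zero (mul_ne_zero (mod_cast k.factorial_ne_zero) (pow_ne_zero k hγ)) (hv0 k hk)
  have hindepU : LinearIndependent K fun k : F => (⟨_, hvU k k.2⟩ : U) :=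
    LinearIndependent.of_comp U.subtype hindep
  simpa using hindepU.fintype_card_le_finrank

/-- Jacobson's lemma, at a common eigenvector. -/
theorem eq_zero_of_lie_apply_eq_smul [CharZero K] {X Y : End K V} (h : Commute X ⁅X, Y⁆)
    {U : Submodule K V} [FiniteDimensional K U] (hY : ∀ v ∈ U, Y v ∈ U) {v : V} (hv : v ∈ U)
    (hv0 : v ≠ 0) {x γ : K} (hx : X v = x • v) (hγ : ⁅X, Y⁆ v = γ • v) : γ = 0 := by
  by_contra hγ0
  have hlie : ⁅X - algebraMap K _ x, Y⁆ = ⁅X, Y⁆ := by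
    simp only [Ring.lie_def, sub_mul, mul_sub, Algebra.commutes, sub_sub_sub_cancel_right]
  have hcomm : Commute (X - algebraMap K _ x) ⁅X - algebraMap K _ x, Y⁆ :=
    hlie.symm ▸ h.sub_left (Algebra.commutes x _)
  have hYk (k : ℕ) : (Y ^ k) v ∈ U := by
    rw [End.pow_apply]
    exact Set.MapsTo.iterate (fun v => hY v) k hv
  have := card_le_finrank_of_lie_apply_eq_smul hcomm hγ0 (U := U)
    (F := Finset.range (finrank K U + 1)) fun k _ =>
      ⟨v, hv0, by simp [hx, algebraMap_end_apply], by rw [hlie, hγ], hYk k⟩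
  simp at this

end LinearAlgebra

/-- A representation on `V` of the centreless Heisenberg–Virasoro algebra, the even part of the
Ramond algebra modulo its centre. -/
structure HeisenbergVirasoroRep (K V : Type*) [Field K] [AddCommGroup V] [Module K V] where
  L : ℤ → End K V
  H : ℤ → End K V
  lie_L_L : ∀ m n v, L m (L n v) - L n (L m v) = ((n : K) - m) • L (m + n) v
  lie_L_H : ∀ m n v, L m (H n v) - H n (L m v) = (n : K) • H (m + n) v
  comm_H : ∀ m n v, H m (H n v) = H n (H m v)

namespace HeisenbergVirasoroRep

variable {K V : Type*} [Field K] [AddCommGroup V] [Module K V] (A : HeisenbergVirasoroRep K V)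

/-- The weight space of weight `μ`: the `μ`-eigenspace of `L 0`. -/
abbrev weightSpace (μ : K) : Submodule K V :=
  (A.L 0).eigenspace μ

/-- All weight spaces have dimension at most `d`. -/
def WeightBounded (d : ℕ) : Prop :=
  ∀ μ, Module.rank K (A.weightSpace μ) ≤ d

theorem H_mem (m : ℤ) {μ : K} {v : V} (hv : v ∈ A.weightSpace μ) :
    A.H m v ∈ A.weightSpace (μ + m) := by
  rw [End.mem_eigenspace_iff] at hv ⊢
  have h := A.lie_L_H 0 m v
  rw [hv, map_smul, zero_add, sub_eq_iff_eq_add] at h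
  rw [h, add_comm, add_smul]

theorem L_mem (m : ℤ) {μ : K} {v : V} (hv : v ∈ A.weightSpace μ) :
    A.L m v ∈ A.weightSpace (μ + m) := by
  rw [End.mem_eigenspace_iff] at hv ⊢
  have h := A.lie_L_L 0 m v
  rw [hv, map_smul, zero_add, sub_eq_iff_eq_add] at h
  rw [h, add_comm, add_smul, Int.cast_zero, sub_zero]

theorem H_pow_mem (m : ℤ) {μ : K} {v : V} (hv : v ∈ A.weightSpace μ) (k : ℕ) :
    (A.H m ^ k) v ∈ A.weightSpace (μ + k * m) := by
  induction k with
  | zero => simpa using hv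
  | succ k ih =>
    rw [pow_succ', End.mul_apply]
    convert A.H_mem m ih using 2
    push_cast; ring

theorem L_pow_mem (m : ℤ) {μ : K} {v : V} (hv : v ∈ A.weightSpace μ) (k : ℕ) :
    (A.L m ^ k) v ∈ A.weightSpace (μ + k * m) := by
  induction k with
  | zero => simpa using hv
  | succ k ih =>
    rw [pow_succ', End.mul_apply]
    convert A.L_mem m ih using 2
    push_cast; ring

theorem commute_H (m n : ℤ) : Commute (A.H m) (A.H n) :=
  LinearMap.ext (A.comm_H m n)

theorem H_L (m r : ℤ) (v : V) : A.H m (A.L r v) = A.L r (A.H m v) - (m : K) • A.H (r + m) v := by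
  rw [← A.lie_L_H, sub_sub_cancel]

theorem lie_H_L (m r : ℤ) : ⁅A.H m, A.L r⁆ = -((m : K) • A.H (r + m)) := by
  ext v
  simp [Ring.lie_def, A.H_L]

theorem commute_H_lie_H_L (m n r : ℤ) : Commute (A.H m) ⁅A.H n, A.L r⁆ := by
  rw [lie_H_L]
  exact ((A.commute_H m _).smul_right _).neg_right

theorem H_pow_add_L_pow_eq_zero (m : ℤ) {v : V} {k : ℕ} (hv : (A.H m ^ k) v = 0) (j : ℕ) :
    (A.H m ^ (k + j)) ((A.L m ^ j) v) = 0 := by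
  induction j with
  | zero => simpa using hv
  | succ j ih =>
    have hlie := LinearMap.congr_fun
      (pow_succ_mul_of_commute_lie (A.commute_H_lie_H_L m m m) (k + j)) ((A.L m ^ j) v)
    rw [End.mul_apply, ← End.mul_apply (A.L m), ← pow_succ'] at hlie
    rw [← add_assoc, hlie, LinearMap.add_apply, LinearMap.smul_apply, End.mul_apply, End.mul_apply,
      ih, pow_succ', End.mul_apply, ih, map_zero, map_zero, map_zero, smul_zero, add_zero]

variable {A}

section WeightBounded

variable {d : ℕ}

theorem WeightBounded.finiteDimensional (hd : A.WeightBounded d) (μ : K) :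
    FiniteDimensional K (A.weightSpace μ) :=
  Module.rank_lt_aleph0_iff.1 ((hd μ).trans_lt Cardinal.natCast_lt_aleph0)

theorem WeightBounded.finrank_le (hd : A.WeightBounded d) (μ : K) :
    finrank K (A.weightSpace μ) ≤ d :=
  Module.finrank_le_of_rank_le (hd μ)

variable {c : K} (hc0 : c ≠ 0) (hc : ∀ v, A.H 0 v = c • v) (hd : A.WeightBounded d)

include hc in
theorem lie_H_L_neg_apply (n : ℤ) (v : V) : ⁅A.H n, A.L (-n)⁆ v = (-(n * c)) • v := by
  rw [lie_H_L, neg_add_cancel, LinearMap.neg_apply, LinearMap.smul_apply, hc, smul_smul, neg_smul]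

variable [CharZero K]

include hc0 hc

theorem L_neg_pow_ne_zero {n : ℤ} (hn : n ≠ 0) {v : V} (hv : v ≠ 0) (h : A.H n v = 0) (k : ℕ) :
    (A.L (-n) ^ k) v ≠ 0 := by
  intro h0
  have hpow := (pow_apply_pow_apply_of_commute_lie (A.commute_H_lie_H_L n n (-n)) h
    (lie_H_L_neg_apply hc n v) k).1
  rw [h0, map_zero] at hpow
  refine smul_ne_zero (mul_ne_zero (mod_cast k.factorial_ne_zero) (pow_ne_zero k ?_)) hv hpow.symm
  exact neg_ne_zero.2 (mul_ne_zero (mod_cast hn) hc0)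

include hd

theorem card_weights_ker_H_le {n : ℤ} (hn : n ≠ 0) (μ : K) {F : Finset ℕ}
    (hF : ∀ k ∈ F, ∃ v ∈ A.weightSpace (μ + k * n), v ≠ 0 ∧ A.H n v = 0) : F.card ≤ d := by
  have := hd.finiteDimensional μ
  refine (card_le_finrank_of_lie_apply_eq_smul (A.commute_H_lie_H_L n n (-n)) (γ := -(n * c))
    (neg_ne_zero.2 (mul_ne_zero (mod_cast hn) hc0)) fun k hk => ?_).trans (hd.finrank_le μ)
  obtain ⟨v, hv, hv0, hHv⟩ := hF k hk
  refine ⟨v, hv0, hHv, lie_H_L_neg_apply hc n v, ?_⟩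
  convert A.L_pow_mem (-n) hv k using 2
  push_cast; ring

theorem eventually_H_injOn {n : ℤ} (hn : n ≠ 0) (μ : K) :
    ∃ N : ℕ, ∀ k ≥ N, ∀ v ∈ A.weightSpace (μ + k * n), A.H n v = 0 → v = 0 := by
  have hfinite : {k : ℕ | ∃ v ∈ A.weightSpace (μ + k * n), v ≠ 0 ∧ A.H n v = 0}.Finite := by
    by_contra hinf
    obtain ⟨F, hF, hcard⟩ := Set.Infinite.exists_subset_card_eq hinf (d + 1)
    have := card_weights_ker_H_le hc0 hc hd hn μ fun k hk => hF hk
    omega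
  obtain ⟨N, hN⟩ := hfinite.bddAbove
  refine ⟨N + 1, fun k hk v hv h => ?_⟩
  by_contra hv0
  exact absurd (hN ⟨v, hv, hv0, h⟩) (by omega)

theorem H_neg_pow_eq_zero {n : ℤ} (hn : n ≠ 0) {μ : K} {v : V} (hv : v ∈ A.weightSpace μ)
    (h : A.H n v = 0) : (A.H (-n) ^ d) v = 0 := by
  by_contra h0
  have := card_weights_ker_H_le hc0 hc hd hn (μ - d * n) (F := Finset.range (d + 1)) fun k hk => by
    obtain ⟨j, rfl⟩ := Nat.exists_eq_add_of_le (Nat.lt_succ_iff.1 (Finset.mem_range.1 hk))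
    refine ⟨(A.H (-n) ^ j) v, ?_, fun h1 => h0 ?_, ?_⟩
    · convert A.H_pow_mem (-n) hv j using 2
      push_cast; ring
    · rw [pow_add, End.mul_apply, h1, map_zero]
    · rw [← End.mul_apply, ((A.commute_H n (-n)).pow_right j).eq, End.mul_apply, h, map_zero]
  simp at this

/-- If `H n v = 0 ≠ v`, then `w = L (-n) ^ N v` is nonzero and killed by a power of `H (-n)`,
although `H (-n)` is injective in the weights of all `H (-n) ^ k w` once `N` is large. -/
theorem H_injOn {n : ℤ} (hn : n ≠ 0) {μ : K} {v : V} (hv : v ∈ A.weightSpace μ)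
    (h : A.H n v = 0) : v = 0 := by
  by_contra hv0
  obtain ⟨N, hN⟩ := eventually_H_injOn hc0 hc hd (neg_ne_zero.2 hn) μ
  have hinj (k : ℕ) (hk : (A.H (-n) ^ k) ((A.L (-n) ^ N) v) = 0) : (A.L (-n) ^ N) v = 0 := by
    induction k with
    | zero => simpa using hk
    | succ k ih =>
      rw [pow_succ', End.mul_apply] at hk
      refine ih (hN (N + k) (Nat.le_add_right N k) _ ?_ hk)
      convert A.H_pow_mem (-n) (A.L_pow_mem (-n) hv N) k using 2
      push_cast; ring
  exact L_neg_pow_ne_zero hc0 hc hn hv0 h N <|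
    hinj _ (A.H_pow_add_L_pow_eq_zero (-n) (H_neg_pow_eq_zero hc0 hc hd hn hv h) N)

theorem restrict_H_injective {n : ℤ} (hn : n ≠ 0) (μ : K) :
    Function.Injective ((A.H n).restrict fun _ => A.H_mem n (μ := μ)) :=
  LinearMap.ker_eq_bot.1 (LinearMap.ker_eq_bot'.2 fun v hv =>
    Subtype.ext (H_injOn hc0 hc hd hn v.2 (congrArg Subtype.val hv)))

theorem finrank_weightSpace_le {n : ℤ} (hn : n ≠ 0) (μ : K) :
    finrank K (A.weightSpace μ) ≤ finrank K (A.weightSpace (μ + n)) := by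
  have := hd.finiteDimensional (μ + n)
  exact LinearMap.finrank_le_finrank_of_injective (restrict_H_injective hc0 hc hd hn μ)

theorem exists_H_eq {n : ℤ} (hn : n ≠ 0) {μ : K} {v : V} (hv : v ∈ A.weightSpace (μ + n)) :
    ∃ w, A.H n w = v := by
  have := hd.finiteDimensional μ
  have := hd.finiteDimensional (μ + n)
  have hdim : finrank K (A.weightSpace μ) = finrank K (A.weightSpace (μ + n)) := by
    refine le_antisymm (finrank_weightSpace_le hc0 hc hd hn μ) ?_
    have h := finrank_weightSpace_le hc0 hc hd (neg_ne_zero.2 hn) (μ + n)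
    rwa [Int.cast_neg, add_neg_cancel_right] at h
  obtain ⟨w, hw⟩ := (LinearMap.injective_iff_surjective_of_finrank_eq_finrank hdim).1
    (restrict_H_injective hc0 hc hd hn μ) ⟨v, hv⟩
  exact ⟨w, congrArg Subtype.val hw⟩

theorem H_bijective (hw : ⨆ μ, A.weightSpace μ = ⊤) (n : ℤ) : Function.Bijective (A.H n) := by
  obtain rfl | hn := eq_or_ne n 0
  · rw [funext hc]
    exact (LinearEquiv.smulOfNeZero K V c hc0).bijective
  refine ⟨LinearMap.ker_eq_bot.1 ?_, LinearMap.range_eq_top.1 (eq_top_iff.2 ?_)⟩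
  · by_contra hker
    have hstable : LinearMap.ker (A.H n) ≤ (LinearMap.ker (A.H n)).comap (A.L 0) := fun v hv => by
      rw [LinearMap.mem_ker] at hv
      simp [A.H_L, hv]
    obtain ⟨μ, v, hv, hv0, hμ⟩ := exists_eigenvector_mem hw hstable hker
    exact hv0 (H_injOn hc0 hc hd hn (End.mem_eigenspace_iff.2 hμ) hv)
  · rw [← hw]
    exact iSup_le fun μ v hv => exists_H_eq hc0 hc hd hn (μ := μ - n) (by rwa [sub_add_cancel])

end WeightBounded

end HeisenbergVirasoroRep

section VanishingFields

variable {K V : Type*} [Field K] [AddCommGroup V] [Module K V]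

/-- The relations among the vector fields `(t ^ r - 1) t d/dt`, which vanish at `t = 1`. -/
def IsVanishingFields (y : ℤ → End K V) : Prop :=
  y 0 = 0 ∧ ∀ (r s : ℤ) (v : V), y r (y s v) - y s (y r v) =
    ((s : K) - r) • y (r + s) v - (s : K) • y s v + (r : K) • y r v

/-- The pullback along `t ↦ t⁻¹`. -/
theorem IsVanishingFields.neg {y : ℤ → End K V} (hy : IsVanishingFields y) :
    IsVanishingFields fun r => -y (-r) := by
  refine ⟨by simp [hy.1], fun r s v => ?_⟩
  have h := hy.2 (-r) (-s) v
  simp only [LinearMap.neg_apply, map_neg, neg_neg]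
  rw [h, neg_add]
  push_cast
  module

/-- `z = y 1 + y (-1)` satisfies `[y 1, z] = z = [-y (-1), z]`, so it raises eigenvalues by one. -/
theorem IsVanishingFields.apply_add_apply_neg_eq_zero {y : ℤ → End K V} (hy : IsVanishingFields y)
    {η : K} (hη : ∀ w, y 1 w = (η + 1) • w → w = 0) {v : V} (hv : y 1 v = η • v) :
    y 1 v + y (-1) v = 0 := by
  refine hη _ ?_
  have h := hy.2 1 (-1) v
  rw [hv, map_smul, add_neg_cancel, hy.1] at h
  rw [map_add, sub_eq_iff_eq_add.1 h, hv, map_smul, hv, LinearMap.zero_apply]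
  push_cast
  module

theorem IsVanishingFields.apply_two_eq {y : ℤ → End K V} (hy : IsVanishingFields y)
    {η : K} (hη : ∀ w, y (-1) w = -(η + 2) • w → w = 0) {v : V} (h₁ : y 1 v = η • v)
    (h₂ : y (-1) v = -η • v) : y 2 v = (2 * η) • v := by
  refine sub_eq_zero.1 (hη _ ?_)
  have h := hy.2 (-1) 2 v
  rw [h₂, map_smul, show (-1 + 2 : ℤ) = 1 from rfl, h₁] at h
  rw [map_sub, sub_eq_iff_eq_add.1 h, map_smul, h₂]
  push_cast
  module

theorem IsVanishingFields.apply_natCast_eq [CharZero K] {y : ℤ → End K V}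
    (hy : IsVanishingFields y) {η : K} {v : V} (h₁ : y 1 v = η • v) (h₂ : y 2 v = (2 * η) • v)
    (n : ℕ) : y n v = (n * η) • v := by
  induction n using Nat.twoStepInduction with
  | zero => simp [hy.1]
  | one => simpa using h₁
  | more n _ ih =>
    obtain _ | n := n
    · simpa using h₂
    have h := hy.2 1 (n + 2 : ℕ) v
    have hn : (n : K) + 1 ≠ 0 := by exact_mod_cast n.succ_ne_zero
    rw [h₁, map_smul] at h
    rw [show ((n + 1 + 1 : ℕ) : ℤ) = (n + 2 : ℕ) from rfl] at ih
    rw [ih, map_smul, h₁, smul_comm, sub_self] at h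
    rw [show ((n + 1 + 2 : ℕ) : ℤ) = 1 + (n + 2 : ℕ) by push_cast; ring]
    refine smul_right_injective V hn ?_
    simp only
    push_cast at h ⊢
    linear_combination (norm := module) (-1 : K) • h

theorem exists_mem_forall_add_natCast_notMem {R : Type*} [Ring R] [CharZero R] {S : Set R}
    (hS : S.Finite) (hne : S.Nonempty) : ∃ η ∈ S, ∀ k : ℕ, 0 < k → η + k ∉ S := by
  obtain ⟨ζ, hζ⟩ := hne
  have hfin : {k : ℕ | ζ + k ∈ S}.Finite :=
    hS.preimage ((add_right_injective ζ).comp Nat.cast_injective).injOn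
  obtain ⟨k, hk, hmax⟩ := Set.exists_max_image _ id hfin ⟨0, by simpa using hζ⟩
  refine ⟨ζ + k, hk, fun j hj hmem => ?_⟩
  have : k + j ≤ k := hmax (k + j) (by simpa [add_assoc] using hmem)
  omega

theorem IsVanishingFields.exists_extremal [CharZero K] [IsAlgClosed K] [FiniteDimensional K V]
    [Nontrivial V] {y : ℤ → End K V} (hy : IsVanishingFields y) :
    ∃ (η : K) (φ : V), φ ≠ 0 ∧ y 1 φ = η • φ ∧ y (-1) φ = -η • φ ∧
      (∀ k : ℕ, 0 < k → ∀ w, y 1 w = (η + k) • w → w = 0) ∧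
      ∀ k : ℕ, 0 < k → ∀ w, y (-1) w = -(η + k) • w → w = 0 := by
  let S : Set K := {ζ | (y 1).HasEigenvalue ζ ∨ (-y (-1)).HasEigenvalue ζ}
  have hS : S.Finite := (End.finite_hasEigenvalue (y 1)).union (End.finite_hasEigenvalue (-y (-1)))
  obtain ⟨ζ, hζ⟩ := End.exists_eigenvalue (y 1)
  obtain ⟨η, hη, hmax⟩ := exists_mem_forall_add_natCast_notMem hS ⟨ζ, .inl hζ⟩
  have hmax₁ (k : ℕ) (hk : 0 < k) (w : V) (hw : y 1 w = (η + k) • w) : w = 0 := by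
    by_contra hw0
    exact hmax k hk (.inl (End.hasEigenvalue_of_hasEigenvector
      ⟨End.mem_eigenspace_iff.2 hw, hw0⟩))
  have hmax₂ (k : ℕ) (hk : 0 < k) (w : V) (hw : (-y (-1)) w = (η + k) • w) : w = 0 := by
    by_contra hw0
    exact hmax k hk (.inr (End.hasEigenvalue_of_hasEigenvector
      ⟨End.mem_eigenspace_iff.2 hw, hw0⟩))
  obtain ⟨φ, hφ0, h₁, h₂⟩ : ∃ φ : V, φ ≠ 0 ∧ y 1 φ = η • φ ∧ y (-1) φ = -η • φ := by
    rcases hη with h | h <;> obtain ⟨φ, hφ⟩ := h.exists_hasEigenvector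
    · have h₁ := hφ.apply_eq_smul
      refine ⟨φ, hφ.2, h₁, ?_⟩
      rw [neg_smul, ← h₁, eq_neg_iff_add_eq_zero, add_comm]
      exact hy.apply_add_apply_neg_eq_zero (by simpa using hmax₁ 1 one_pos) h₁
    · have h₁ := hφ.apply_eq_smul
      have h := hy.neg.apply_add_apply_neg_eq_zero (by simpa using hmax₂ 1 one_pos) h₁
      rw [LinearMap.neg_apply, neg_eq_iff_eq_neg, ← neg_smul] at h₁
      refine ⟨φ, hφ.2, ?_, h₁⟩
      simpa [h₁, ← sub_eq_add_neg, sub_eq_zero, eq_comm (a := η • φ)] using h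
  exact ⟨η, φ, hφ0, h₁, h₂, hmax₁, fun k hk w hw => hmax₂ k hk w (by simp [hw, -neg_add_rev])⟩

theorem IsVanishingFields.exists_common_eigenvector [CharZero K] [IsAlgClosed K]
    [FiniteDimensional K V] [Nontrivial V] {y : ℤ → End K V} (hy : IsVanishingFields y) :
    ∃ (η : K) (φ : V), φ ≠ 0 ∧ ∀ r : ℤ, y r φ = (r * η) • φ := by
  obtain ⟨η, φ, hφ0, h₁, h₂, hmax₁, hmax₂⟩ := hy.exists_extremal
  have hpos := hy.apply_natCast_eq h₁ (hy.apply_two_eq (hmax₂ 2 two_pos) h₁ h₂)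
  have h₁' : (-y (-1)) φ = η • φ := by simp [h₂]
  have h₂' : (-y (- -1)) φ = -η • φ := by simp [h₁]
  have hneg := hy.neg.apply_natCast_eq h₁' <| hy.neg.apply_two_eq
    (fun w hw => hmax₁ 2 two_pos w (by simpa [-neg_add_rev] using hw)) h₁' h₂'
  refine ⟨η, φ, hφ0, fun r => ?_⟩
  obtain ⟨n, rfl | rfl⟩ := r.eq_nat_or_neg
  · simpa using hpos n
  · simpa [neg_eq_iff_eq_neg] using hneg n

end VanishingFields

section LogarithmicDerivative

variable {R : Type*} [Ring R]

theorem lie_mul_eq_mul_add {x u v p q : R} (hu : ⁅x, u⁆ = u * p) (hv : ⁅x, v⁆ = v * q)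
    (hpv : Commute p v) : ⁅x, u * v⁆ = u * v * (p + q) := by
  rw [Ring.lie_def, sub_eq_iff_eq_add] at hu hv ⊢
  rw [← mul_assoc, hu, add_mul, mul_assoc u x v, hv, mul_assoc u p v, hpv.eq]
  noncomm_ring

theorem lie_units_inv_eq_mul_neg {x p : R} {u : Rˣ} (hu : ⁅x, (u : R)⁆ = u * p)
    (hpu : Commute p u) : ⁅x, ((u⁻¹ : Rˣ) : R)⁆ = (u⁻¹ : Rˣ) * -p := by
  have hxu : x * u = u * (p + x) := by rw [mul_add, ← sub_eq_iff_eq_add, ← Ring.lie_def, hu]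
  rw [Ring.lie_def, mul_neg, ← hpu.units_inv_right.eq, sub_eq_iff_eq_add, ← sub_eq_neg_add,
    eq_sub_iff_add_eq', ← add_mul, ← Units.mul_right_inj u, ← mul_assoc, ← hxu]
  simp

end LogarithmicDerivative

/-- Additivity of `a ↦ a / e a r` makes `e` constant off the axes, and associativity identifies
that constant with the value on the axes. -/
theorem ratio_eq_const {K : Type*} [Field K] [CharZero K] {c : K} {e : ℤ → ℤ → K}
    (hne : ∀ a b, e a b ≠ 0) (hzero : ∀ b, e 0 b = c) (hsymm : ∀ a b, e a b = e b a)
    (hassoc : ∀ a b d, e a b * e (a + b) d = e b d * e a (b + d))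
    (hadd : ∀ a b r : ℤ, (a : K) * (e a r)⁻¹ + b * (e b r)⁻¹ = (a + b) * (e (a + b) r)⁻¹)
    (a b : ℤ) : e a b = c := by
  have hleft (a r : ℤ) (ha : a ≠ 0) : e a r = e 1 r := by
    let f : ℤ →+ K := ⟨⟨fun a => a * (e a r)⁻¹, by simp⟩, fun a b => by simp [hadd]⟩
    have hf : (a : K) * (e a r)⁻¹ = a * (e 1 r)⁻¹ := by
      simpa [f] using map_zsmul f a 1
    exact inv_injective (mul_left_cancel₀ (Int.cast_ne_zero.2 ha) hf)
  have hconst (a b : ℤ) (ha : a ≠ 0) (hb : b ≠ 0) : e a b = e 1 1 := by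
    rw [hleft a b ha, hsymm, hleft b 1 hb]
  have hone : e 1 1 = c := by
    have h := hassoc 1 1 (-1)
    rw [hconst (1 + 1) (-1) (by decide) (by decide), hconst 1 (-1) (by decide) (by decide),
      add_neg_cancel, hsymm 1 0, hzero] at h
    exact mul_left_cancel₀ (hne 1 1) h
  rcases eq_or_ne a 0 with rfl | ha
  · exact hzero b
  rcases eq_or_ne b 0 with rfl | hb
  · rw [hsymm, hzero]
  · rw [hconst a b ha hb, hone]

namespace HeisenbergVirasoroRep

variable {K V : Type*} [Field K] [AddCommGroup V] [Module K V] {A : HeisenbergVirasoroRep K V}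

theorem mem_weightSpace_of_H_mem {n : ℤ} (hn : Function.Injective (A.H n)) {μ : K} {v : V}
    (hv : A.H n v ∈ A.weightSpace (μ + n)) : v ∈ A.weightSpace μ := by
  rw [End.mem_eigenspace_iff] at hv ⊢
  refine hn ?_
  rw [A.H_L, hv, zero_add, map_smul, add_smul, add_sub_cancel_right]

section Ratio

/-- The operator of degree zero comparing `H a H b` with `H (a + b)`. -/
def ratio (h : ℤ → (End K V)ˣ) (a b : ℤ) : (End K V)ˣ :=
  h a * h b * (h (a + b))⁻¹

variable {h : ℤ → (End K V)ˣ} (hh : ∀ n, (h n : End K V) = A.H n)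

include hh

theorem commute_units_H (a b : ℤ) : Commute (h a) (h b) := by
  rw [← Commute.units_val_iff, hh, hh]
  exact A.commute_H a b

theorem commute_units_H_ratio (n a b : ℤ) : Commute (h n) (ratio h a b) :=
  ((commute_units_H hh n a).mul_right (commute_units_H hh n b)).mul_right
    (commute_units_H hh n _).inv_right

theorem commute_ratio (a b a' b' : ℤ) : Commute (ratio h a b) (ratio h a' b') :=
  ((commute_units_H_ratio hh a a' b').mul_left (commute_units_H_ratio hh b a' b')).mul_left
    (commute_units_H_ratio hh _ a' b').inv_left

theorem inv_apply_mem_weightSpace (n : ℤ) {μ : K} {v : V} (hv : v ∈ A.weightSpace (μ + n)) :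
    ((h n)⁻¹ : (End K V)ˣ).val v ∈ A.weightSpace μ := by
  have hH : A.H n (((h n)⁻¹ : (End K V)ˣ).val v) = v := by
    rw [← hh, ← End.mul_apply, Units.mul_inv, End.one_apply]
  refine mem_weightSpace_of_H_mem (hh n ▸ ((End.isUnit_iff _).1 (h n).isUnit).1) ?_
  rwa [hH]

theorem ratio_apply_mem_weightSpace (a b : ℤ) {μ : K} {v : V} (hv : v ∈ A.weightSpace μ) :
    (ratio h a b).val v ∈ A.weightSpace μ := by
  have hcomm : ratio h a b = (h (a + b))⁻¹ * (h a * h b) :=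
    ((commute_units_H hh a _).mul_left (commute_units_H hh b _)).inv_right.eq
  rw [hcomm, Units.val_mul, Units.val_mul, hh a, hh b, End.mul_apply, End.mul_apply]
  refine inv_apply_mem_weightSpace hh _ ?_
  convert A.H_mem a (A.H_mem b hv) using 2
  push_cast; ring

theorem lie_inv_mul_L_H (a r : ℤ) :
    ⁅((h r)⁻¹ : (End K V)ˣ) * A.L r, (h a : End K V)⁆ =
      h a * ((a : K) • ((ratio h a r)⁻¹ : (End K V)ˣ).val) := by
  have hlie : A.L r * A.H a - A.H a * A.L r = (a : K) • A.H (a + r) := by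
    ext v
    rw [add_comm a r]
    exact A.lie_L_H r a v
  have hcomm : (h a).val * ((h r)⁻¹ : (End K V)ˣ).val = ((h r)⁻¹ : (End K V)ˣ).val * (h a).val :=
    congrArg Units.val (commute_units_H hh a r).inv_right.eq
  have hunit : h a * (ratio h a r)⁻¹ = (h r)⁻¹ * h (a + r) := by
    have hcomm_a : Commute (h a) (h (a + r) * (h r)⁻¹) :=
      (commute_units_H hh a _).mul_right (commute_units_H hh a r).inv_right
    rw [ratio, mul_inv_rev, mul_inv_rev, inv_inv, ← mul_assoc (h (a + r)), ← mul_assoc, hcomm_a.eq,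
      mul_inv_cancel_right, (commute_units_H hh _ r).inv_right.eq]
  rw [mul_smul_comm, ← Units.val_mul, hunit, Units.val_mul, Ring.lie_def, ← mul_assoc, hcomm,
    mul_assoc, mul_assoc, ← mul_sub, hh a, hlie, hh (a + r), mul_smul_comm]

theorem lie_inv_mul_L_ratio (a b r : ℤ) :
    ⁅((h r)⁻¹ : (End K V)ˣ) * A.L r, (ratio h a b).val⁆ =
      ratio h a b * ((a : K) • ((ratio h a r)⁻¹ : (End K V)ˣ).val +
        (b : K) • ((ratio h b r)⁻¹ : (End K V)ˣ).val +
        -((a + b : ℤ) : K) • ((ratio h (a + b) r)⁻¹ : (End K V)ˣ).val) := by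
  have hcomm (i j n : ℤ) (t : K) :
      Commute (t • ((ratio h i j)⁻¹ : (End K V)ˣ).val) (h n).val :=
    (((commute_units_H_ratio hh n i j).symm.inv_left).units_val).smul_left t
  have hab := lie_mul_eq_mul_add (lie_inv_mul_L_H hh a r) (lie_inv_mul_L_H hh b r) (hcomm a r b a)
  have hinv := lie_units_inv_eq_mul_neg (lie_inv_mul_L_H hh (a + b) r) (hcomm _ r _ _)
  rw [neg_smul]
  exact lie_mul_eq_mul_add hab hinv (((hcomm a r _ _).add_left (hcomm b r _ _)).units_inv_right)

theorem H_apply_H_apply_eq_smul {e : ℤ → ℤ → K} {φ : V}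
    (he : ∀ a b, (ratio h a b).val φ = e a b • φ) (a b : ℤ) :
    A.H a (A.H b φ) = e a b • A.H (a + b) φ := by
  have hmul : ratio h a b * h (a + b) = h a * h b := inv_mul_cancel_right _ _
  rw [← commute_units_H_ratio hh, Units.ext_iff, Units.val_mul, Units.val_mul, hh, hh, hh] at hmul
  rw [← map_smul, ← he, ← End.mul_apply, ← End.mul_apply, hmul]

theorem add_mul_inv_ratio_eq [CharZero K] {μ : K} [FiniteDimensional K (A.weightSpace μ)]
    {e : ℤ → ℤ → K} {φ : V} (hφ : φ ∈ A.weightSpace μ) (hφ0 : φ ≠ 0)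
    (he : ∀ a b, (ratio h a b).val φ = e a b • φ) (hne : ∀ a b, e a b ≠ 0) (a b r : ℤ) :
    (a : K) * (e a r)⁻¹ + b * (e b r)⁻¹ = (a + b) * (e (a + b) r)⁻¹ := by
  have hinv (i j : ℤ) : ((ratio h i j)⁻¹).val φ = (e i j)⁻¹ • φ := by
    rw [eq_inv_smul_iff₀ (hne i j), ← map_smul, ← he, ← End.mul_apply, Units.inv_mul,
      End.one_apply]
  have hlie : ⁅(ratio h a b).val, ((h r)⁻¹).val * A.L r⁆ = _ :=
    (Ring.lie_def _ _).trans <| (neg_sub _ _).symm.trans <|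
      congrArg Neg.neg (lie_inv_mul_L_ratio hh a b r)
  have hcomm (i j : ℤ) (t : K) :
      Commute (ratio h a b).val (t • ((ratio h i j)⁻¹).val) :=
    ((commute_ratio hh a b i j).inv_right.units_val).smul_right t
  have h0 := eq_zero_of_lie_apply_eq_smul (U := A.weightSpace μ) (x := e a b)
    (γ := -(e a b * (a * (e a r)⁻¹ + b * (e b r)⁻¹ - (a + b) * (e (a + b) r)⁻¹)))
    (X := (ratio h a b).val) (Y := ((h r)⁻¹).val * A.L r) ?_ ?_ hφ hφ0 (he a b) ?_
  · rw [neg_eq_zero, mul_eq_zero, sub_eq_zero] at h0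
    exact h0.resolve_left (hne a b)
  · rw [hlie]
    exact (((Commute.refl _).mul_right
      (((hcomm _ _ _).add_right (hcomm _ _ _)).add_right (hcomm _ _ _))).neg_right)
  · exact fun v hv => inv_apply_mem_weightSpace hh r (A.L_mem r hv)
  · rw [hlie]
    simp only [LinearMap.neg_apply, End.mul_apply, LinearMap.add_apply, LinearMap.smul_apply,
      hinv, map_add, map_smul, he]
    push_cast
    module

end Ratio

section NonzeroLevel

variable [CharZero K] [IsAlgClosed K] {c : K} (hc : ∀ v, A.H 0 v = c • v)
  (hbij : ∀ n, Function.Bijective (A.H n)) {μ : K} [FiniteDimensional K (A.weightSpace μ)]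
  (hμ : A.weightSpace μ ≠ ⊥)

include hbij hμ in
theorem exists_ratio_eigenvector : ∃ e : ℤ → ℤ → K, ∃ φ ∈ A.weightSpace μ, φ ≠ 0 ∧
    (∀ a b, A.H a (A.H b φ) = e a b • A.H (a + b) φ) ∧ (∀ a b, e a b ≠ 0) ∧
    ∀ a b r : ℤ, (a : K) * (e a r)⁻¹ + b * (e b r)⁻¹ = (a + b) * (e (a + b) r)⁻¹ := by
  choose h hh using fun n => (End.isUnit_iff (A.H n)).2 (hbij n)
  obtain ⟨φ, hφ, hφ0, he⟩ := exists_common_eigenvector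
    (f := fun p : ℤ × ℤ => (ratio h p.1 p.2).val)
    (fun p q => (commute_ratio hh _ _ _ _).units_val) (A.weightSpace μ) hμ
    (fun p v hv => ratio_apply_mem_weightSpace hh _ _ hv)
  choose e he using he
  have hH := H_apply_H_apply_eq_smul hh (e := fun a b => e (a, b)) fun a b => he (a, b)
  have hH_ne (a : ℤ) {v : V} (hv : v ≠ 0) : A.H a v ≠ 0 := (map_ne_zero_iff _ (hbij a).1).2 hv
  have hne (a b : ℤ) : e (a, b) ≠ 0 := fun h0 =>
    hH_ne a (hH_ne b hφ0) (by rw [hH, h0, zero_smul])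
  exact ⟨fun a b => e (a, b), φ, hφ, hφ0, hH, hne,
    add_mul_inv_ratio_eq hh hφ hφ0 (fun a b => he (a, b)) hne⟩

include hc hbij hμ in
theorem exists_H_H_eq_smul :
    ∃ φ ∈ A.weightSpace μ, φ ≠ 0 ∧ ∀ a b, A.H a (A.H b φ) = c • A.H (a + b) φ := by
  obtain ⟨e, φ, hφ, hφ0, he, hne, hadd⟩ := exists_ratio_eigenvector hbij hμ
  have hcancel {s t : K} {a : ℤ} (h : s • A.H a φ = t • A.H a φ) : s = t :=
    smul_left_injective K ((map_ne_zero_iff _ (hbij a).1).2 hφ0) h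
  refine ⟨φ, hφ, hφ0, fun a b => ?_⟩
  rw [he, ratio_eq_const hne (fun b => hcancel (a := 0 + b) ?_)
    (fun a b => hcancel (a := a + b) ?_) (fun a b d => hcancel (a := a + b + d) ?_) hadd]
  · rw [← he, hc, zero_add]
  · rw [← he, A.comm_H, he, add_comm]
  · calc (e a b * e (a + b) d) • A.H (a + b + d) φ = A.H d (A.H a (A.H b φ)) := by
          rw [he, map_smul, A.comm_H, he, smul_smul]
      _ = (e b d * e a (b + d)) • A.H (a + b + d) φ := by
          rw [A.comm_H d a, A.comm_H d b, he, map_smul, he, smul_smul, add_assoc]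

end NonzeroLevel

end HeisenbergVirasoroRep

namespace HeisenbergVirasoroRep

variable {K V : Type*} [Field K] [AddCommGroup V] [Module K V] (A : HeisenbergVirasoroRep K V)

/-- The vectors on which the operators `c⁻¹ H n` compose like the powers of a single operator. -/
def multiplicativePart (c : K) : Submodule K V where
  carrier := {v | ∀ a b, A.H a (A.H b v) = c • A.H (a + b) v}
  zero_mem' := by simp
  add_mem' := fun hv hw a b => by rw [map_add, map_add, hv, hw, map_add, smul_add]
  smul_mem' := fun t v hv a b => by rw [map_smul, map_smul, hv, map_smul, smul_comm]

variable {A} {c : K}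

theorem H_mem_multiplicativePart (n : ℤ) {v : V} (hv : v ∈ A.multiplicativePart c) :
    A.H n v ∈ A.multiplicativePart c := fun a b => by
  rw [A.comm_H b, A.comm_H a, hv, map_smul, A.comm_H n]

theorem L_mem_multiplicativePart (n : ℤ) {v : V} (hv : v ∈ A.multiplicativePart c) :
    A.L n v ∈ A.multiplicativePart c := fun a b => by
  rw [A.H_L, map_sub, map_smul, A.H_L, A.H_L, hv, hv, hv, map_smul, add_assoc n a b,
    add_left_comm a n b]
  push_cast
  module

theorem H_neg_L_mem_weightSpace (r : ℤ) {μ : K} {v : V} (hv : v ∈ A.weightSpace μ) :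
    A.H (-r) (A.L r v) ∈ A.weightSpace μ := by
  have h := A.H_mem (-r) (A.L_mem r hv)
  rwa [Int.cast_neg, add_neg_cancel_right] at h

theorem H_neg_L_comp (r s : ℤ) {v : V} (hv : v ∈ A.multiplicativePart c) :
    A.H (-r) (A.L r (A.H (-s) (A.L s v))) =
      c • (A.H (-(r + s)) (A.L r (A.L s v)) - (s : K) • A.H (-s) (A.L s v)) := by
  have hs := L_mem_multiplicativePart s hv
  have hL : A.L r (A.H (-s) (A.L s v)) =
      A.H (-s) (A.L r (A.L s v)) - (s : K) • A.H (r + -s) (A.L s v) := by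
    rw [A.H_L (-s) r]
    push_cast
    module
  rw [hL, map_sub, map_smul, hs, L_mem_multiplicativePart r hs, neg_add_cancel_left, neg_add,
    smul_comm (s : K) c, ← smul_sub c]

variable (A) in
/-- The operators `c⁻¹ H (-r) L r` of degree zero, shifted by `-μ`, on the vectors of weight `μ` in
the multiplicative part. -/
def normalizedL (c μ : K) (r : ℤ) : End K ↥(A.multiplicativePart c ⊓ A.weightSpace μ) :=
  (c⁻¹ • (A.H (-r) * A.L r) - μ • 1).restrict fun _ hv =>
    Submodule.sub_mem _ (Submodule.smul_mem _ _
      ⟨H_mem_multiplicativePart _ (L_mem_multiplicativePart _ hv.1),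
        H_neg_L_mem_weightSpace r hv.2⟩) (Submodule.smul_mem _ _ hv)

theorem coe_normalizedL_apply {μ : K} (r : ℤ) (v : ↥(A.multiplicativePart c ⊓ A.weightSpace μ)) :
    (A.normalizedL c μ r v : V) = c⁻¹ • A.H (-r) (A.L r v) - μ • (v : V) := rfl

theorem isVanishingFields_normalizedL (hc0 : c ≠ 0) (hc : ∀ v, A.H 0 v = c • v) (μ : K) :
    IsVanishingFields (A.normalizedL c μ) := by
  have hcomp (r s : ℤ) (v : ↥(A.multiplicativePart c ⊓ A.weightSpace μ)) :
      c⁻¹ • A.H (-r) (A.L r (c⁻¹ • A.H (-s) (A.L s v))) =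
        c⁻¹ • (A.H (-(r + s)) (A.L r (A.L s v)) - (s : K) • A.H (-s) (A.L s v)) := by
    rw [map_smul, map_smul, H_neg_L_comp r s v.2.1, inv_smul_smul₀ hc0]
  refine ⟨LinearMap.ext fun v => Subtype.ext ?_, fun r s v => Subtype.ext ?_⟩
  · rw [coe_normalizedL_apply, neg_zero, hc, inv_smul_smul₀ hc0, End.mem_eigenspace_iff.1 v.2.2,
      sub_self]
    rfl
  · have hlie : A.H (-(r + s)) (A.L r (A.L s v)) - A.H (-(r + s)) (A.L s (A.L r v)) =
        ((s : K) - r) • A.H (-(r + s)) (A.L (r + s) v) := by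
      rw [← map_sub, A.lie_L_L, map_smul]
    simp only [Submodule.coe_sub, Submodule.coe_add, Submodule.coe_smul, coe_normalizedL_apply,
      map_sub, map_smul, smul_sub] at hcomp ⊢
    rw [hcomp, hcomp, add_comm s r, sub_eq_iff_eq_add.1 hlie]
    module

theorem exists_intermediate_series_of_mem [CharZero K] [IsAlgClosed K] (hc0 : c ≠ 0)
    (hc : ∀ v, A.H 0 v = c • v) {μ : K} [FiniteDimensional K (A.weightSpace μ)] {φ₀ : V}
    (hφ₀ : φ₀ ∈ A.multiplicativePart c ⊓ A.weightSpace μ) (hφ₀0 : φ₀ ≠ 0) :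
    ∃ (b : K) (φ : V), φ ∈ A.multiplicativePart c ∧ φ ≠ 0 ∧
      ∀ r : ℤ, A.L r φ = (c⁻¹ * (μ + b * r)) • A.H r φ := by
  have : FiniteDimensional K ↥(A.multiplicativePart c ⊓ A.weightSpace μ) :=
    Submodule.finiteDimensional_of_le inf_le_right
  have : Nontrivial ↥(A.multiplicativePart c ⊓ A.weightSpace μ) :=
    Submodule.nontrivial_iff_ne_bot.2 ((Submodule.ne_bot_iff _).2 ⟨φ₀, hφ₀, hφ₀0⟩)
  obtain ⟨b, φ, hφ0, hφ⟩ := (isVanishingFields_normalizedL hc0 hc μ).exists_common_eigenvector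
  refine ⟨b, φ, φ.2.1, Subtype.coe_ne_coe.2 hφ0, fun r => ?_⟩
  have hr : c⁻¹ • A.H (-r) (A.L r φ) = (μ + b * r) • (φ : V) := by
    have h := congrArg Subtype.val (hφ r)
    rw [coe_normalizedL_apply, sub_eq_iff_eq_add, Submodule.coe_smul, ← add_smul] at h
    rw [h, add_comm, mul_comm]
  have hHr := congrArg (A.H r) hr
  rw [map_smul, map_smul, L_mem_multiplicativePart r φ.2.1, add_neg_cancel, hc,
    inv_smul_smul₀ hc0] at hHr
  rw [mul_smul, ← hHr, inv_smul_smul₀ hc0]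

theorem exists_intermediate_series [CharZero K] [IsAlgClosed K] (hc0 : c ≠ 0)
    (hc : ∀ v, A.H 0 v = c • v) {d : ℕ} (hd : A.WeightBounded d)
    (hw : ⨆ μ, A.weightSpace μ = ⊤) {μ : K} (hμ : A.weightSpace μ ≠ ⊥) :
    ∃ (b : K) (φ : ℤ → V), φ 0 ≠ 0 ∧ (∀ m i, A.H m (φ i) = c • φ (m + i)) ∧
      ∀ m i : ℤ, A.L m (φ i) = (μ + i + b * m) • φ (m + i) := by
  have := hd.finiteDimensional μ
  obtain ⟨φ₀, hφ₀, hφ₀0, hφ₀H⟩ := exists_H_H_eq_smul hc (H_bijective hc0 hc hd hw) hμ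
  obtain ⟨b, φ, hφ, hφ0, hL⟩ := exists_intermediate_series_of_mem hc0 hc ⟨hφ₀H, hφ₀⟩ hφ₀0
  refine ⟨b, fun i => c⁻¹ • A.H i φ, ?_, fun m i => ?_, fun m i => ?_⟩
  · simpa only [hc, inv_smul_smul₀ hc0] using hφ0
  · rw [map_smul, hφ, smul_comm]
  · have hLH := A.lie_L_H m i φ
    rw [sub_eq_iff_eq_add, hL, map_smul, hφ, add_comm i m] at hLH
    rw [map_smul, hLH]
    match_scalars
    field_simp
    ring

end HeisenbergVirasoroRep

/-- A `ℤ/2`-graded representation of the `N = 2` Ramond algebra modulo its centre, where `P m` and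
`Q m` stand for `G_m^+` and `G_m^-`. -/
structure RamondRep (K V : Type*) [Field K] [AddCommGroup V] [Module K V] extends
    HeisenbergVirasoroRep K V where
  P : ℤ → End K V
  Q : ℤ → End K V
  part : ZMod 2 → Submodule K V
  isCompl : IsCompl (part 0) (part 1)
  L_part : ∀ {τ} m {v}, v ∈ part τ → L m v ∈ part τ
  H_part : ∀ {τ} m {v}, v ∈ part τ → H m v ∈ part τ
  P_part : ∀ {τ} m {v}, v ∈ part τ → P m v ∈ part (τ + 1)
  Q_part : ∀ {τ} m {v}, v ∈ part τ → Q m v ∈ part (τ + 1)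
  lie_L_P : ∀ m n v, L m (P n v) - P n (L m v) = ((n : K) - m / 2) • P (m + n) v
  lie_L_Q : ∀ m n v, L m (Q n v) - Q n (L m v) = ((n : K) - m / 2) • Q (m + n) v
  lie_H_P : ∀ m n v, H m (P n v) - P n (H m v) = P (m + n) v
  lie_H_Q : ∀ m n v, H m (Q n v) - Q n (H m v) = -Q (m + n) v
  anti_P : ∀ m n v, P m (P n v) + P n (P m v) = 0
  anti_Q : ∀ m n v, Q m (Q n v) + Q n (Q m v) = 0
  anti_P_Q : ∀ m n v, P m (Q n v) + Q n (P m v) =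
    (-2 : K) • L (m + n) v + ((m : K) - n) • H (m + n) v

namespace RamondRep

variable {K V : Type*} [Field K] [AddCommGroup V] [Module K V] (A : RamondRep K V)

/-- The twist by the automorphism exchanging `G^+` and `G^-` and changing the sign of `H`. -/
def swap : RamondRep K V where
  L := A.L
  H m := -A.H m
  P := A.Q
  Q := A.P
  part := A.part
  isCompl := A.isCompl
  L_part := A.L_part
  H_part m _ hv := Submodule.neg_mem _ (A.H_part m hv)
  P_part := A.Q_part
  Q_part := A.P_part
  lie_L_L := A.lie_L_L
  lie_L_H m n v := by
    rw [LinearMap.neg_apply, LinearMap.neg_apply, LinearMap.neg_apply, map_neg, smul_neg,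
      ← A.lie_L_H]
    abel
  comm_H m n v := by simp [A.comm_H m n]
  lie_L_P := A.lie_L_Q
  lie_L_Q := A.lie_L_P
  lie_H_P m n v := by
    rw [LinearMap.neg_apply, LinearMap.neg_apply, map_neg, ← neg_neg (A.Q (m + n) v),
      ← A.lie_H_Q]
    abel
  lie_H_Q m n v := by
    rw [LinearMap.neg_apply, LinearMap.neg_apply, map_neg, ← A.lie_H_P]
    abel
  anti_P := A.anti_Q
  anti_Q := A.anti_P
  anti_P_Q m n v := by
    rw [add_comm, A.anti_P_Q, add_comm n m, LinearMap.neg_apply]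
    module

/-- Stability of a subspace under all operators of the representation. -/
structure Stable (N : Submodule K V) : Prop where
  L_mem : ∀ m, ∀ v ∈ N, A.L m v ∈ N
  H_mem : ∀ m, ∀ v ∈ N, A.H m v ∈ N
  P_mem : ∀ m, ∀ v ∈ N, A.P m v ∈ N
  Q_mem : ∀ m, ∀ v ∈ N, A.Q m v ∈ N

/-- A representation is simple if its only stable graded subspaces are the trivial ones; the zero
representation is not excluded. -/
def Simple : Prop :=
  ∀ N : Submodule K V, A.Stable N → N = (N ⊓ A.part 0) ⊔ (N ⊓ A.part 1) → N = ⊥ ∨ N = ⊤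

variable {A}

theorem stable_swap {N : Submodule K V} : A.swap.Stable N ↔ A.Stable N :=
  ⟨fun h => ⟨h.L_mem, fun m v hv => by simpa [swap] using h.H_mem m v hv, h.Q_mem, h.P_mem⟩,
    fun h => ⟨h.L_mem, fun m v hv => by simpa [swap] using h.H_mem m v hv, h.Q_mem, h.P_mem⟩⟩

theorem Simple.swap (h : A.Simple) : A.swap.Simple := fun N hN hgr =>
  h N (stable_swap.1 hN) hgr

theorem graded_iSup {ι : Type*} {p : ι → Submodule K V} (σ : ι → ZMod 2)
    (hp : ∀ i, p i ≤ A.part (σ i)) :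
    ⨆ i, p i = ((⨆ i, p i) ⊓ A.part 0) ⊔ ((⨆ i, p i) ⊓ A.part 1) := by
  refine le_antisymm (iSup_le fun i => ?_) (sup_le inf_le_left inf_le_left)
  rcases (by decide : ∀ s : ZMod 2, s = 0 ∨ s = 1) (σ i) with h | h
  · exact (le_inf (le_iSup p i) (h ▸ hp i)).trans le_sup_left
  · exact (le_inf (le_iSup p i) (h ▸ hp i)).trans le_sup_right

section Component

theorem P_mem (m : ℤ) {μ : K} {v : V} (hv : v ∈ A.weightSpace μ) :
    A.P m v ∈ A.weightSpace (μ + m) := by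
  rw [End.mem_eigenspace_iff] at hv ⊢
  have h := A.lie_L_P 0 m v
  rw [hv, map_smul, zero_add, sub_eq_iff_eq_add] at h
  rw [h, add_comm μ, add_smul, Int.cast_zero, zero_div, sub_zero]

theorem Q_mem (m : ℤ) {μ : K} {v : V} (hv : v ∈ A.weightSpace μ) :
    A.Q m v ∈ A.weightSpace (μ + m) :=
  P_mem (A := A.swap) m hv

variable (A) in
/-- The vectors of charge `c` and parity `τ`, the charge being the eigenvalue of `H 0`. -/
def chargeSpace (c : K) (τ : ZMod 2) : Submodule K V :=
  (A.H 0).eigenspace c ⊓ A.part τ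

variable {c : K} {τ : ZMod 2} {v : V}

theorem H_zero_apply (hv : v ∈ A.chargeSpace c τ) : A.H 0 v = c • v :=
  End.mem_eigenspace_iff.1 hv.1

theorem L_mem_chargeSpace (m : ℤ) (hv : v ∈ A.chargeSpace c τ) :
    A.L m v ∈ A.chargeSpace c τ := by
  refine ⟨End.mem_eigenspace_iff.2 ?_, A.L_part m hv.2⟩
  rw [A.H_L, H_zero_apply hv, map_smul, Int.cast_zero, zero_smul, sub_zero]

theorem H_mem_chargeSpace (m : ℤ) (hv : v ∈ A.chargeSpace c τ) :
    A.H m v ∈ A.chargeSpace c τ := by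
  refine ⟨End.mem_eigenspace_iff.2 ?_, A.H_part m hv.2⟩
  rw [A.comm_H, H_zero_apply hv, map_smul]

theorem P_mem_chargeSpace (m : ℤ) (hv : v ∈ A.chargeSpace c τ) :
    A.P m v ∈ A.chargeSpace (c + 1) (τ + 1) := by
  refine ⟨End.mem_eigenspace_iff.2 ?_, A.P_part m hv.2⟩
  rw [sub_eq_iff_eq_add'.1 (A.lie_H_P 0 m v), H_zero_apply hv, map_smul, zero_add, add_smul,
    one_smul]

theorem chargeSpace_swap (c : K) (τ : ZMod 2) : A.swap.chargeSpace (-c) τ = A.chargeSpace c τ := by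
  ext v
  simp [chargeSpace, swap]

theorem Q_mem_chargeSpace (m : ℤ) (hv : v ∈ A.chargeSpace c τ) :
    A.Q m v ∈ A.chargeSpace (c - 1) (τ + 1) := by
  rw [← chargeSpace_swap] at hv ⊢
  rw [neg_sub', sub_neg_eq_add]
  exact P_mem_chargeSpace (A := A.swap) m hv

end Component

section Lowered

/-- The `k`-fold images of `S` under the operators `Q r`. -/
def lowered (A : RamondRep K V) (S : Submodule K V) : ℕ → Submodule K V
  | 0 => S
  | k + 1 => ⨆ r, (lowered A S k).map (A.Q r)

variable {S : Submodule K V}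

theorem Q_mem_lowered (r : ℤ) {k : ℕ} {v : V} (hv : v ∈ A.lowered S k) :
    A.Q r v ∈ A.lowered S (k + 1) :=
  Submodule.mem_iSup_of_mem r ⟨v, hv, rfl⟩

theorem lowered_succ_le {k : ℕ} {N : Submodule K V} (h : ∀ r, ∀ v ∈ A.lowered S k, A.Q r v ∈ N) :
    A.lowered S (k + 1) ≤ N :=
  iSup_le fun r => Submodule.map_le_iff_le_comap.2 (h r)

theorem lowered_le_comap_L (hL : ∀ m, S ≤ S.comap (A.L m)) (m : ℤ) (k : ℕ) :
    A.lowered S k ≤ (A.lowered S k).comap (A.L m) := by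
  induction k with
  | zero => exact hL m
  | succ k ih =>
    refine lowered_succ_le fun r v hv => ?_
    rw [Submodule.mem_comap, sub_eq_iff_eq_add.1 (A.lie_L_Q m r v)]
    exact add_mem (Submodule.smul_mem _ _ (Q_mem_lowered _ hv)) (Q_mem_lowered _ (ih hv))

theorem lowered_le_comap_H (hH : ∀ m, S ≤ S.comap (A.H m)) (m : ℤ) (k : ℕ) :
    A.lowered S k ≤ (A.lowered S k).comap (A.H m) := by
  induction k with
  | zero => exact hH m
  | succ k ih =>
    refine lowered_succ_le fun r v hv => ?_
    rw [Submodule.mem_comap, sub_eq_iff_eq_add.1 (A.lie_H_Q m r v)]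
    exact add_mem (neg_mem (Q_mem_lowered _ hv)) (Q_mem_lowered _ (ih hv))

theorem stable_iSup_lowered (hL : ∀ m, S ≤ S.comap (A.L m)) (hH : ∀ m, S ≤ S.comap (A.H m))
    (hP : ∀ m, S ≤ LinearMap.ker (A.P m)) : A.Stable (⨆ k, A.lowered S k) := by
  have hle (f : End K V) (h : ∀ k, A.lowered S k ≤ (⨆ k, A.lowered S k).comap f) :
      ∀ v ∈ ⨆ k, A.lowered S k, f v ∈ ⨆ k, A.lowered S k := iSup_le h
  have hmono {f : End K V} {k l : ℕ} (h : A.lowered S k ≤ (A.lowered S l).comap f) :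
      A.lowered S k ≤ (⨆ k, A.lowered S k).comap f :=
    h.trans (Submodule.comap_mono (le_iSup (A.lowered S) l))
  have hQ (r : ℤ) (k : ℕ) : A.lowered S k ≤ (⨆ k, A.lowered S k).comap (A.Q r) :=
    hmono (l := k + 1) fun v hv => Q_mem_lowered r hv
  refine ⟨fun m => hle _ fun k => hmono (lowered_le_comap_L hL m k),
    fun m => hle _ fun k => hmono (lowered_le_comap_H hH m k), fun m => hle _ fun k => ?_,
    fun m => hle _ (hQ m)⟩
  induction k generalizing m with
  | zero => exact (hP m).trans (Submodule.comap_mono bot_le)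
  | succ k ih =>
    refine lowered_succ_le fun r v hv => ?_
    rw [Submodule.mem_comap, eq_sub_of_add_eq (A.anti_P_Q m r v)]
    refine sub_mem (add_mem (Submodule.smul_mem _ _ ?_) (Submodule.smul_mem _ _ ?_))
      (hle _ (hQ r) _ (ih m hv))
    · exact hmono (lowered_le_comap_L hL _ k) hv
    · exact hmono (lowered_le_comap_H hH _ k) hv

theorem lowered_le_chargeSpace {c : K} {τ : ZMod 2} (hS : S ≤ A.chargeSpace c τ) (k : ℕ) :
    A.lowered S k ≤ A.chargeSpace (c - k) (τ + k) := by
  induction k with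
  | zero => simpa [lowered] using hS
  | succ k ih =>
    refine lowered_succ_le fun r v hv => ?_
    have h := Q_mem_chargeSpace r (ih hv)
    rwa [sub_sub, add_assoc, ← Nat.cast_succ, ← Nat.cast_succ] at h

/-- The subspace generated by the vectors of charge `c - 1` killed by all `P s` avoids the
charge `c`. -/
theorem Simple.eq_zero_of_forall_P_eq_zero [CharZero K] (hA : A.Simple) {c : K}
    (hc : (A.H 0).eigenspace c ≠ ⊥) {τ : ZMod 2} {v : V} (hv : v ∈ A.chargeSpace (c - 1) τ)
    (hP : ∀ s, A.P s v = 0) : v = 0 := by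
  let S : Submodule K V := A.chargeSpace (c - 1) τ ⊓ ⨅ s, LinearMap.ker (A.P s)
  have hker {u : V} (hu : u ∈ S) (s : ℤ) : A.P s u = 0 := (Submodule.mem_iInf _).1 hu.2 s
  have hcharge (k : ℕ) := lowered_le_chargeSpace (inf_le_left : S ≤ _) k
  have hstable : A.Stable (⨆ k, A.lowered S k) := by
    refine stable_iSup_lowered (fun m u hu => ⟨L_mem_chargeSpace m hu.1, ?_⟩)
      (fun m u hu => ⟨H_mem_chargeSpace m hu.1, ?_⟩) fun m u hu => hker hu m
    · refine (Submodule.mem_iInf _).2 fun s => ?_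
      simpa [hker hu] using A.lie_L_P m s u
    · refine (Submodule.mem_iInf _).2 fun s => ?_
      simpa [hker hu] using A.lie_H_P m s u
  rcases hA _ hstable (graded_iSup _ fun k => (hcharge k).trans inf_le_right) with h | h
  · exact (Submodule.mem_bot K).1 <| h ▸ Submodule.mem_iSup_of_mem 0
      ⟨hv, (Submodule.mem_iInf _).2 hP⟩
  · refine absurd (((A.H 0).eigenspaces_iSupIndep c).eq_bot_of_le ?_) hc
    refine le_top.trans (h ▸ iSup_le fun k => ((hcharge k).trans inf_le_left).trans ?_)
    refine le_iSup₂_of_le (c - 1 - k) (fun hk => ?_) le_rfl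
    rw [sub_sub, sub_eq_self] at hk
    exact Nat.cast_add_one_ne_zero k ((add_comm _ _).trans hk)

end Lowered

end RamondRep

theorem apply_eq_apply_zero_of_skew_affine {K V : Type*} [Field K] [CharZero K] [AddCommGroup V]
    [Module K V] {X Y : ℤ → V}
    (h : ∀ r s : ℤ, Y s + (r : K) • X s = -(Y r + (s : K) • X r)) (m : ℤ) : X m = X 0 := by
  have := IsAddTorsionFree.of_isTorsionFree K V
  rcases eq_or_ne m 0 with rfl | hm
  · rfl
  have hY0 : Y 0 = 0 := by
    have h₀ := h 0 0
    rw [Int.cast_zero, zero_smul, add_zero] at h₀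
    exact self_eq_neg.1 h₀
  have hYm : Y m = -((m : K) • X 0) := by simpa [hY0] using h 0 m
  have hmm : Y m + (m : K) • X m = 0 := self_eq_neg.1 (h m m)
  rw [hYm, neg_add_eq_zero] at hmm
  exact (smul_right_injective V (Int.cast_ne_zero.2 hm) hmm).symm

namespace RamondRep

variable {K V : Type*} [Field K] [AddCommGroup V] [Module K V]

/-- A family `x i` of vectors of parity `τ` on which `L` and `H` act as on an intermediate series
module. -/
structure IsDensityFamily (A : RamondRep K V) (τ : ZMod 2) (a b c : K) (x : ℤ → V) : Prop where
  mem : ∀ i, x i ∈ A.part τ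
  L_apply : ∀ m i : ℤ, A.L m (x i) = (a + i + b * m) • x (m + i)
  H_apply : ∀ m i, A.H m (x i) = c • x (m + i)

/-- A family `x i` of vectors transforming like the vectors `v_i` of `R_{a,b,c}`. -/
structure IsFlatFamily (A : RamondRep K V) (τ : ZMod 2) (a b c : K) (x : ℤ → V) : Prop extends
    A.IsDensityFamily τ a b c x where
  P_apply : ∀ m i, A.P m (x i) = A.P 0 (x (m + i))
  Q_apply : ∀ m i, A.Q m (x i) = A.Q 0 (x (m + i))

variable {A : RamondRep K V} {τ : ZMod 2} {a b c : K} {w : ℤ → V}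

theorem IsFlatFamily.of_swap (h : A.swap.IsFlatFamily τ a b c w) :
    A.IsFlatFamily τ a b (-c) w where
  mem := h.mem
  L_apply := h.L_apply
  H_apply m i := by rw [neg_smul, ← h.H_apply, swap, LinearMap.neg_apply, neg_neg]
  P_apply := h.Q_apply
  Q_apply := h.P_apply

/-- The coefficient of `r` in `Q r (w (n - r))` when this is an affine function of `r`. -/
def slope (A : RamondRep K V) (w : ℤ → V) (n : ℤ) : V :=
  A.Q 1 (w (n - 1)) - A.Q 0 (w n)

namespace IsDensityFamily

variable (hw : A.IsDensityFamily τ a b c w)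

include hw

theorem mem_chargeSpace (i : ℤ) : w i ∈ A.chargeSpace c τ :=
  ⟨End.mem_eigenspace_iff.2 (by rw [hw.H_apply, zero_add]), hw.mem i⟩

theorem L_Q_apply (m r k : ℤ) : A.L m (A.Q r (w k)) =
    ((r : K) - m / 2) • A.Q (m + r) (w k) + (a + k + b * m) • A.Q r (w (m + k)) := by
  rw [sub_eq_iff_eq_add.1 (A.lie_L_Q m r _), hw.L_apply, map_smul]

theorem H_Q_apply (m r k : ℤ) :
    A.H m (A.Q r (w k)) = c • A.Q r (w (m + k)) - A.Q (m + r) (w k) := by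
  rw [sub_eq_iff_eq_add.1 (A.lie_H_Q m r _), hw.H_apply, map_smul, neg_add_eq_sub]

theorem P_Q_apply (hP : ∀ m i, A.P m (w i) = 0) (s r k : ℤ) : A.P s (A.Q r (w k)) =
    (-2 * (a + k + b * (s + r)) + (s - r) * c) • w (s + r + k) := by
  rw [eq_sub_of_add_eq (A.anti_P_Q s r _), hP, map_zero, hw.L_apply, hw.H_apply]
  push_cast
  module

/-- The second difference of `r ↦ Q r (w (n - r))` is killed by all `P s`. -/
theorem Q_apply_eq [CharZero K] (hP : ∀ m i, A.P m (w i) = 0) (hA : A.Simple) (hw0 : w ≠ 0)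
    (r k : ℤ) : A.Q r (w k) = A.Q 0 (w (r + k)) + (r : K) • A.slope w (r + k) := by
  obtain ⟨i, hi⟩ := Function.ne_iff.1 hw0
  have hmem (r k : ℤ) := Q_mem_chargeSpace r (hw.mem_chargeSpace k)
  rw [← sub_eq_zero]
  refine hA.eq_zero_of_forall_P_eq_zero (c := c) (τ := τ + 1)
    ((Submodule.ne_bot_iff _).2 ⟨w i, (hw.mem_chargeSpace i).1, hi⟩) ?_ fun s => ?_
  · exact sub_mem (hmem _ _) (add_mem (hmem _ _) (Submodule.smul_mem _ _
      (sub_mem (hmem _ _) (hmem _ _))))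
  · simp only [slope, map_sub, map_add, map_smul, hw.P_Q_apply hP, add_zero,
      show s + 1 + (r + k - 1) = s + r + k by ring, ← add_assoc]
    push_cast
    module

omit hw in
theorem Q_slope_apply [CharZero K]
    (hQ : ∀ r k, A.Q r (w k) = A.Q 0 (w (r + k)) + (r : K) • A.slope w (r + k)) (m n : ℤ) :
    A.Q m (A.slope w n) = A.Q 0 (A.slope w (m + n)) := by
  let X (s : ℤ) : V := A.Q s (A.slope w (m + n - s))
  let Y (s : ℤ) : V := A.Q s (A.Q 0 (w (m + n - s)))
  have hXY (r s : ℤ) : Y s + (r : K) • X s = A.Q s (A.Q r (w (m + n - s - r))) := by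
    rw [hQ r, add_sub_cancel, map_add, map_smul]
  have h := apply_eq_apply_zero_of_skew_affine (K := K) (X := X) (Y := Y) (fun r s => by
    rw [hXY, hXY, sub_right_comm, eq_neg_iff_add_eq_zero, A.anti_Q]) m
  simpa [X] using h

theorem isFlatFamily_slope [CharZero K] (hP : ∀ m i, A.P m (w i) = 0)
    (hQ : ∀ r k, A.Q r (w k) = A.Q 0 (w (r + k)) + (r : K) • A.slope w (r + k)) :
    A.IsFlatFamily (τ + 1) a (b + 1 / 2) (c - 1) (A.slope w) where
  mem n := sub_mem (A.Q_part _ (hw.mem _)) (A.Q_part _ (hw.mem _))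
  L_apply m n := by
    have h₁ : m + 1 + (n - 1) = m + n := by ring
    have h₂ : m + (n - 1) = m + n - 1 := by ring
    rw [slope, map_sub, hw.L_Q_apply, hw.L_Q_apply, hQ (m + 1), h₁, h₂, hQ 1, hQ (m + 0), add_zero,
      add_sub_cancel]
    push_cast
    module
  H_apply m n := by
    have h₁ : m + 1 + (n - 1) = m + n := by ring
    have h₂ : m + (n - 1) = m + n - 1 := by ring
    rw [slope, map_sub, hw.H_Q_apply, hw.H_Q_apply, hQ (m + 1), h₁, h₂, hQ 1, hQ (m + 0), add_zero,
      add_sub_cancel]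
    push_cast
    module
  P_apply m n := by
    have h₁ (s k : ℤ) : s + 1 + (k - 1) = s + k := by ring
    simp only [slope, map_sub, hw.P_Q_apply hP, h₁, add_zero, zero_add, add_sub_cancel]
    push_cast
    module
  Q_apply m n := Q_slope_apply hQ m n

end IsDensityFamily

/-- If `w` is not flat, then its slope is. -/
theorem Simple.exists_isFlatFamily_of_P_eq_zero [CharZero K] (hA : A.Simple)
    (hw : A.IsDensityFamily τ a b c w) (hw0 : w ≠ 0) (hP : ∀ m i, A.P m (w i) = 0) :
    ∃ (τ : ZMod 2) (a b c : K) (x : ℤ → V), A.IsFlatFamily τ a b c x ∧ x ≠ 0 := by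
  have hQ := hw.Q_apply_eq hP hA hw0
  by_cases hslope : A.slope w = 0
  · exact ⟨τ, a, b, c, w, ⟨hw, fun m i => by rw [hP, hP], fun m i => by simp [hQ m, hslope]⟩, hw0⟩
  · exact ⟨_, _, _, _, _, hw.isFlatFamily_slope hP hQ, hslope⟩

end RamondRep

theorem finite_setOf_inf_eigenspace_ne_bot {K V : Type*} [Field K] [AddCommGroup V] [Module K V]
    (f : End K V) (U : Submodule K V) [FiniteDimensional K U] :
    {c | U ⊓ f.eigenspace c ≠ ⊥}.Finite := by
  have h (c : {c | U ⊓ f.eigenspace c ≠ ⊥}) := (Submodule.ne_bot_iff _).1 c.2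
  choose v hv hv0 using h
  have hind : LinearIndependent K v := End.eigenvectors_linearIndependent f _ v
    fun c => ⟨(hv c).2, hv0 c⟩
  have hU : LinearIndependent K fun c => (⟨v c, (hv c).1⟩ : U) := .of_comp U.subtype hind
  exact Set.finite_coe_iff.1 hU.finite

namespace HeisenbergVirasoroRep

/-- The restriction of a representation to a stable subspace. -/
def restrict {K V : Type*} [Field K] [AddCommGroup V] [Module K V] (A : HeisenbergVirasoroRep K V)
    (S : Submodule K V) (hL : ∀ m, ∀ v ∈ S, A.L m v ∈ S) (hH : ∀ m, ∀ v ∈ S, A.H m v ∈ S) :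
    HeisenbergVirasoroRep K S where
  L m := (A.L m).restrict (hL m)
  H m := (A.H m).restrict (hH m)
  lie_L_L m n v := Subtype.ext (A.lie_L_L m n v)
  lie_L_H m n v := Subtype.ext (A.lie_L_H m n v)
  comm_H m n v := Subtype.ext (A.comm_H m n v)

end HeisenbergVirasoroRep

namespace RamondRep

variable {K V : Type*} [Field K] [AddCommGroup V] [Module K V] {A : RamondRep K V}

variable (A) in
/-- The representation of the even part on a space of fixed charge and parity. -/
def charge (c : K) (τ : ZMod 2) : HeisenbergVirasoroRep K (A.chargeSpace c τ) :=
  A.restrict _ (fun m _ hv => L_mem_chargeSpace m hv) fun m _ hv => H_mem_chargeSpace m hv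

variable {c μ : K} {τ : ZMod 2} {d : ℕ}

theorem charge_H_zero (v : A.chargeSpace c τ) : (A.charge c τ).H 0 v = c • v :=
  Subtype.ext (H_zero_apply v.2)

theorem iSup_weightSpace_charge (hw : ⨆ μ, A.weightSpace μ = ⊤) (c : K) (τ : ZMod 2) :
    ⨆ μ, (A.charge c τ).weightSpace μ = ⊤ :=
  iSup_eigenspace_restrict_eq_top hw fun _ hv => L_mem_chargeSpace 0 hv

variable (A) in
/-- The homogeneous parts of all weight spaces have dimension at most `d`. -/
def Bounded (d : ℕ) : Prop :=
  ∀ μ τ, Module.rank K ↥(A.weightSpace μ ⊓ A.part τ) ≤ d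

theorem Bounded.finiteDimensional (hd : A.Bounded d) (μ : K) (τ : ZMod 2) :
    FiniteDimensional K ↥(A.weightSpace μ ⊓ A.part τ) :=
  Module.rank_lt_aleph0_iff.1 ((hd μ τ).trans_lt Cardinal.natCast_lt_aleph0)

theorem Bounded.charge (hd : A.Bounded d) (c : K) (τ : ZMod 2) :
    (A.charge c τ).WeightBounded d := fun μ => by
  have hle : ((A.charge c τ).weightSpace μ).map (Submodule.subtype _) ≤
      A.weightSpace μ ⊓ A.part τ := by
    rintro _ ⟨v, hv, rfl⟩
    exact ⟨End.mem_eigenspace_iff.2 (congrArg Subtype.val (End.mem_eigenspace_iff.1 hv)), v.2.2⟩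
  rw [(Submodule.equivMapOfInjective _ (Submodule.injective_subtype _) _).rank_eq]
  exact (Submodule.rank_mono hle).trans (hd μ τ)

section Sector

variable (A) in
/-- The vectors of charge `c` and parity `τ` all of whose weights lie in `μ + ℤ`. -/
def sector (μ c : K) (τ : ZMod 2) : Submodule K V :=
  ⨆ i : ℤ, A.weightSpace (μ + i) ⊓ A.chargeSpace c τ

theorem sector_swap : A.swap.sector μ (-c) τ = A.sector μ c τ := by
  simp only [sector, chargeSpace_swap]
  rfl

theorem mem_sector {v : V} (i : ℤ) (hv : v ∈ A.weightSpace (μ + i)) (hv' : v ∈ A.chargeSpace c τ) :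
    v ∈ A.sector μ c τ :=
  Submodule.mem_iSup_of_mem i ⟨hv, hv'⟩

theorem sector_le_part : A.sector μ c τ ≤ A.part τ :=
  iSup_le fun _ => inf_le_right.trans inf_le_right

theorem sector_le_comap {f : End K V} {m : ℤ} {c' : K} {τ' : ZMod 2}
    (hf : ∀ ν, ∀ v ∈ A.weightSpace ν, f v ∈ A.weightSpace (ν + m))
    (hf' : ∀ v ∈ A.chargeSpace c τ, f v ∈ A.chargeSpace c' τ') :
    A.sector μ c τ ≤ (A.sector μ c' τ').comap f := by
  refine iSup_le fun i v hv => mem_sector (i + m) ?_ (hf' v hv.2)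
  rw [Int.cast_add, ← add_assoc]
  exact hf _ v hv.1

variable {v : V} (m : ℤ)

theorem L_mem_sector (hv : v ∈ A.sector μ c τ) : A.L m v ∈ A.sector μ c τ :=
  sector_le_comap (fun _ _ => A.L_mem m) (fun _ => L_mem_chargeSpace m) hv

theorem H_mem_sector (hv : v ∈ A.sector μ c τ) : A.H m v ∈ A.sector μ c τ :=
  sector_le_comap (fun _ _ => A.H_mem m) (fun _ => H_mem_chargeSpace m) hv

theorem P_mem_sector (hv : v ∈ A.sector μ c τ) : A.P m v ∈ A.sector μ (c + 1) (τ + 1) :=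
  sector_le_comap (fun _ _ => P_mem m) (fun _ => P_mem_chargeSpace m) hv

theorem Q_mem_sector (hv : v ∈ A.sector μ c τ) : A.Q m v ∈ A.sector μ (c - 1) (τ + 1) :=
  sector_le_comap (fun _ _ => Q_mem m) (fun _ => Q_mem_chargeSpace m) hv

end Sector

section Weight

variable [CharZero K] (hw : ⨆ μ, A.weightSpace μ = ⊤) (hd : A.Bounded d)

include hw hd

theorem weightSpace_inf_chargeSpace_ne_bot (hc0 : c ≠ 0) (h : A.sector μ c τ ≠ ⊥) :
    (A.weightSpace μ ⊓ A.part τ) ⊓ (A.H 0).eigenspace c ≠ ⊥ := by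
  obtain ⟨i, hi⟩ := not_forall.1 (mt iSup_eq_bot.2 h)
  obtain ⟨v, hv, hv0⟩ := (Submodule.ne_bot_iff _).1 hi
  have hH := H_mem_chargeSpace (-i) hv.2
  refine (Submodule.ne_bot_iff _).2 ⟨A.H (-i) v, ⟨⟨?_, hH.2⟩, hH.1⟩, fun h0 => hv0 ?_⟩
  · simpa using A.H_mem (-i) hv.1
  · have hinj := (HeisenbergVirasoroRep.H_bijective hc0 charge_H_zero (hd.charge c τ)
      (iSup_weightSpace_charge hw c τ) (-i)).1
    exact congrArg Subtype.val (@hinj ⟨v, hv.2⟩ 0 (by rw [map_zero]; exact Subtype.ext h0))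

theorem finite_sector_ne_bot (μ c : K) (τ : ZMod 2) :
    {j : ℤ | A.sector μ (c + j) (τ + j) ≠ ⊥}.Finite := by
  have := hd.finiteDimensional μ
  have hinj : Function.Injective fun j : ℤ => c + (j : K) :=
    (add_right_injective c).comp Int.cast_injective
  refine (((Set.finite_iUnion fun σ : ZMod 2 => finite_setOf_inf_eigenspace_ne_bot (A.H 0)
    (A.weightSpace μ ⊓ A.part σ)).insert 0).preimage hinj.injOn).subset fun j hj => ?_
  exact or_iff_not_imp_left.2 fun hj0 => Set.mem_iUnion.2
    ⟨τ + j, weightSpace_inf_chargeSpace_ne_bot hw hd hj0 hj⟩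

variable [IsAlgClosed K]

theorem Simple.exists_isFlatFamily_of_sector (hA : A.Simple) (hc0 : c ≠ 0)
    (hne : A.sector μ c τ ≠ ⊥) (hP : ∀ m, ∀ v ∈ A.sector μ c τ, A.P m v = 0) :
    ∃ (τ : ZMod 2) (a b c : K) (x : ℤ → V), A.IsFlatFamily τ a b c x ∧ x ≠ 0 := by
  obtain ⟨v, hv, hv0⟩ := (Submodule.ne_bot_iff _).1
    (weightSpace_inf_chargeSpace_ne_bot hw hd hc0 hne)
  obtain ⟨b, φ, hφ0, hφH, hφL⟩ := HeisenbergVirasoroRep.exists_intermediate_series hc0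
    charge_H_zero (hd.charge c τ) (iSup_weightSpace_charge hw c τ) (μ := μ)
    ((Submodule.ne_bot_iff _).2 ⟨⟨v, hv.2, hv.1.2⟩, End.mem_eigenspace_iff.2
      (Subtype.ext (End.mem_eigenspace_iff.1 hv.1.1)), fun h => hv0 (congrArg Subtype.val h)⟩)
  have hφ : A.IsDensityFamily τ μ b c fun i => (φ i : V) :=
    ⟨fun i => (φ i).2.2, fun m i => congrArg Subtype.val (hφL m i),
      fun m i => congrArg Subtype.val (hφH m i)⟩
  refine hA.exists_isFlatFamily_of_P_eq_zero hφ (fun h => hφ0 (Subtype.ext (congrFun h 0)))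
    fun m i => hP m _ (mem_sector i (End.mem_eigenspace_iff.2 ?_) (φ i).2)
  simpa using hφ.L_apply 0 i

omit [CharZero K] in
theorem exists_sector_ne_bot [Nontrivial V] : ∃ μ c τ, A.sector μ c τ ≠ ⊥ := by
  obtain ⟨τ, hτ⟩ : ∃ τ, A.part τ ≠ ⊥ := by
    by_contra! h
    have := A.isCompl.sup_eq_top
    rw [h, h, sup_bot_eq] at this
    exact bot_ne_top this
  obtain ⟨μ, v, hv, hv0, hμ⟩ := exists_eigenvector_mem hw (fun v => A.L_part 0) hτ
  have := hd.finiteDimensional μ τ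
  obtain ⟨u, hu, hu0, hH⟩ := exists_common_eigenvector (f := fun _ : Unit => A.H 0)
    (fun _ _ => Commute.refl _) (A.weightSpace μ ⊓ A.part τ)
    ((Submodule.ne_bot_iff _).2 ⟨v, ⟨End.mem_eigenspace_iff.2 hμ, hv⟩, hv0⟩)
    fun _ u hu => ⟨by simpa using A.H_mem 0 hu.1, A.H_part 0 hu.2⟩
  obtain ⟨c, hc⟩ := hH ()
  exact ⟨μ, c, τ, (Submodule.ne_bot_iff _).2
    ⟨u, mem_sector 0 (by simpa using hu.1) ⟨End.mem_eigenspace_iff.2 hc, hu.2⟩, hu0⟩⟩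

end Weight

section Degenerate

variable [CharZero K]

/-- If all odd operators vanish, then so do the even ones, being their anticommutators. -/
theorem Simple.rank_le_one_of_odd_eq_zero (hA : A.Simple) (hP : ∀ m v, A.P m v = 0)
    (hQ : ∀ m v, A.Q m v = 0) {u : V} (hu : u ∈ A.part τ) (hu0 : u ≠ 0) :
    Module.rank K V ≤ 1 := by
  have h (r s : ℤ) (v : V) : (-2 : K) • A.L (r + s) v + ((r : K) - s) • A.H (r + s) v = 0 := by
    rw [← A.anti_P_Q, hP, hQ, add_zero]
  have hH (n : ℤ) (v : V) : A.H n v = 0 := by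
    have h₁ := h (n + 1) (-1) v
    have h₂ := h n 0 v
    rw [add_neg_cancel_right] at h₁
    rw [add_zero] at h₂
    refine (smul_eq_zero.1 (?_ : (2 : K) • A.H n v = 0)).resolve_left two_ne_zero
    push_cast at h₁ h₂
    linear_combination (norm := module) h₁ - h₂
  have hL (n : ℤ) (v : V) : A.L n v = 0 := by simpa [hH] using h n 0 v
  have hspan : K ∙ u ≤ A.part τ := (Submodule.span_singleton_le_iff_mem ..).2 hu
  have htop : K ∙ u = ⊤ := by
    refine (hA (K ∙ u) ⟨?_, ?_, ?_, ?_⟩ ?_).resolve_left (mt Submodule.span_singleton_eq_bot.1 hu0)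
    · simp [hL]
    · simp [hH]
    · simp [hP]
    · simp [hQ]
    · simpa only [ciSup_unique] using graded_iSup (fun _ : Unit => τ) fun _ => hspan
  rw [← rank_top, ← htop]
  exact (rank_span_le _).trans_eq (Cardinal.mk_singleton u)

theorem Simple.rank_le_one_of_sector (hA : A.Simple) (hne : A.sector μ c τ ≠ ⊥)
    (hP : ∀ m, ∀ v ∈ A.sector μ c τ, A.P m v = 0) (hQ : ∀ m, ∀ v ∈ A.sector μ c τ, A.Q m v = 0) :
    Module.rank K V ≤ 1 := by
  obtain ⟨u, hu, hu0⟩ := (Submodule.ne_bot_iff _).1 hne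
  have htop : A.sector μ c τ = ⊤ := by
    refine (hA _ ⟨fun m _ => L_mem_sector m, fun m _ => H_mem_sector m, fun m v hv => ?_,
      fun m v hv => ?_⟩ ?_).resolve_left hne
    · exact hP m v hv ▸ zero_mem _
    · exact hQ m v hv ▸ zero_mem _
    · simpa only [ciSup_unique] using graded_iSup (fun _ : Unit => τ) fun _ => sector_le_part
  exact hA.rank_le_one_of_odd_eq_zero (fun m v => hP m v (htop ▸ trivial))
    (fun m v => hQ m v (htop ▸ trivial)) (sector_le_part hu) hu0

end Degenerate

/-- Only finitely many charges occur, so the largest one is killed by `G^+` and the smallest one by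
`G^-`; one of the two is nonzero. -/
theorem Simple.exists_isFlatFamily [CharZero K] [IsAlgClosed K] (hA : A.Simple)
    (hw : ⨆ μ, A.weightSpace μ = ⊤) (hd : A.Bounded d) (hV : 1 < Module.rank K V) :
    ∃ (τ : ZMod 2) (a b c : K) (x : ℤ → V), A.IsFlatFamily τ a b c x ∧ x ≠ 0 := by
  have : Nontrivial V := rank_pos_iff_nontrivial.1 (zero_lt_one.trans hV)
  obtain ⟨μ, c, τ, hne⟩ := exists_sector_ne_bot hw hd
  have hfin := finite_sector_ne_bot hw hd μ c τ
  have hnonempty : {j : ℤ | A.sector μ (c + j) (τ + j) ≠ ⊥}.Nonempty := ⟨0, by simpa using hne⟩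
  obtain ⟨j₁, hj₁, hmax⟩ := Set.exists_max_image _ id hfin hnonempty
  obtain ⟨j₀, hj₀, hmin⟩ := Set.exists_min_image _ id hfin hnonempty
  have hP (m : ℤ) : ∀ v ∈ A.sector μ (c + j₁) (τ + j₁), A.P m v = 0 := fun v hv => by
    by_contra h0
    refine (Int.lt_succ j₁).not_ge (hmax (j₁ + 1) ((Submodule.ne_bot_iff _).2 ⟨_, ?_, h0⟩))
    simpa [add_assoc] using P_mem_sector m hv
  have hQ (m : ℤ) : ∀ v ∈ A.sector μ (c + j₀) (τ + j₀), A.Q m v = 0 := fun v hv => by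
    by_contra h0
    refine (Int.pred_self_lt j₀).not_ge (hmin (j₀ - 1) ((Submodule.ne_bot_iff _).2 ⟨_, ?_, h0⟩))
    simpa [add_sub_assoc, add_assoc, CharTwo.sub_eq_add] using Q_mem_sector m hv
  by_cases hc₁ : c + j₁ = 0
  · by_cases hc₀ : c + j₀ = 0
    · obtain rfl : j₁ = j₀ := Int.cast_injective (add_left_cancel (hc₁.trans hc₀.symm))
      exact absurd hV (hA.rank_le_one_of_sector hj₁ hP hQ).not_gt
    · have hswap : A.swap.sector μ (-(c + j₀)) (τ + j₀) = _ := sector_swap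
      obtain ⟨σ, a, b, c', x, hx, hx0⟩ := Simple.exists_isFlatFamily_of_sector (A := A.swap) hw hd
        hA.swap (neg_ne_zero.2 hc₀) (hswap ▸ hj₀) fun m v hv => hQ m v (hswap.le hv)
      exact ⟨σ, a, b, -c', x, hx.of_swap, hx0⟩
  · exact hA.exists_isFlatFamily_of_sector hw hd hc₁ hj₁ hP

end RamondRep

section Heisenberg

variable {K V : Type*} [Field K] [AddCommGroup V] [Module K V]

section WeylPair

variable {X Y : End K V} {γ t : K} (h : ⁅X, Y⁆ = γ • 1) {v : V} (ht : Y (X v) = t • v)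

include h ht

theorem apply_apply_pow_of_lie_eq_smul_one (k : ℕ) :
    Y (X ((X ^ k) v)) = (t - k * γ) • (X ^ k) v := by
  have hXY (u : V) : Y (X u) = X (Y u) - γ • u := by
    have hu := LinearMap.congr_fun h u
    simp only [Ring.lie_def, LinearMap.sub_apply, End.mul_apply, LinearMap.smul_apply,
      End.one_apply] at hu
    rw [← hu, sub_sub_cancel]
  induction k with
  | zero => simpa using ht
  | succ k ih =>
    rw [hXY, pow_succ', End.mul_apply, ih, map_smul]
    push_cast
    module

theorem pow_apply_ne_zero_of_lie_eq_smul_one (hv : v ≠ 0) (hγ : ∀ i : ℕ, t ≠ i * γ) (k : ℕ) :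
    (X ^ k) v ≠ 0 := by
  induction k with
  | zero => exact hv
  | succ k ih =>
    intro h0
    have hk := apply_apply_pow_of_lie_eq_smul_one h ht k
    rw [← End.mul_apply X, ← pow_succ', h0, map_zero] at hk
    exact smul_ne_zero (sub_ne_zero.2 (hγ k)) ih hk.symm

end WeylPair

variable {H : ℤ → End K V} {γ : K}
  (hH : ∀ m n, ⁅H m, H n⁆ = if m + n = 0 then (m * γ : K) • 1 else 0)

include hH

theorem lie_apply_neg_eq_smul_one (n : ℤ) : ⁅H n, H (-n)⁆ = (n * γ : K) • 1 := by
  rw [hH, if_pos (add_neg_cancel n)]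

theorem commute_of_add_ne_zero {m n : ℤ} (h : m + n ≠ 0) : Commute (H m) (H n) :=
  commute_iff_lie_eq.2 (by rw [hH, if_neg h])

theorem commute_neg_mul_self {m n : ℤ} (h : m + n ≠ 0) (h' : m - n ≠ 0) :
    Commute (H m) (H (-n) * H n) :=
  (commute_of_add_ne_zero hH h').mul_right (commute_of_add_ne_zero hH h)

theorem commute_neg_mul_self_neg_mul_self (m n : ℕ) :
    Commute (H (-m) * H m) (H (-n) * H n) := by
  rcases eq_or_ne m n with rfl | h
  · exact Commute.refl _
  · exact (commute_neg_mul_self hH (by omega) (by omega)).mul_left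
      (commute_neg_mul_self hH (by omega) (by omega))

variable [CharZero K] (hγ : γ ≠ 0)

include hγ

theorem exists_eq_or_eq_neg_forall_ne {n : ℤ} (hn : n ≠ 0) {v : V} {t : K}
    (ht : H (-n) (H n v) = t • v) :
    ∃ k, (k = n ∨ k = -n) ∧ ∃ s : K, H (-k) (H k v) = s • v ∧ ∀ i : ℕ, s ≠ i * (k * γ) := by
  by_cases h : ∀ i : ℕ, t ≠ i * (n * γ)
  · exact ⟨n, Or.inl rfl, t, ht, h⟩
  · push Not at h
    obtain ⟨i, hi⟩ := h
    refine ⟨-n, Or.inr rfl, t + n * γ, ?_, fun j hj => ?_⟩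
    · have hlie := LinearMap.congr_fun (lie_apply_neg_eq_smul_one hH n) v
      rw [Ring.lie_def, LinearMap.sub_apply, End.mul_apply, End.mul_apply, ht,
        sub_eq_iff_eq_add'] at hlie
      rw [neg_neg, hlie, add_smul]
      rfl
    · have hij : ((i + 1 + j : ℕ) : K) * (n * γ) = 0 := by
        push_cast at hj ⊢
        linear_combination hj - hi
      rcases mul_eq_zero.1 hij with h0 | h0
      · exact absurd (Nat.cast_eq_zero.1 h0) (by omega)
      · exact mul_ne_zero (Int.cast_ne_zero.2 hn) hγ h0

/-- The vectors `H q ^ j (H p ^ f j v)` are eigenvectors of `H (-q) * H q` for different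
eigenvalues. -/
theorem card_le_finrank_of_heisenberg {p q : ℤ} (hq : q ≠ 0) (hpq : p + q ≠ 0) (hpq' : p - q ≠ 0)
    {v : V} (hv : v ≠ 0) {s t : K} (hs : H (-p) (H p v) = s • v) (hs' : ∀ i : ℕ, s ≠ i * (p * γ))
    (ht : H (-q) (H q v) = t • v) (ht' : ∀ i : ℕ, t ≠ i * (q * γ)) {U : Submodule K V}
    [FiniteDimensional K U] {F : Finset ℕ} {f : ℕ → ℕ}
    (hU : ∀ j ∈ F, (H q ^ j) ((H p ^ f j) v) ∈ U) : F.card ≤ finrank K U := by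
  have htp (k : ℕ) : H (-q) (H q ((H p ^ k) v)) = t • (H p ^ k) v := by
    rw [← End.mul_apply, ← End.mul_apply,
      ← ((commute_neg_mul_self hH hpq hpq').pow_left k).eq, End.mul_apply, End.mul_apply, ht,
      map_smul]
  have hp0 := pow_apply_ne_zero_of_lie_eq_smul_one (lie_apply_neg_eq_smul_one hH p) hs hv hs'
  have hlie := lie_apply_neg_eq_smul_one hH q
  have hindep : LinearIndependent K fun j : F => (H q ^ (j : ℕ)) ((H p ^ f j) v) := by
    refine End.eigenvectors_linearIndependent' (H (-q) * H q) (fun j : F => t - j * (q * γ))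
      (fun i j hij => ?_) _ fun j => ⟨End.mem_eigenspace_iff.2 ?_, ?_⟩
    · exact Subtype.ext (Nat.cast_injective (mul_right_cancel₀
        (mul_ne_zero (Int.cast_ne_zero.2 hq) hγ) (sub_right_injective hij)))
    · exact apply_apply_pow_of_lie_eq_smul_one hlie (htp _) j
    · exact pow_apply_ne_zero_of_lie_eq_smul_one hlie (htp _) (hp0 _) ht' j
  have hindepU : LinearIndependent K fun j : F => (⟨_, hU j j.2⟩ : U) := .of_comp U.subtype hindep
  simpa using hindepU.fintype_card_le_finrank

omit hH hγ [CharZero K] in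
theorem pow_apply_mem_of_shift {E : K → Submodule K V}
    (hE : ∀ (m : ℤ) (μ : K), ∀ v ∈ E μ, H m v ∈ E (μ + m))
    (m : ℤ) {μ : K} {v : V} (hv : v ∈ E μ) (k : ℕ) :
    (H m ^ k) v ∈ E (μ + k * m) := by
  induction k with
  | zero => simpa using hv
  | succ k ih =>
    rw [pow_succ', End.mul_apply]
    convert hE m _ _ ih using 2
    push_cast; ring

end Heisenberg

theorem heisenberg_level_eq_zero {K V : Type*} [Field K] [CharZero K] [IsAlgClosed K]
    [AddCommGroup V] [Module K V] {H : ℤ → End K V} {γ : K}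
    (hH : ∀ m n, ⁅H m, H n⁆ = if m + n = 0 then (m * γ : K) • 1 else 0)
    {E : K → Submodule K V} (hE : ∀ (m : ℤ) (μ : K), ∀ v ∈ E μ, H m v ∈ E (μ + m)) {d : ℕ}
    (hd : ∀ μ, Module.rank K (E μ) ≤ d) {μ : K} (hμ : E μ ≠ ⊥) : γ = 0 := by
  by_contra hγ
  have hfin (ν : K) : FiniteDimensional K (E ν) :=
    Module.rank_lt_aleph0_iff.1 ((hd ν).trans_lt Cardinal.natCast_lt_aleph0)
  obtain ⟨v, hv, hv0, hN⟩ := exists_common_eigenvector (f := fun n : ℕ => H (-n) * H n)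
    (commute_neg_mul_self_neg_mul_self hH) (E μ) hμ fun n v hv => by
      simpa using hE (-n) _ _ (hE n _ _ hv)
  obtain ⟨t₁, h₁⟩ := hN 1
  obtain ⟨t₂, h₂⟩ := hN 2
  obtain ⟨p, hp, s, hs, hs'⟩ := exists_eq_or_eq_neg_forall_ne hH hγ one_ne_zero h₁
  obtain ⟨q, hq, t, ht, ht'⟩ := exists_eq_or_eq_neg_forall_ne hH hγ two_ne_zero h₂
  obtain ⟨f, w, hf⟩ : ∃ (f : ℕ → ℕ) (w : ℤ), ∀ j ∈ Finset.range (d + 1), f j * p + j * q = w := by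
    by_cases hpq : q = 2 * p
    · refine ⟨fun j => 2 * (d - j), 2 * d * p, fun j hj => ?_⟩
      rw [Finset.mem_range, Nat.lt_succ_iff] at hj
      push_cast [Nat.cast_sub hj]
      rw [hpq]
      ring
    · obtain rfl : q = -2 * p := by omega
      exact ⟨fun j => 2 * j, 0, fun j _ => by push_cast; ring⟩
  have hU (j : ℕ) (hj : j ∈ Finset.range (d + 1)) : (H q ^ j) ((H p ^ f j) v) ∈ E (μ + w) := by
    convert pow_apply_mem_of_shift hE q (pow_apply_mem_of_shift hE p hv (f j)) j using 2
    rw [← hf j hj]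
    push_cast
    ring
  have hcard := card_le_finrank_of_heisenberg hH hγ (by omega) (by omega) (by omega) hv0 hs hs' ht
    ht' hU
  rw [Finset.card_range] at hcard
  exact absurd (hcard.trans (Module.finrank_le_of_rank_le (hd _))) (Nat.not_succ_le_self d)

theorem eq_of_le_of_codisjoint_of_disjoint {α : Type*} [Lattice α] [BoundedOrder α]
    [IsModularLattice α] {a b c d : α} (hac : a ≤ c) (hbd : b ≤ d) (hab : Codisjoint a b)
    (hcd : Disjoint c d) : a = c :=
  eq_of_le_of_inf_le_of_sup_le hac (((hcd.mono_right hbd).le_bot).trans bot_le)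
    (le_top.trans hab.eq_top.ge)

theorem eigenspace_eq_inf_sup_inf {K V : Type*} [Field K] [AddCommGroup V] [Module K V]
    {p q : Submodule K V} (hpq : IsCompl p q) {f : End K V} (hp : p ≤ p.comap f)
    (hq : q ≤ q.comap f) (κ : K) :
    f.eigenspace κ = (f.eigenspace κ ⊓ p) ⊔ (f.eigenspace κ ⊓ q) := by
  refine le_antisymm (fun v hv => ?_) (sup_le inf_le_left inf_le_left)
  obtain ⟨x, hx, y, hy, rfl⟩ := Submodule.mem_sup.1 (hpq.sup_eq_top.ge (Submodule.mem_top (x := v)))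
  rw [End.mem_eigenspace_iff, map_add, smul_add, ← sub_eq_zero, add_sub_add_comm] at hv
  have hx0 : f x - κ • x = 0 := Submodule.disjoint_def.1 hpq.disjoint _
    (sub_mem (hp hx) (p.smul_mem κ hx)) (by
      rw [eq_neg_of_add_eq_zero_left hv]
      exact neg_mem (sub_mem (hq hy) (q.smul_mem κ hy)))
  rw [hx0, zero_add] at hv
  exact Submodule.add_mem_sup ⟨End.mem_eigenspace_iff.2 (sub_eq_zero.1 hx0), hx⟩
    ⟨End.mem_eigenspace_iff.2 (sub_eq_zero.1 hv), hy⟩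

namespace SuperModule

theorem Isomorphic.symm {A V W : Type*} [AddCommGroup A] [Module ℂ A] [LieSuperalgebra A]
    [AddCommGroup V] [Module ℂ V] [AddCommGroup W] [Module ℂ W] {M : SuperModule A V}
    {N : SuperModule A W} (h : M.Isomorphic N) : N.Isomorphic M := by
  obtain ⟨e, hpart, hact⟩ := h
  refine ⟨e.symm, fun τ w hw => ?_, fun x w => ?_⟩
  · have hle (σ) : (M.part σ).map (e : V →ₗ[ℂ] W) ≤ N.part σ :=
      Submodule.map_le_iff_le_comap.2 (hpart σ)
    have hcodisj :
        Codisjoint ((M.part 0).map (e : V →ₗ[ℂ] W)) ((M.part 1).map (e : V →ₗ[ℂ] W)) := by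
      rw [codisjoint_iff, ← Submodule.map_sup, M.isCompl.sup_eq_top, Submodule.map_top,
        LinearEquiv.range]
    have heq : (M.part τ).map (e : V →ₗ[ℂ] W) = N.part τ := by
      rcases (by decide : ∀ s : ZMod 2, s = 0 ∨ s = 1) τ with rfl | rfl
      · exact eq_of_le_of_codisjoint_of_disjoint (hle 0) (hle 1) hcodisj N.isCompl.disjoint
      · exact eq_of_le_of_codisjoint_of_disjoint (hle 1) (hle 0) hcodisj.symm
          N.isCompl.disjoint.symm
    obtain ⟨v, hv, rfl⟩ := heq.ge hw
    simpa using hv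
  · rw [LinearEquiv.symm_apply_eq, hact, LinearEquiv.apply_symm_apply]

variable {V : Type*} [AddCommGroup V] [Module ℂ V] {M : SuperModule Ramond V}

theorem act_mem_of_act_single_mem {N : Submodule ℂ V}
    (h : ∀ i, ∀ v ∈ N, M.act (Finsupp.single i 1) v ∈ N) (x : Ramond) {v : V} (hv : v ∈ N) :
    M.act x v ∈ N := by
  induction x using Finsupp.induction_linear with
  | zero => simp
  | add x y hx hy => simpa using add_mem hx hy
  | single i t =>
    rw [← Finsupp.smul_single_one, map_smul]
    exact N.smul_mem t (h i v hv)

theorem act_mem_part_of_even {x : Ramond} (hx : x ∈ Ramond.part 0) {τ : ZMod 2} {v : V}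
    (hv : v ∈ M.part τ) : M.act x v ∈ M.part τ :=
  zero_add τ ▸ M.act_mem hx hv

variable (M)

theorem act_act_sub_act_act {x y : Ramond} {σ : ZMod 2} (hx : x ∈ Ramond.part 0)
    (hy : y ∈ Ramond.part σ) (v : V) :
    M.act x (M.act y v) - M.act y (M.act x v) = M.act (Ramond.bracket x y) v := by
  have h := M.act_bracket v hx hy
  rwa [ZMod.val_zero, zero_mul, pow_zero, one_smul] at h

theorem act_act_add_act_act {x y : Ramond} (hx : x ∈ Ramond.part 1) (hy : y ∈ Ramond.part 1)
    (v : V) : M.act x (M.act y v) + M.act y (M.act x v) = M.act (Ramond.bracket x y) v := by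
  have h := M.act_bracket v hx hy
  rwa [ZMod.val_one, mul_one, pow_one, neg_one_smul, sub_neg_eq_add] at h

theorem act_C_act_single (i : RamondIndex) (v : V) :
    M.act Ramond.C (M.act (Finsupp.single i 1) v) =
      M.act (Finsupp.single i 1) (M.act Ramond.C v) := by
  rw [← sub_eq_zero, M.act_act_sub_act_act Ramond.C_mem (Ramond.single_mem_part i),
    Ramond.bracket_C_left, map_zero, LinearMap.zero_apply]

variable {M}

theorem act_C_mem_weightSpace {μ : ℂ} {v : V} (hv : v ∈ M.weightSpace μ) :
    M.act Ramond.C v ∈ M.weightSpace μ := by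
  rw [weightSpace, End.mem_eigenspace_iff] at hv ⊢
  exact (M.act_C_act_single (.L 0) v).symm.trans (hv ▸ map_smul _ _ _)

theorem act_H_mem_weightSpace (m : ℤ) {μ : ℂ} {v : V} (hv : v ∈ M.weightSpace μ) :
    M.act (Ramond.H m) v ∈ M.weightSpace (μ + m) := by
  rw [weightSpace, End.mem_eigenspace_iff] at hv ⊢
  have h := M.act_act_sub_act_act (Ramond.L_mem 0) (Ramond.H_mem m) v
  rw [hv, Ramond.bracket_L_H, zero_add, map_smul, map_smul, LinearMap.smul_apply,
    sub_eq_iff_eq_add] at h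
  rw [h, add_comm, add_smul]

theorem IsWeight.exists_weightSpace_inf_part_ne_bot [Nontrivial V] (hw : M.IsWeight) :
    ∃ μ τ, M.weightSpace μ ⊓ M.part τ ≠ ⊥ := by
  by_contra! h
  have hbot (μ : ℂ) : M.weightSpace μ = ⊥ := by
    rw [weightSpace, eigenspace_eq_inf_sup_inf M.isCompl
      (fun _ => act_mem_part_of_even (Ramond.L_mem 0))
      (fun _ => act_mem_part_of_even (Ramond.L_mem 0)), ← weightSpace, h, h, sup_bot_eq]
  refine top_ne_bot (α := Submodule ℂ V) ?_
  rw [← hw, iSup_congr hbot, iSup_bot]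

theorem IsSimple.exists_act_C_eq_smul (hs : M.IsSimple) {μ : ℂ} {τ : ZMod 2}
    (hμ : M.weightSpace μ ⊓ M.part τ ≠ ⊥)
    [FiniteDimensional ℂ ↥(M.weightSpace μ ⊓ M.part τ)] :
    ∃ κ : ℂ, ∀ v, M.act Ramond.C v = κ • v := by
  obtain ⟨u, -, hu0, hC⟩ := exists_common_eigenvector (f := fun _ : Unit => M.act Ramond.C)
    (fun _ _ => Commute.refl _) _ hμ fun _ v hv =>
      ⟨act_C_mem_weightSpace hv.1, act_mem_part_of_even Ramond.C_mem hv.2⟩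
  obtain ⟨κ, hκ⟩ := hC ()
  refine ⟨κ, fun v => ?_⟩
  have hsub : M.IsSubmodule (End.eigenspace (M.act Ramond.C) κ) := by
    refine ⟨fun x v hv => act_mem_of_act_single_mem (fun i v hv => ?_) x hv,
      eigenspace_eq_inf_sup_inf M.isCompl (fun _ => act_mem_part_of_even Ramond.C_mem)
        (fun _ => act_mem_part_of_even Ramond.C_mem) κ⟩
    rw [End.mem_eigenspace_iff] at hv ⊢
    rw [act_C_act_single, hv, map_smul]
  have htop := (hs.2 _ hsub).resolve_left
    ((Submodule.ne_bot_iff _).2 ⟨u, End.mem_eigenspace_iff.2 hκ, hu0⟩)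
  exact End.mem_eigenspace_iff.1 (htop.ge Submodule.mem_top)

theorem IsCuspidal.act_C_eq_zero (hs : M.IsSimple) (hM : M.IsCuspidal) (v : V) :
    M.act Ramond.C v = 0 := by
  obtain ⟨hw, d, -, hd⟩ := hM
  have := hs.1
  obtain ⟨μ, τ, hμ⟩ := hw.exists_weightSpace_inf_part_ne_bot
  have : FiniteDimensional ℂ ↥(M.weightSpace μ ⊓ M.part τ) :=
    Module.rank_lt_aleph0_iff.1 ((hd μ τ).trans_lt Cardinal.natCast_lt_aleph0)
  obtain ⟨κ, hκ⟩ := hs.exists_act_C_eq_smul hμ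
  have hlevel : κ / 3 = 0 := by
    refine heisenberg_level_eq_zero (H := fun m => M.act (Ramond.H m)) (fun m n => ?_)
      (E := fun μ => M.weightSpace μ ⊓ M.part τ) (fun m μ v hv =>
        ⟨act_H_mem_weightSpace m hv.1, act_mem_part_of_even (Ramond.H_mem m) hv.2⟩)
      (fun μ => hd μ τ) hμ
    refine LinearMap.ext fun v =>
      (M.act_act_sub_act_act (Ramond.H_mem m) (Ramond.H_mem n) v).trans ?_
    rw [Ramond.bracket_H_H, map_smul, LinearMap.smul_apply, hκ]
    split_ifs
    · rw [smul_smul, div_mul_eq_mul_div, mul_div_assoc]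
      rfl
    · rw [zero_smul, LinearMap.zero_apply]
  rw [hκ, (div_eq_zero_iff.1 hlevel).resolve_right three_ne_zero, zero_smul]

/-- The operators of a module on which the central element acts by zero. -/
noncomputable def toRamondRep (M : SuperModule Ramond V) (hC : ∀ v, M.act Ramond.C v = 0) :
    RamondRep ℂ V where
  L m := M.act (Ramond.L m)
  H m := M.act (Ramond.H m)
  P m := M.act (Ramond.Gp m)
  Q m := M.act (Ramond.Gm m)
  part := M.part
  isCompl := M.isCompl
  L_part m _ hv := act_mem_part_of_even (Ramond.L_mem m) hv
  H_part m _ hv := act_mem_part_of_even (Ramond.H_mem m) hv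
  P_part {τ} m _ hv := add_comm 1 τ ▸ M.act_mem (Ramond.Gp_mem m) hv
  Q_part {τ} m _ hv := add_comm 1 τ ▸ M.act_mem (Ramond.Gm_mem m) hv
  lie_L_L m n v := by
    simp only [M.act_act_sub_act_act (Ramond.L_mem m) (Ramond.L_mem n), Ramond.bracket_L_L,
      map_add, map_smul, LinearMap.add_apply, LinearMap.smul_apply, hC, smul_zero, add_zero]
  lie_L_H m n v := by
    simp [M.act_act_sub_act_act (Ramond.L_mem m) (Ramond.H_mem n), Ramond.bracket_L_H]
  comm_H m n v := by
    rw [← sub_eq_zero, M.act_act_sub_act_act (Ramond.H_mem m) (Ramond.H_mem n),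
      Ramond.bracket_H_H, map_smul, LinearMap.smul_apply, hC, smul_zero]
  lie_L_P m n v := by
    simp [M.act_act_sub_act_act (Ramond.L_mem m) (Ramond.Gp_mem n), Ramond.bracket_L_Gp]
  lie_L_Q m n v := by
    simp [M.act_act_sub_act_act (Ramond.L_mem m) (Ramond.Gm_mem n), Ramond.bracket_L_Gm]
  lie_H_P m n v := by
    rw [M.act_act_sub_act_act (Ramond.H_mem m) (Ramond.Gp_mem n), Ramond.bracket_H_Gp]
  lie_H_Q m n v := by
    simp [M.act_act_sub_act_act (Ramond.H_mem m) (Ramond.Gm_mem n), Ramond.bracket_H_Gm]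
  anti_P m n v := by
    simp [M.act_act_add_act_act (Ramond.Gp_mem m) (Ramond.Gp_mem n), Ramond.bracket_Gp_Gp]
  anti_Q m n v := by
    simp [M.act_act_add_act_act (Ramond.Gm_mem m) (Ramond.Gm_mem n), Ramond.bracket_Gm_Gm]
  anti_P_Q m n v := by
    simp only [M.act_act_add_act_act (Ramond.Gp_mem m) (Ramond.Gm_mem n), Ramond.bracket_Gp_Gm,
      map_add, map_smul, LinearMap.add_apply, LinearMap.smul_apply, hC, smul_zero, add_zero]

theorem isSubmodule_iff (hC : ∀ v, M.act Ramond.C v = 0) {N : Submodule ℂ V} :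
    M.IsSubmodule N ↔ (M.toRamondRep hC).Stable N ∧ N = (N ⊓ M.part 0) ⊔ (N ⊓ M.part 1) := by
  refine and_congr_left fun _ => ⟨fun h => ⟨fun m => h _, fun m => h _, fun m => h _, fun m => h _⟩,
    fun h x v hv => act_mem_of_act_single_mem (fun i v hv => ?_) x hv⟩
  cases i with
  | L m => exact h.L_mem m v hv
  | H m => exact h.H_mem m v hv
  | Gp m => exact h.P_mem m v hv
  | Gm m => exact h.Q_mem m v hv
  | C => exact (hC v).symm ▸ N.zero_mem

theorem isSimple_iff (hC : ∀ v, M.act Ramond.C v = 0) :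
    M.IsSimple ↔ Nontrivial V ∧ (M.toRamondRep hC).Simple := by
  simp only [IsSimple, isSubmodule_iff hC, and_imp]
  rfl

end SuperModule

namespace RamondRep

variable {K V : Type*} [Field K] [AddCommGroup V] [Module K V] {A : RamondRep K V} {τ : ZMod 2}
  {a b c : K} {x : ℤ → V}

theorem P_P_self [CharZero K] (m : ℤ) (v : V) : A.P m (A.P m v) = 0 := by
  have := IsAddTorsionFree.of_isTorsionFree K V
  exact self_eq_neg.1 (eq_neg_of_add_eq_zero_left (A.anti_P m m v))

theorem Q_P_eq (m n : ℤ) (v : V) : A.Q m (A.P n v) =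
    (-2 : K) • A.L (n + m) v + ((n : K) - m) • A.H (n + m) v - A.P n (A.Q m v) :=
  eq_sub_of_add_eq' (A.anti_P_Q n m v)

namespace IsFlatFamily

variable (h : A.IsFlatFamily τ a b c x) (m k : ℤ)

include h

theorem swap : A.swap.IsFlatFamily τ a b (-c) x :=
  ⟨⟨h.mem, h.L_apply, fun m i => by rw [RamondRep.swap, LinearMap.neg_apply, h.H_apply, neg_smul]⟩,
    h.Q_apply, h.P_apply⟩

theorem P_P [CharZero K] : A.P m (A.P 0 (x k)) = 0 := by
  rw [← sub_add_cancel k m, add_comm, ← h.P_apply, P_P_self]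

theorem Q_Q [CharZero K] : A.Q m (A.Q 0 (x k)) = 0 :=
  h.swap.P_P m k

theorem L_P : A.L m (A.P 0 (x k)) = (a + k + (b - 1 / 2) * m) • A.P 0 (x (m + k)) := by
  rw [sub_eq_iff_eq_add.1 (A.lie_L_P m 0 (x k)), h.L_apply, map_smul, add_zero, h.P_apply]
  push_cast
  module

theorem L_Q : A.L m (A.Q 0 (x k)) = (a + k + (b - 1 / 2) * m) • A.Q 0 (x (m + k)) :=
  h.swap.L_P m k

theorem H_P : A.H m (A.P 0 (x k)) = (c + 1) • A.P 0 (x (m + k)) := by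
  rw [sub_eq_iff_eq_add.1 (A.lie_H_P m 0 (x k)), h.H_apply, map_smul, add_zero, h.P_apply]
  module

theorem H_Q : A.H m (A.Q 0 (x k)) = (c - 1) • A.Q 0 (x (m + k)) := by
  rw [sub_eq_iff_eq_add.1 (A.lie_H_Q m 0 (x k)), h.H_apply, map_smul, add_zero, h.Q_apply]
  module

theorem Q_P : A.Q m (A.P 0 (x k)) =
    -A.P 0 (A.Q 0 (x (m + k))) - (2 * a + 2 * k + (2 * b + c) * m) • x (m + k) := by
  rw [Q_P_eq, h.Q_apply, zero_add, h.L_apply, h.H_apply]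
  push_cast
  module

theorem P_Q : A.P m (A.Q 0 (x k)) =
    A.P 0 (A.Q 0 (x (m + k))) + ((c + 2 - 2 * b) * m) • x (m + k) := by
  have hzero := h.Q_P 0 (m + k)
  rw [zero_add] at hzero
  rw [eq_sub_of_add_eq (A.anti_P_Q m 0 (x k)), h.P_apply, hzero, add_zero, h.L_apply, h.H_apply]
  push_cast
  module

theorem L_P_Q [CharZero K] : A.L m (A.P 0 (A.Q 0 (x k))) =
    (a + k + (b - 1) * m) • A.P 0 (A.Q 0 (x (m + k))) +
      (1 / 2 * (2 * b - c - 2) * (m : K) ^ 2) • x (m + k) := by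
  rw [sub_eq_iff_eq_add.1 (A.lie_L_P m 0 _), h.L_Q, map_smul, add_zero, h.P_Q]
  push_cast
  module

theorem H_P_Q : A.H m (A.P 0 (A.Q 0 (x k))) =
    c • A.P 0 (A.Q 0 (x (m + k))) - ((m : K) * (2 * b - c - 2)) • x (m + k) := by
  rw [sub_eq_iff_eq_add.1 (A.lie_H_P m 0 _), h.H_Q, map_smul, add_zero, h.P_Q]
  module

theorem P_P_Q [CharZero K] :
    A.P m (A.P 0 (A.Q 0 (x k))) = ((2 * b - c - 2) * m) • A.P 0 (x (m + k)) := by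
  rw [eq_neg_of_add_eq_zero_left (A.anti_P m 0 _), h.P_Q, map_add, map_smul, P_P_self]
  module

theorem Q_P_Q [CharZero K] : A.Q m (A.P 0 (A.Q 0 (x k))) =
    -(2 * a + 2 * k + (2 * b + c - 2) * m) • A.Q 0 (x (m + k)) := by
  rw [Q_P_eq, h.Q_Q, map_zero, zero_add, h.L_Q, h.H_Q]
  push_cast
  module

end IsFlatFamily

/-- The images of the basis vectors of `R_{a,b,c}` determined by a family `x`. -/
def familyVector (A : RamondRep K V) (x : ℤ → V) : RModIndex → V
  | .v i => x i
  | .vp i => A.P 0 (x i)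
  | .vm i => A.Q 0 (x i)
  | .vpm i => A.P 0 (A.Q 0 (x i))

theorem familyVector_mem_span (k : RModIndex) :
    A.familyVector x k ∈ Submodule.span K (Set.range (A.familyVector x)) :=
  Submodule.subset_span ⟨k, rfl⟩

theorem stable_span {S : Set V} (hL : ∀ m, ∀ v ∈ S, A.L m v ∈ Submodule.span K S)
    (hH : ∀ m, ∀ v ∈ S, A.H m v ∈ Submodule.span K S)
    (hP : ∀ m, ∀ v ∈ S, A.P m v ∈ Submodule.span K S)
    (hQ : ∀ m, ∀ v ∈ S, A.Q m v ∈ Submodule.span K S) : A.Stable (Submodule.span K S) where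
  L_mem m := Submodule.span_le (p := (Submodule.span K S).comap (A.L m)).2 (hL m)
  H_mem m := Submodule.span_le (p := (Submodule.span K S).comap (A.H m)).2 (hH m)
  P_mem m := Submodule.span_le (p := (Submodule.span K S).comap (A.P m)).2 (hP m)
  Q_mem m := Submodule.span_le (p := (Submodule.span K S).comap (A.Q m)).2 (hQ m)

theorem graded_span {S : Set V} (hS : ∀ v ∈ S, ∃ σ, v ∈ A.part σ) :
    Submodule.span K S = (Submodule.span K S ⊓ A.part 0) ⊔ (Submodule.span K S ⊓ A.part 1) := by
  choose σ hσ using fun v : S => hS v v.2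
  rw [Submodule.span_eq_iSup_of_singleton_spans, iSup_subtype']
  exact graded_iSup σ fun v => (Submodule.span_singleton_le_iff_mem ..).2 (hσ v)

namespace IsFlatFamily

variable (h : A.IsFlatFamily τ a b c x)

include h

theorem familyVector_mem_part (k : RModIndex) :
    A.familyVector x k ∈ A.part (τ + RSpace.parity k) := by
  cases k with
  | v i => exact (add_zero τ).symm ▸ h.mem i
  | vp i => exact A.P_part 0 (h.mem i)
  | vm i => exact A.Q_part 0 (h.mem i)
  | vpm i =>
    have hmem := A.P_part 0 (A.Q_part 0 (h.mem i))
    rwa [add_assoc, CharTwo.add_self_eq_zero] at hmem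

variable [CharZero K]

theorem stable_span_familyVector :
    A.Stable (Submodule.span K (Set.range (A.familyVector x))) := by
  have hv (i) : x i ∈ Submodule.span K (Set.range (A.familyVector x)) :=
    familyVector_mem_span (.v i)
  have hvp (i) : A.P 0 (x i) ∈ Submodule.span K (Set.range (A.familyVector x)) :=
    familyVector_mem_span (.vp i)
  have hvm (i) : A.Q 0 (x i) ∈ Submodule.span K (Set.range (A.familyVector x)) :=
    familyVector_mem_span (.vm i)
  have hvpm (i) : A.P 0 (A.Q 0 (x i)) ∈ Submodule.span K (Set.range (A.familyVector x)) :=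
    familyVector_mem_span (.vpm i)
  refine stable_span ?_ ?_ ?_ ?_ <;> rintro m _ ⟨k | k | k | k, rfl⟩ <;>
    simp only [familyVector, h.L_apply, h.L_P, h.L_Q, h.L_P_Q, h.H_apply, h.H_P, h.H_Q, h.H_P_Q,
      h.P_apply m, h.P_P, h.P_Q m, h.P_P_Q m, h.Q_apply m, h.Q_P m, h.Q_Q, h.Q_P_Q m, add_mem,
      sub_mem, neg_mem, zero_mem, Submodule.smul_mem, hv, hvp, hvm, hvpm]

theorem span_familyVector_eq_top (hA : A.Simple) (hx : x ≠ 0) :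
    Submodule.span K (Set.range (A.familyVector x)) = ⊤ := by
  obtain ⟨i, hi⟩ := Function.ne_iff.1 hx
  refine (hA _ h.stable_span_familyVector (graded_span ?_)).resolve_left
    ((Submodule.ne_bot_iff _).2 ⟨x i, familyVector_mem_span (.v i), hi⟩)
  rintro _ ⟨k, rfl⟩
  exact ⟨_, h.familyVector_mem_part k⟩

theorem stable_span_lower (hbc : 2 * b - c = 2) :
    A.Stable (Submodule.span K
      (Set.range (fun i => A.Q 0 (x i)) ∪ Set.range fun i => A.P 0 (A.Q 0 (x i)))) := by
  obtain rfl : c = 2 * b - 2 := by linear_combination -hbc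
  set N := Submodule.span K
    (Set.range (fun i => A.Q 0 (x i)) ∪ Set.range fun i => A.P 0 (A.Q 0 (x i))) with hN
  have hvm (i) : A.Q 0 (x i) ∈ N := Submodule.subset_span (.inl ⟨i, rfl⟩)
  have hvpm (i) : A.P 0 (A.Q 0 (x i)) ∈ N := Submodule.subset_span (.inr ⟨i, rfl⟩)
  refine stable_span ?_ ?_ ?_ ?_ <;> rw [← hN] <;> rintro m _ (⟨k, rfl⟩ | ⟨k, rfl⟩) <;>
    simp [h.L_Q, h.L_P_Q, h.H_Q, h.H_P_Q, h.P_Q m, h.P_P_Q m, h.Q_Q, h.Q_P_Q m, Submodule.smul_mem,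
      hvm, hvpm]

end IsFlatFamily

end RamondRep

section Eigenspace

variable {K V ι : Type*} [Field K] [AddCommGroup V] [Module K V] {f : End K V} {y : ι → V}
  {t : ι → K}

theorem eigenspace_inf_span_range (hf : ∀ i, f (y i) = t i • y i) (μ : K) :
    f.eigenspace μ ⊓ Submodule.span K (Set.range y) = Submodule.span K (y '' {i | t i = μ}) := by
  set p := Submodule.span K (y '' {i | t i = μ})
  set q := Submodule.span K (y '' {i | t i = μ}ᶜ)
  have hp : p ≤ f.eigenspace μ := Submodule.span_le.2 (by
    rintro _ ⟨i, rfl, rfl⟩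
    exact End.mem_eigenspace_iff.2 (hf i))
  have hq : q ≤ ⨆ ν, ⨆ (_ : ν ≠ μ), f.eigenspace ν := Submodule.span_le.2 (by
    rintro _ ⟨i, hi, rfl⟩
    exact Submodule.mem_iSup_of_mem _ (Submodule.mem_iSup_of_mem hi
      (End.mem_eigenspace_iff.2 (hf i))))
  have hpq : p ⊔ q = Submodule.span K (Set.range y) := by
    rw [← Submodule.span_union, ← Set.image_union, Set.union_compl_self, Set.image_univ]
  have hdisj : Disjoint (f.eigenspace μ) q := (f.eigenspaces_iSupIndep μ).mono_right hq
  rw [← hpq, inf_comm, sup_inf_assoc_of_le _ hp, inf_comm, hdisj.eq_bot, sup_bot_eq]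

theorem rank_eigenspace_inf_span_range_le_one (hf : ∀ i, f (y i) = t i • y i)
    (ht : Function.Injective t) (μ : K) :
    Module.rank K ↥(f.eigenspace μ ⊓ Submodule.span K (Set.range y)) ≤ 1 := by
  rw [eigenspace_inf_span_range hf]
  refine (rank_span_le _).trans (Cardinal.mk_le_one_iff_set_subsingleton.2 ?_)
  exact Set.Subsingleton.image (fun i hi j hj => ht (hi.trans hj.symm)) y

end Eigenspace

theorem exists_int_affine_ne_zero {K : Type*} [Field K] [CharZero K] {s t : K} (hs : s ≠ 0)
    (ht : t ≠ 0) (p q : K) : ∃ j : ℤ, s * j + p ≠ 0 ∧ t * j + q ≠ 0 := by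
  have hfin {s : K} (hs : s ≠ 0) (p : K) : {j : ℤ | s * j + p = 0}.Finite :=
    Set.Subsingleton.finite fun i hi j hj =>
      Int.cast_injective (mul_left_cancel₀ hs (add_right_cancel (hi.trans hj.symm)))
  obtain ⟨j, hj⟩ := ((hfin hs p).union (hfin ht q)).exists_notMem
  exact ⟨j, not_or.1 hj⟩

theorem intermediate_series_mem {K V : Type*} [Field K] [CharZero K] [AddCommGroup V] [Module K V]
    {L : ℤ → End K V} {N : Submodule K V} (hN : ∀ m, ∀ v ∈ N, L m v ∈ N) {a b : K} {x : ℤ → V}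
    (hx : ∀ m i : ℤ, L m (x i) = (a + i + b * m) • x (m + i)) (hb : b ≠ 0) (hb' : 1 - b ≠ 0)
    {i : ℤ} (hi : x i ∈ N) (n : ℤ) : x n ∈ N := by
  have step {k l : ℤ} (hkl : a + k + b * (l - k) ≠ 0) (hk : x k ∈ N) : x l ∈ N := by
    have hmem := hN (l - k) _ hk
    rwa [hx, sub_add_cancel, Int.cast_sub, N.smul_mem_iff hkl] at hmem
  obtain ⟨j, hij, hjn⟩ := exists_int_affine_ne_zero hb hb' (a + i - b * i) (a + b * n)
  have hj : x j ∈ N := step (by convert hij using 1; ring) hi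
  exact step (by convert hjn using 1; ring) hj

namespace RamondRep

variable {K V : Type*} [Field K] [AddCommGroup V] [Module K V] [CharZero K] {A : RamondRep K V}
  {τ : ZMod 2} {a b c : K} {x : ℤ → V}

theorem bounded_one_of_span_eq_top {y z : ℤ → V} (hy : ∀ i, y i ∈ A.part τ)
    (hz : ∀ i, z i ∈ A.part (τ + 1)) (hLy : ∀ i : ℤ, A.L 0 (y i) = (a + i) • y i)
    (hLz : ∀ i : ℤ, A.L 0 (z i) = (a + i) • z i)
    (htop : Submodule.span K (Set.range y ∪ Set.range z) = ⊤) : A.Bounded 1 := by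
  have hinj : Function.Injective fun i : ℤ => a + i :=
    (add_right_injective a).comp Int.cast_injective
  have hcodisj : Codisjoint (Submodule.span K (Set.range y)) (Submodule.span K (Set.range z)) := by
    rwa [codisjoint_iff, ← Submodule.span_union]
  have hyle : Submodule.span K (Set.range y) ≤ A.part τ :=
    Submodule.span_le.2 (Set.range_subset_iff.2 hy)
  have hzle : Submodule.span K (Set.range z) ≤ A.part (τ + 1) :=
    Submodule.span_le.2 (Set.range_subset_iff.2 hz)
  have hdisj : Disjoint (A.part τ) (A.part (τ + 1)) := by
    rcases (by decide : ∀ s : ZMod 2, s = 0 ∨ s = 1) τ with rfl | rfl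
    exacts [A.isCompl.disjoint, A.isCompl.disjoint.symm]
  intro μ σ
  rw [Nat.cast_one]
  rcases (by decide : ∀ s t : ZMod 2, s = t ∨ s = t + 1) σ τ with rfl | rfl
  · rw [← eq_of_le_of_codisjoint_of_disjoint hyle hzle hcodisj hdisj]
    exact rank_eigenspace_inf_span_range_le_one hLy hinj μ
  · rw [← eq_of_le_of_codisjoint_of_disjoint hzle hyle hcodisj.symm hdisj.symm]
    exact rank_eigenspace_inf_span_range_le_one hLz hinj μ

namespace IsFlatFamily

section Degenerate

theorem bounded_one_of_eq (h : A.IsFlatFamily τ a b c x) (hA : A.Simple) (hx : x ≠ 0)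
    (hbc : 2 * b - c = 2) : A.Bounded 1 := by
  have hv (i : ℤ) : A.L 0 (x i) = (a + i) • x i := by simp [h.L_apply]
  have hvp (i : ℤ) : A.L 0 (A.P 0 (x i)) = (a + i) • A.P 0 (x i) := by simp [h.L_P]
  have hvm (i : ℤ) : A.L 0 (A.Q 0 (x i)) = (a + i) • A.Q 0 (x i) := by simp [h.L_Q]
  have hvpm (i : ℤ) : A.L 0 (A.P 0 (A.Q 0 (x i))) = (a + i) • A.P 0 (A.Q 0 (x i)) := by
    simp [h.L_P_Q]
  have hmem (i : ℤ) := A.Q_part 0 (h.mem i)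
  have hgraded : ∀ v ∈ (Set.range fun i => A.Q 0 (x i)) ∪ Set.range fun i => A.P 0 (A.Q 0 (x i)),
      ∃ σ, v ∈ A.part σ := by
    rintro _ (⟨i, rfl⟩ | ⟨i, rfl⟩)
    exacts [⟨_, hmem i⟩, ⟨_, A.P_part 0 (hmem i)⟩]
  rcases hA _ (h.stable_span_lower hbc) (graded_span hgraded) with hbot | htop
  · have hQ (i : ℤ) : A.Q 0 (x i) = 0 :=
      (Submodule.mem_bot K).1 (hbot.le (Submodule.subset_span (.inl ⟨i, rfl⟩)))
    refine bounded_one_of_span_eq_top h.mem (fun i => A.P_part 0 (h.mem i)) hv hvp ?_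
    rw [← top_le_iff, ← h.span_familyVector_eq_top hA hx, Submodule.span_le]
    rintro _ ⟨k | k | k | k, rfl⟩
    · exact Submodule.subset_span (.inl ⟨k, rfl⟩)
    · exact Submodule.subset_span (.inr ⟨k, rfl⟩)
    all_goals simp [familyVector, hQ]
  · exact bounded_one_of_span_eq_top hmem (fun i => A.P_part 0 (hmem i)) hvm hvpm htop

theorem ne_and_ne_of_not_bounded_one (h : A.IsFlatFamily τ a b c x) (hA : A.Simple) (hx : x ≠ 0)
    (hd : ¬ A.Bounded 1) : 2 * b + c ≠ 2 ∧ 2 * b - c ≠ 2 :=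
  ⟨fun hbc => hd (h.swap.bounded_one_of_eq hA.swap hx (by rwa [sub_neg_eq_add])),
    fun hbc => hd (h.bounded_one_of_eq hA hx hbc)⟩

end Degenerate

section Generation

variable (h : A.IsFlatFamily τ a b c x) {N : Submodule K V} (hN : A.Stable N)

include h hN

theorem mem_of_P_mem (hbc : 2 * b + c ≠ 2) (hbc' : 2 * b - c ≠ 2) {i : ℤ} (hi : A.P 0 (x i) ∈ N)
    (n : ℤ) : x n ∈ N := by
  have hP (k : ℤ) : A.P 0 (x k) ∈ N := by
    by_cases hc : c + 1 = 0
    · exact intermediate_series_mem (x := fun k => A.P 0 (x k)) hN.L_mem h.L_P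
        (fun hb => hbc' (by linear_combination 2 * hb - hc))
        (fun hb => hbc (by linear_combination -2 * hb + hc)) hi k
    · have hmem := hN.H_mem (k - i) _ hi
      rwa [h.H_P, sub_add_cancel, N.smul_mem_iff hc] at hmem
  have h0 := hN.Q_mem 0 _ (hP n)
  have h1 := hN.Q_mem 1 _ (hP (n - 1))
  rw [h.Q_P, zero_add] at h0
  rw [h.Q_P, add_sub_cancel] at h1
  refine (N.smul_mem_iff (s := 2 * b + c - 2) (sub_ne_zero.2 hbc)).1 ?_
  convert N.sub_mem h0 h1 using 1
  push_cast
  module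

theorem mem_of_Q_mem (hbc : 2 * b + c ≠ 2) (hbc' : 2 * b - c ≠ 2) {i : ℤ} (hi : A.Q 0 (x i) ∈ N)
    (n : ℤ) : x n ∈ N :=
  h.swap.mem_of_P_mem (stable_swap.2 hN) (by rwa [← sub_eq_add_neg]) (by rwa [sub_neg_eq_add]) hi n

theorem mem_of_combination_mem (hbc : 2 * b + c ≠ 2) (hbc' : 2 * b - c ≠ 2) {i : ℤ} {α β γ δ : K}
    (hw : α • x i + β • A.P 0 (x i) + γ • A.Q 0 (x i) + δ • A.P 0 (A.Q 0 (x i)) ∈ N)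
    (hw0 : α • x i + β • A.P 0 (x i) + γ • A.Q 0 (x i) + δ • A.P 0 (A.Q 0 (x i)) ≠ 0) (n : ℤ) :
    x n ∈ N := by
  have hodd : β • A.P 0 (x i) - γ • A.Q 0 (x i) ∈ N := by
    convert N.sub_mem (hN.H_mem 0 _ hw) (N.smul_mem c hw) using 1
    simp only [map_add, map_smul, h.H_apply, h.H_P, h.H_Q, h.H_P_Q, zero_add, Int.cast_zero,
      zero_mul, zero_smul, sub_zero]
    module
  have hodd' : β • A.P 0 (x i) + γ • A.Q 0 (x i) ∈ N := by
    convert N.sub_mem (hN.H_mem 0 _ hodd) (N.smul_mem c hodd) using 1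
    simp only [map_sub, map_smul, h.H_P, h.H_Q, zero_add]
    module
  rcases ne_or_eq β 0 with hβ | rfl
  · refine h.mem_of_P_mem hN hbc hbc' (i := i)
      ((N.smul_mem_iff (mul_ne_zero two_ne_zero hβ)).1 ?_) n
    convert N.add_mem hodd' hodd using 1
    module
  rcases ne_or_eq γ 0 with hγ | rfl
  · refine h.mem_of_Q_mem hN hbc hbc' (i := i)
      ((N.smul_mem_iff (mul_ne_zero two_ne_zero hγ)).1 ?_) n
    convert N.sub_mem hodd' hodd using 1
    module
  have hP (r : ℤ) : (α + δ * ((2 * b - c - 2) * r)) • A.P 0 (x (r + i)) ∈ N := by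
    convert hN.P_mem r _ hw using 1
    simp only [map_add, map_smul, h.P_apply r, h.P_P_Q r, zero_smul, map_zero]
    module
  rcases ne_or_eq α 0 with hα | rfl
  · exact h.mem_of_P_mem hN hbc hbc' ((N.smul_mem_iff (by simpa using hα)).1 (hP 0)) n
  · have hδ : δ ≠ 0 := fun hδ => hw0 (by simp [hδ])
    refine h.mem_of_P_mem hN hbc hbc' (i := 1 + i) ((N.smul_mem_iff ?_).1 (hP 1)) n
    simpa using And.intro hδ (sub_ne_zero.2 hbc')

end Generation

end IsFlatFamily

end RamondRep

/-- The degree `i` of each of the basis vectors `v_i, v_i^+, v_i^-, v_i^{+-}`; the weight of such a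
vector of `R_{a,b,c}` is `a + i`. -/
def RModIndex.degree : RModIndex → ℤ
  | .v i | .vp i | .vm i | .vpm i => i

theorem RModIndex.setOf_degree_eq (i : ℤ) : {k | degree k = i} = {v i, vp i, vm i, vpm i} := by
  ext k
  cases k <;> simp [degree]

namespace RamondRep.IsFlatFamily

variable {K V : Type*} [Field K] [AddCommGroup V] [Module K V] [CharZero K] {A : RamondRep K V}
  {τ : ZMod 2} {a b c : K} {x : ℤ → V} (h : A.IsFlatFamily τ a b c x)

include h

theorem L_zero_familyVector (k : RModIndex) :
    A.L 0 (A.familyVector x k) = (a + k.degree) • A.familyVector x k := by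
  cases k <;> simp [familyVector, RModIndex.degree, h.L_apply, h.L_P, h.L_Q, h.L_P_Q]

variable (htop : Submodule.span K (Set.range (A.familyVector x)) = ⊤)

include htop

theorem iSup_weightSpace_eq_top : ⨆ μ, A.weightSpace μ = ⊤ := by
  rw [← top_le_iff, ← htop, Submodule.span_le]
  rintro _ ⟨k, rfl⟩
  exact Submodule.mem_iSup_of_mem _ (End.mem_eigenspace_iff.2 (h.L_zero_familyVector k))

theorem exists_eq_combination {μ : K} {w : V} (hw : A.L 0 w = μ • w) (hw0 : w ≠ 0) :
    ∃ (i : ℤ) (α β γ δ : K),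
      w = α • x i + β • A.P 0 (x i) + γ • A.Q 0 (x i) + δ • A.P 0 (A.Q 0 (x i)) := by
  have hspan : w ∈ Submodule.span K (A.familyVector x '' {k | a + k.degree = μ}) := by
    rw [← eigenspace_inf_span_range h.L_zero_familyVector, htop, inf_top_eq]
    exact End.mem_eigenspace_iff.2 hw
  obtain ⟨k, hk⟩ : {k : RModIndex | a + k.degree = μ}.Nonempty := by
    by_contra! hempty
    rw [hempty, Set.image_empty, Submodule.span_empty, Submodule.mem_bot] at hspan
    exact hw0 hspan
  obtain rfl : a + k.degree = μ := hk
  simp only [add_right_inj, Int.cast_inj, RModIndex.setOf_degree_eq, Set.image_insert_eq,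
    Set.image_singleton, Submodule.mem_span_insert, Submodule.mem_span_singleton] at hspan
  obtain ⟨α, _, ⟨β, _, ⟨γ, _, ⟨δ, rfl⟩, rfl⟩, rfl⟩, rfl⟩ := hspan
  exact ⟨k.degree, α, β, γ, δ, by simp only [familyVector, add_assoc]⟩

theorem eq_bot_or_eq_top (hbc : 2 * b + c ≠ 2) (hbc' : 2 * b - c ≠ 2) {N : Submodule K V}
    (hN : A.Stable N) : N = ⊥ ∨ N = ⊤ := by
  refine or_iff_not_imp_left.2 fun hbot => top_le_iff.1 ?_
  obtain ⟨μ, w, hwN, hw0, hw⟩ :=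
    exists_eigenvector_mem (h.iSup_weightSpace_eq_top htop) (hN.L_mem 0) hbot
  obtain ⟨i, α, β, γ, δ, rfl⟩ := h.exists_eq_combination htop hw hw0
  have hx := h.mem_of_combination_mem hN hbc hbc' hwN hw0
  rw [← htop, Submodule.span_le]
  rintro _ ⟨k | k | k | k, rfl⟩
  exacts [hx k, hN.P_mem 0 _ (hx k), hN.Q_mem 0 _ (hx k), hN.P_mem 0 _ (hN.Q_mem 0 _ (hx k))]

end RamondRep.IsFlatFamily

theorem RamondRep.Bounded.exists_forall_exists_smul_eq {K V : Type*} [Field K] [AddCommGroup V]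
    [Module K V] {A : RamondRep K V} (hd : A.Bounded 1) (μ : K) (τ : ZMod 2) :
    ∃ u, ∀ v ∈ A.weightSpace μ ⊓ A.part τ, ∃ t : K, t • u = v := by
  obtain ⟨u, hu⟩ := (rank_submodule_le_one_iff' _).1 ((hd μ τ).trans_eq Nat.cast_one)
  exact ⟨u, fun v hv => Submodule.mem_span_singleton.1 (hu hv)⟩

namespace RModule

variable (a b c : ℂ)

/-- The operators of `R_{a,b,c}`, on which the central element acts by zero. -/
noncomputable def ramondRep : RamondRep ℂ RSpace :=
  (RModule a b c).toRamondRep (RSpace.act_C a b c)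

theorem isFlatFamily_v : (ramondRep a b c).IsFlatFamily 0 a b c RSpace.v where
  mem := RSpace.v_mem
  L_apply := RSpace.act_L_v a b c
  H_apply := RSpace.act_H_v a b c
  P_apply m i := (RSpace.act_Gp_v a b c m i).trans
    ((RSpace.act_Gp_v a b c 0 _).trans (by rw [zero_add])).symm
  Q_apply m i := (RSpace.act_Gm_v a b c m i).trans
    ((RSpace.act_Gm_v a b c 0 _).trans (by rw [zero_add])).symm

theorem familyVector_v (k : RModIndex) :
    (ramondRep a b c).familyVector RSpace.v k = Finsupp.single k 1 := by
  have hP (i : ℤ) : (ramondRep a b c).P 0 (RSpace.v i) = RSpace.vp i :=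
    (RSpace.act_Gp_v a b c 0 i).trans (by rw [zero_add])
  have hQ (i : ℤ) : (ramondRep a b c).Q 0 (RSpace.v i) = RSpace.vm i :=
    (RSpace.act_Gm_v a b c 0 i).trans (by rw [zero_add])
  cases k with
  | v i => rfl
  | vp i => exact hP i
  | vm i => exact hQ i
  | vpm i =>
    refine (congrArg _ (hQ i)).trans ((RSpace.act_Gp_vm a b c 0 i).trans ?_)
    rw [zero_add, Int.cast_zero, mul_zero, zero_smul, add_zero]
    rfl

theorem span_familyVector_v :
    Submodule.span ℂ (Set.range ((ramondRep a b c).familyVector RSpace.v)) = ⊤ := by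
  rw [funext (familyVector_v a b c), ← Finsupp.coe_basisSingleOne, Basis.span_eq]

theorem not_bounded_one : ¬ (ramondRep a b c).Bounded 1 := fun hd => by
  obtain ⟨u, hu⟩ := hd.exists_forall_exists_smul_eq a 0
  have hmem (k : RModIndex) (hdeg : k.degree = 0) (hpar : RSpace.parity k = 0) :
      ∃ t : ℂ, t • u = Finsupp.single k 1 := by
    refine hu _ ⟨End.mem_eigenspace_iff.2 ?_, ?_⟩
    · simpa [hdeg, familyVector_v] using (isFlatFamily_v a b c).L_zero_familyVector k
    · exact hpar ▸ RSpace.single_mem_part k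
  obtain ⟨s, hs⟩ := hmem (.v 0) rfl rfl
  obtain ⟨t, ht⟩ := hmem (.vpm 0) rfl rfl
  have hsv : s * u (.v 0) = 1 := by simpa using DFunLike.congr_fun hs (.v 0)
  have hspm : s * u (.vpm 0) = 0 := by simpa using DFunLike.congr_fun hs (.vpm 0)
  have htpm : t * u (.vpm 0) = 1 := by simpa using DFunLike.congr_fun ht (.vpm 0)
  rw [(mul_eq_zero.1 hspm).resolve_left (left_ne_zero_of_mul_eq_one hsv), mul_zero] at htpm
  exact zero_ne_one htpm

variable {a b c}

theorem isSimple_iff : (RModule a b c).IsSimple ↔ 2 * b + c ≠ 2 ∧ 2 * b - c ≠ 2 := by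
  have hv0 : RSpace.v 0 ≠ 0 := by simp [RSpace.v]
  rw [SuperModule.isSimple_iff (RSpace.act_C a b c)]
  refine ⟨fun h => (isFlatFamily_v a b c).ne_and_ne_of_not_bounded_one h.2
    (fun h => hv0 (congr_fun h 0)) (not_bounded_one a b c),
    fun ⟨hbc, hbc'⟩ => ⟨nontrivial_of_ne _ _ hv0, fun N hN _ => ?_⟩⟩
  exact (isFlatFamily_v a b c).eq_bot_or_eq_top (span_familyVector_v a b c) hbc hbc' hN

end RModule

namespace RamondRep

variable {V : Type*} [AddCommGroup V] [Module ℂ V] (A : RamondRep ℂ V) (x : ℤ → V)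

/-- The linear map from `R_{a,b,c}` carrying `v_i` to `x i`, `v_i^+` to `G_0^+ x i`, and so on. -/
noncomputable def familyMap : RSpace →ₗ[ℂ] V :=
  Finsupp.linearCombination ℂ (A.familyVector x)

theorem familyMap_single (k : RModIndex) :
    A.familyMap x (Finsupp.single k 1) = A.familyVector x k := by
  simp [familyMap]

end RamondRep

namespace SuperModule

open RamondRep

variable {V : Type*} [AddCommGroup V] [Module ℂ V] {M : SuperModule Ramond V}
  {hC : ∀ v, M.act Ramond.C v = 0} {τ : ZMod 2} {a b c : ℂ} {x : ℤ → V}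
  (h : (M.toRamondRep hC).IsFlatFamily τ a b c x)

include h

theorem act_single_familyVector (i : RamondIndex) (k : RModIndex) :
    M.act (Finsupp.single i 1) ((M.toRamondRep hC).familyVector x k) =
      (M.toRamondRep hC).familyMap x (RSpace.actBasis a b c i k) := by
  have hv (k) : (M.toRamondRep hC).familyMap x (RSpace.v k) = _ := familyMap_single _ x (.v k)
  have hvp (k) : (M.toRamondRep hC).familyMap x (RSpace.vp k) = _ := familyMap_single _ x (.vp k)
  have hvm (k) : (M.toRamondRep hC).familyMap x (RSpace.vm k) = _ := familyMap_single _ x (.vm k)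
  have hvpm (k) : (M.toRamondRep hC).familyMap x (RSpace.vpm k) = _ :=
    familyMap_single _ x (.vpm k)
  cases i <;> cases k <;>
    simp only [RSpace.actBasis, map_add, map_sub, map_neg, map_smul, map_zero, hv, hvp, hvm, hvpm]
  exacts [h.L_apply .., h.L_P .., h.L_Q .., h.L_P_Q .., h.H_apply .., h.H_P .., h.H_Q ..,
    h.H_P_Q .., h.P_apply .., h.P_P .., h.P_Q .., h.P_P_Q .., h.Q_apply .., h.Q_P .., h.Q_Q ..,
    h.Q_P_Q .., hC _, hC _, hC _, hC _]

theorem act_familyMap (g : Ramond) (w : RSpace) :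
    M.act g ((M.toRamondRep hC).familyMap x w) =
      (M.toRamondRep hC).familyMap x ((RModule a b c).act g w) := by
  suffices M.act.compl₂ ((M.toRamondRep hC).familyMap x) =
      (RSpace.act a b c).compr₂ ((M.toRamondRep hC).familyMap x) from
    LinearMap.congr_fun₂ this g w
  refine Finsupp.lhom_ext' fun i => LinearMap.ext_ring (Finsupp.lhom_ext' fun k =>
    LinearMap.ext_ring ?_)
  change M.act (Finsupp.single i 1) (familyMap _ x (Finsupp.single k 1)) =
    familyMap _ x (RSpace.act a b c (Finsupp.single i 1) (Finsupp.single k 1))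
  rw [familyMap_single, RSpace.act_single, act_single_familyVector h]

theorem familyMap_mem_part {σ : ZMod 2} {w : RSpace} (hw : w ∈ RSpace.part σ) :
    (M.toRamondRep hC).familyMap x w ∈ M.part (τ + σ) := by
  refine RSpace.part_induction (p := fun w => familyMap _ x w ∈ M.part (τ + σ)) ?_ ?_ ?_ ?_ hw
  · rintro k rfl
    exact (familyMap_single _ x k).symm ▸ h.familyVector_mem_part k
  · exact (map_zero (familyMap _ x)).symm ▸ zero_mem _
  · exact fun w w' hw hw' => (map_add (familyMap _ x) w w').symm ▸ add_mem hw hw'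
  · exact fun t w hw => (map_smul (familyMap _ x) t w).symm ▸ Submodule.smul_mem _ t hw

theorem isomorphic_RModule (hM : M.IsSimple) (hx : x ≠ 0) (hbc : 2 * b + c ≠ 2)
    (hbc' : 2 * b - c ≠ 2) :
    M.Isomorphic (RModule a b c) ∨ M.Isomorphic (RModule a b c).parityChange := by
  have hker : LinearMap.ker ((M.toRamondRep hC).familyMap x) = ⊥ := by
    have hsub (g : Ramond) (w) (hw : w ∈ LinearMap.ker ((M.toRamondRep hC).familyMap x)) :
        (RModule a b c).act g w ∈ LinearMap.ker ((M.toRamondRep hC).familyMap x) := by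
      rw [LinearMap.mem_ker, ← act_familyMap h, LinearMap.mem_ker.1 hw, map_zero]
    refine ((RModule.isFlatFamily_v a b c).eq_bot_or_eq_top (RModule.span_familyVector_v a b c)
      hbc hbc' ⟨fun m => hsub _, fun m => hsub _, fun m => hsub _, fun m => hsub _⟩).resolve_right
      fun htop => hx (funext fun i => ?_)
    exact (familyMap_single _ x (.v i)).symm.trans
      (LinearMap.mem_ker.1 (htop.ge Submodule.mem_top))
  have hrange : LinearMap.range ((M.toRamondRep hC).familyMap x) = ⊤ := by
    rw [familyMap, Finsupp.range_linearCombination,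
      h.span_familyVector_eq_top ((isSimple_iff hC).1 hM).2 hx]
  let e := LinearEquiv.ofBijective _ ⟨LinearMap.ker_eq_bot.1 hker, LinearMap.range_eq_top.1 hrange⟩
  rcases (by decide : ∀ s : ZMod 2, s = 0 ∨ s = 1) τ with rfl | rfl
  · refine .inl (Isomorphic.symm ⟨e, fun σ v hv => ?_, fun g v => (act_familyMap h g v).symm⟩)
    exact zero_add σ ▸ familyMap_mem_part h hv
  · refine .inr (Isomorphic.symm ⟨e, fun σ v hv => ?_, fun g v => (act_familyMap h g v).symm⟩)
    have hmem := familyMap_mem_part h hv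
    rwa [add_left_comm, CharTwo.add_self_eq_zero, add_zero] at hmem

end SuperModule

theorem proposition4p6_general {V : Type*} [AddCommGroup V] [Module ℂ V] {M : SuperModule Ramond V}
    (hM : M.IsSimple) (hc : M.IsCuspidal) (hd : ¬ M.IsDimBound 1) :
    ∃ a b c : ℂ, 2 * b + c ≠ 2 ∧ 2 * b - c ≠ 2 ∧
      (M.Isomorphic (RModule a b c) ∨ M.Isomorphic (RModule a b c).parityChange) := by
  have hC := hc.act_C_eq_zero hM
  obtain ⟨hw, d, -, hdim⟩ := hc
  have hA := ((SuperModule.isSimple_iff hC).1 hM).2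
  have hV : 1 < Module.rank ℂ V := lt_of_not_ge fun hV => hd ⟨one_pos, fun _ _ =>
    (Submodule.rank_le _).trans (hV.trans_eq Nat.cast_one.symm)⟩
  obtain ⟨τ, a, b, c, x, h, hx⟩ := hA.exists_isFlatFamily hw hdim hV
  obtain ⟨hbc, hbc'⟩ := h.ne_and_ne_of_not_bounded_one hA hx fun hd' => hd ⟨one_pos, hd'⟩
  exact ⟨a, b, c, hbc, hbc', SuperModule.isomorphic_RModule h hM hx hbc hbc'⟩

theorem proposition4p6 :
    (∀ (V : Type*) [AddCommGroup V] [Module ℂ V] (M : SuperModule Ramond V),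
      M.IsSimple → M.IsCuspidal → M.HasLength 2 →
        ∃ a b c : ℂ, 2 * b + c ≠ 2 ∧ 2 * b - c ≠ 2 ∧
          (M.Isomorphic (RModule a b c) ∨ M.Isomorphic (RModule a b c).parityChange)) ∧
    (∀ (a b c : ℂ) (m r i k : ℤ),
      (RModule a b c).act (Ramond.L m) (RSpace.v i) = (a + i + b * m) • RSpace.v (m + i) ∧
      (RModule a b c).act (Ramond.L m) (RSpace.vp k) = (a + k + (b - 1 / 2) * m) • RSpace.vp (m + k) ∧
      (RModule a b c).act (Ramond.L m) (RSpace.vm k) = (a + k + (b - 1 / 2) * m) • RSpace.vm (m + k) ∧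
      (RModule a b c).act (Ramond.H m) (RSpace.v i) = c • RSpace.v (m + i) ∧
      (RModule a b c).act (Ramond.H m) (RSpace.vp k) = (c + 1) • RSpace.vp (m + k) ∧
      (RModule a b c).act (Ramond.H m) (RSpace.vm k) = (c - 1) • RSpace.vm (m + k) ∧
      (RModule a b c).act (Ramond.Gp r) (RSpace.v i) = RSpace.vp (r + i) ∧
      (RModule a b c).act (Ramond.Gm r) (RSpace.v i) = RSpace.vm (r + i) ∧
      (RModule a b c).act (Ramond.Gp r) (RSpace.vp i) = 0 ∧
      (RModule a b c).act (Ramond.Gm r) (RSpace.vm i) = 0 ∧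
      (RModule a b c).act (Ramond.L m) (RSpace.vpm i) = (a + i + (b - 1) * m) • RSpace.vpm (m + i) +
        (1 / 2 * (2 * b - c - 2) * (m : ℂ) ^ 2) • RSpace.v (i + m) ∧
      (RModule a b c).act (Ramond.H m) (RSpace.vpm i) =
        c • RSpace.vpm (m + i) - ((m : ℂ) * (2 * b - c - 2)) • RSpace.v (m + i) ∧
      (RModule a b c).act (Ramond.Gp r) (RSpace.vm k) = RSpace.vpm (k + r) + ((c + 2 - 2 * b) * r) • RSpace.v (k + r) ∧
      (RModule a b c).act (Ramond.Gm r) (RSpace.vp k) =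
        -RSpace.vpm (r + k) - (2 * a + 2 * k + (2 * b + c) * r) • RSpace.v (k + r) ∧
      (RModule a b c).act (Ramond.Gm r) (RSpace.vpm i) =
        -(2 * a + 2 * i + (2 * b + c - 2) * r) • RSpace.vm (r + i) ∧
      (RModule a b c).act (Ramond.Gp r) (RSpace.vpm i) = ((2 * b - c - 2) * r) • RSpace.vp (r + i) ∧
      (RModule a b c).act Ramond.C (RSpace.v i) = 0 ∧ (RModule a b c).act Ramond.C (RSpace.vp i) = 0 ∧
      (RModule a b c).act Ramond.C (RSpace.vm i) = 0 ∧ (RModule a b c).act Ramond.C (RSpace.vpm i) = 0) ∧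
    (∀ a b c : ℂ, (RModule a b c).IsSimple ↔ 2 * b + c ≠ 2 ∧ 2 * b - c ≠ 2) := by
  refine ⟨fun V _ _ M hM hc h2 =>
      proposition4p6_general hM hc fun h => absurd (h2.2 h) (by norm_num),
    fun a b c m r i k => ?_, fun a b c => RModule.isSimple_iff⟩
  refine ⟨RSpace.act_L_v .., RSpace.act_L_vp .., RSpace.act_L_vm .., RSpace.act_H_v ..,
    RSpace.act_H_vp .., RSpace.act_H_vm .., RSpace.act_Gp_v .., RSpace.act_Gm_v ..,
    RSpace.act_Gp_vp .., RSpace.act_Gm_vm .., ?_, RSpace.act_H_vpm .., ?_, ?_,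
    RSpace.act_Gm_vpm .., RSpace.act_Gp_vpm .., RSpace.act_C .., RSpace.act_C ..,
    RSpace.act_C .., RSpace.act_C ..⟩
  · rw [add_comm i m]; exact RSpace.act_L_vpm ..
  · rw [add_comm k r]; exact RSpace.act_Gp_vm ..
  · rw [add_comm k r]; exact RSpace.act_Gm_vp ..
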